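/- Let $k\ge 1$, let ${\bf n}=(n_1,\dots,n_k)$ and ${\bf m}=(m_1,\dots,m_k)$ be tuples of positive integers, let $\mathcal K$ be a complex Hilbert space and $\mathcal H$ a separable infinite-dimensional complex Hilbert space. *Poly-hyperball.* For a Hilbert space $\mathcal E$, the poly-hyperball ${\bf D}_{\bf n}^{\bf m}(\mathcal E)$ is the set of all tuples ${\bf X}=(X_{i,j})_{1\le i\le k,\,1\le j\le n_i}$ of operators in $B(\mathcal E)$ such that $X_{p,a}X_{q,b}=X_{q,b}X_{p,a}$ whenever $p\ne q$, and $${\bf \Delta}^{\bf p}_{\bf X}(I):=(\mathrm{id}-\Phi_{X_1})^{p_1}\circ\cdots\circ(\mathrm{id}-\Phi_{X_k})^{p_k}(I)\ge 0\quad\text{for all }{\bf 0}\le{\bf p}\le{\bf m},\qquad \Phi_{X_i}(Y)=\sum_{j=1}^{n_i}X_{i,j}YX_{i,j}^*.$$ Its radial part is ${\bf D}_{{\bf n},rad}^{\bf m}(\mathcal E)=\bigcup_{0\le r<1}r\,{\bf D}_{\bf n}^{\bf m}(\mathcal E)$. For $\boldsymbol\alpha=(\alpha_1,\dots,\alpha_k)$,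 where $\alpha_i$ is a word in the free semigroup $\mathbb F_{n_i}^+$, put ${\bf X}_{\boldsymbol\alpha}=X_{1,\alpha_1}\cdots X_{k,\alpha_k}$, where $X_{i,\alpha}=X_{i,j_1}\cdots X_{i,j_q}$ for $\alpha=g_{j_1}\cdots g_{j_q}$. Let $\mathcal J$ be the set of pairs $(\boldsymbol\alpha,\boldsymbol\beta)$ such that, for some $s\in\mathbb Z^k$, $|\alpha_i|=s_i^+$ and $|\beta_i|=s_i^-$ for all $i$. *Universal model.* Let $F^2(H_{n})$ be the full Fock space with orthonormal basis $\{e_\alpha:\alpha\in\mathbb F_n^+\}$, let $\mathcal F=\bigotimes_{i=1}^kF^2(H_{n_i})$, $e_{\boldsymbol\alpha}=e_{\alpha_1}\otimes\cdots\otimes e_{\alpha_k}$, and $b^{(m)}_{\alpha}=\binom{|\alpha|+m-1}{m-1}$. The operator ${\bf W}_{i,j}$ on $\mathcal F$ acts on the $i$-th tensor factor by $e_\alpha\mapsto\sqrt{b^{(m_i)}_{\alpha}/b^{(m_i)}_{g_j\alpha}}\;e_{g_j\alpha}$ and as the identity on the others, and ${\bf W}=({\bf W}_{i,j})$. *Berezin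 transform.* For ${\bf X}\in{\bf D}_{{\bf n},rad}^{\bf m}(\mathcal E)$ let ${\bf K_X}:\mathcal E\to\mathcal F\otimes\mathcal E$ be the operator $${\bf K_X}h=\sum_{\boldsymbol\beta}\sqrt{b^{(m_1)}_{\beta_1}}\cdots\sqrt{b^{(m_k)}_{\beta_k}}\;e_{\boldsymbol\beta}\otimes{\bf \Delta}^{\bf m}_{\bf X}(I)^{1/2}{\bf X}_{\boldsymbol\beta}^*h,$$ and for $T\in B(\mathcal K\otimes\mathcal F)$ put $\widetilde{\bf B}_{\bf X}[T]=(I_{\mathcal K}\otimes{\bf K}_{\bf X}^*)(T\otimes I_{\mathcal E})(I_{\mathcal K}\otimes{\bf K_X})$. *Free $k$-pluriharmonic functions.* A function $F:{\bf D}_{{\bf n},rad}^{\bf m}(\mathcal H)\to B(\mathcal K)\otimes_{min}B(\mathcal H)$ is called free $k$-pluriharmonic if there are operators $A_{(\boldsymbol\alpha,\boldsymbol\beta)}\in B(\mathcal K)$, $(\boldsymbol\alpha,\boldsymbol\beta)\in\mathcal J$, such that $$F({\bf X})=\sum_{s_1\in\mathbb Z}\cdots\sum_{s_k\in\mathbb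 Z}\ \sum_{|\alpha_i|=s_i^+,\,|\beta_i|=s_i^-}A_{(\boldsymbol\alpha,\boldsymbol\beta)}\otimes{\bf X}_{\boldsymbol\alpha}{\bf X}_{\boldsymbol\beta}^*$$ for all ${\bf X}\in{\bf D}_{{\bf n},rad}^{\bf m}(\mathcal H)$, with convergence in the operator norm (where $\sum_{s\in\mathbb Z}$ is $\lim_{N\to\infty}\sum_{|s|\le N}$). Its value $F({\bf X})$ at a tuple ${\bf X}\in{\bf D}_{{\bf n},rad}^{\bf m}(\mathcal E)$ on another Hilbert space $\mathcal E$, in particular $F(r{\bf W})$ for $0\le r<1$, is the sum of the same series. **Theorem.** Let $\boldsymbol{\mathcal G}\subset B(\mathcal K\otimes\mathcal F)$ be the norm-closed linear span of $\{C\otimes{\bf W}_{\boldsymbol\alpha}{\bf W}_{\boldsymbol\beta}^*:\ C\in B(\mathcal K),\ (\boldsymbol\alpha,\boldsymbol\beta)\in\mathcal J\}$. For a function $F:{\bf D}_{{\bf n},rad}^{\bf m}(\mathcal H)\to B(\mathcal K)\otimes_{min}B(\mathcal H)$ the following statements are equivalent. 1. $F$ is free $k$-pluriharmonic and $F(r{\bf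 W})$ converges in the operator norm as $r\to1$. 2. There is $T\in\boldsymbol{\mathcal G}$ such that $F({\bf X})=\widetilde{\bf B}_{\bf X}[T]$ for all ${\bf X}\in{\bf D}_{{\bf n},rad}^{\bf m}(\mathcal H)$. 3. $F$ is free $k$-pluriharmonic and has a norm-continuous extension to ${\bf D}_{\bf n}^{\bf m}(\mathcal H)$. In this case, for $T$ as in (2), $T=\lim_{r\to1}F(r{\bf W})$ in the operator norm. Moreover, let ${\bf PH}^c_{\mathcal K}$ be the space of all free $k$-pluriharmonic functions $F$ which, for every Hilbert space $\mathcal E$, are defined on ${\bf D}_{{\bf n},rad}^{\bf m}(\mathcal E)$ and have norm-continuous extensions to ${\bf D}_{\bf n}^{\bf m}(\mathcal E)$, with the matrix norms $\|[F_{ij}]\|_p=\sup\|[F_{ij}({\bf X})]_{p\times p}\|$, the supremum being over all Hilbert spaces $\mathcal E$ and all ${\bf X}\in{\bf D}_{{\bf n},rad}^{\bf m}(\mathcal E)$. Then the map $\Phi:{\bf PH}^c_{\mathcal K}\to\boldsymbol{\mathcal G}$, $\Phi(F)=\lim_{r\to1}F(r{\bf W})$, is a completely isometric isomorphism: it is a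 linear bijection, and $\|[\Phi(F_{ij})]\|=\|[F_{ij}]\|_p$ for all $p$ and all $p\times p$ matrices $[F_{ij}]$ over ${\bf PH}^c_{\mathcal K}$. -/

import Mathlib

open Filter Topology
open scoped TensorProduct

noncomputable section

namespace PolyHyperball

/-! ### Hilbert space tensor products -/

section HilbertTensor

variable {E F E' F' G : Type*}
  [NormedAddCommGroup E] [InnerProductSpace ℂ E]
  [NormedAddCommGroup F] [InnerProductSpace ℂ F]
  [NormedAddCommGroup E'] [InnerProductSpace ℂ E']
  [NormedAddCommGroup F'] [InnerProductSpace ℂ F']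
  [NormedAddCommGroup G] [InnerProductSpace ℂ G]

variable (E F) in
/-- The Hilbert tensor product `E ⊗ F`: the completion of the algebraic tensor product for
`⟪x ⊗ y, x' ⊗ y'⟫ = ⟪x, x'⟫ ⟪y, y'⟫`. -/
abbrev HTensor : Type _ := UniformSpace.Completion (E ⊗[ℂ] F)

/-- The elementary tensor `x ⊗ y` in the Hilbert tensor product. -/
def htmul (x : E) (y : F) : HTensor E F := ((x ⊗ₜ[ℂ] y : E ⊗[ℂ] F) : HTensor E F)

/-- The bounded operator `A ⊗ B` between Hilbert tensor products. -/
def opTensor (A : E →L[ℂ] E') (B : F →L[ℂ] F') : HTensor E F →L[ℂ] HTensor E' F' :=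
  (TensorProduct.mapL A B).completion

lemma opTensor_htmul (A : E →L[ℂ] E') (B : F →L[ℂ] F') (x : E) (y : F) :
    opTensor A B (htmul x y) = htmul (A x) (B y) := by
  simp [opTensor, htmul]

lemma opTensor_add_left (A A' : E →L[ℂ] E') (B : F →L[ℂ] F') :
    opTensor (A + A') B = opTensor A B + opTensor A' B := by
  refine ContinuousLinearMap.ext fun v => ?_
  induction v using UniformSpace.Completion.induction_on with
  | hp => exact isClosed_eq (ContinuousLinearMap.continuous _) (ContinuousLinearMap.continuous _)
  | ih v =>
    simp only [opTensor, TensorProduct.mapL_add_left, add_apply,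
      ContinuousLinearMap.completion_apply_coe, UniformSpace.Completion.coe_add]

lemma opTensor_smul_left (c : ℂ) (A : E →L[ℂ] E') (B : F →L[ℂ] F') :
    opTensor (c • A) B = c • opTensor A B := by
  refine ContinuousLinearMap.ext fun v => ?_
  induction v using UniformSpace.Completion.induction_on with
  | hp => exact isClosed_eq (ContinuousLinearMap.continuous _) (ContinuousLinearMap.continuous _)
  | ih v =>
    simp only [opTensor, TensorProduct.mapL_smul_left, smul_apply,
      ContinuousLinearMap.completion_apply_coe, UniformSpace.Completion.coe_smul]

lemma opTensor_zero_left (B : F →L[ℂ] F') : opTensor (0 : E →L[ℂ] E') B = 0 := by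
  have h := opTensor_add_left (0 : E →L[ℂ] E') 0 B
  rw [add_zero] at h
  exact left_eq_add.mp h

variable (E F G) in
/-- The canonical map of `E ⊗ (F ⊗ G)` (algebraic) to its iterated Hilbert completion. -/
def toHTensorRight : E ⊗[ℂ] (F ⊗[ℂ] G) →ₗᵢ[ℂ] HTensor E (HTensor F G) :=
  UniformSpace.Completion.toComplₗᵢ.comp
    (LinearIsometry.lTensor E (UniformSpace.Completion.toComplₗᵢ (𝕜 := ℂ) (E := F ⊗[ℂ] G)))

variable (E F G) in
/-- The canonical map of `(E ⊗ F) ⊗ G` (algebraic) to its iterated Hilbert completion. -/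
def toHTensorLeft : (E ⊗[ℂ] F) ⊗[ℂ] G →ₗᵢ[ℂ] HTensor (HTensor E F) G :=
  UniformSpace.Completion.toComplₗᵢ.comp
    (LinearIsometry.rTensor G (UniformSpace.Completion.toComplₗᵢ (𝕜 := ℂ) (E := E ⊗[ℂ] F)))

lemma toHTensorRight_tmul (x : E) (y : F) (z : G) :
    toHTensorRight E F G (x ⊗ₜ (y ⊗ₜ z)) = htmul x (htmul y z) := by
  simp [toHTensorRight, htmul]

lemma toHTensorLeft_tmul (x : E) (y : F) (z : G) :
    toHTensorLeft E F G ((x ⊗ₜ y) ⊗ₜ z) = htmul (htmul x y) z := by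
  simp [toHTensorLeft, htmul]

lemma denseRange_toHTensorRight : DenseRange (toHTensorRight E F G) := by
  have key : DenseRange (LinearIsometry.lTensor E
      (UniformSpace.Completion.toComplₗᵢ (𝕜 := ℂ) (E := F ⊗[ℂ] G))) := by
    intro x
    rw [← LinearIsometry.coe_toLinearMap, ← LinearMap.coe_range,
      ← Submodule.topologicalClosure_coe, SetLike.mem_coe]
    induction x with
    | zero => exact Submodule.zero_mem _
    | add x y hx hy => exact Submodule.add_mem _ hx hy
    | tmul a b =>
      induction b using UniformSpace.Completion.induction_on with
      | hp =>
        refine (Submodule.isClosed_topologicalClosure _).preimage ?_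
        exact (TensorProduct.mkL ℂ E (HTensor F G) a).continuous
      | ih b =>
        refine Submodule.le_topologicalClosure _ ⟨a ⊗ₜ b, ?_⟩
        simp
  exact UniformSpace.Completion.denseRange_coe.comp key
    (UniformSpace.Completion.continuous_coe _)

lemma denseRange_toHTensorLeft : DenseRange (toHTensorLeft E F G) := by
  have key : DenseRange (LinearIsometry.rTensor G
      (UniformSpace.Completion.toComplₗᵢ (𝕜 := ℂ) (E := E ⊗[ℂ] F))) := by
    intro x
    rw [← LinearIsometry.coe_toLinearMap, ← LinearMap.coe_range,
      ← Submodule.topologicalClosure_coe, SetLike.mem_coe]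
    induction x with
    | zero => exact Submodule.zero_mem _
    | add x y hx hy => exact Submodule.add_mem _ hx hy
    | tmul a b =>
      induction a using UniformSpace.Completion.induction_on with
      | hp =>
        refine (Submodule.isClosed_topologicalClosure _).preimage ?_
        exact ((TensorProduct.mkL ℂ (HTensor E F) G).flip b).continuous
      | ih a =>
        refine Submodule.le_topologicalClosure _ ⟨a ⊗ₜ b, ?_⟩
        simp
  exact UniformSpace.Completion.denseRange_coe.comp key
    (UniformSpace.Completion.continuous_coe _)

variable (E F G) in
/-- The associativity unitary `E ⊗ (F ⊗ G) ≃ (E ⊗ F) ⊗ G` of Hilbert tensor products. -/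
def hassoc : HTensor E (HTensor F G) ≃ₗᵢ[ℂ] HTensor (HTensor E F) G :=
  (TensorProduct.assoc ℂ E F G).symm.extendOfIsometry
    (toHTensorRight E F G).toLinearMap (toHTensorLeft E F G).toLinearMap
    denseRange_toHTensorRight denseRange_toHTensorLeft
    (fun x => by
      rw [LinearIsometry.coe_toLinearMap, LinearIsometry.coe_toLinearMap,
        LinearIsometry.norm_map, LinearIsometry.norm_map]
      exact (TensorProduct.assocIsometry ℂ E F G).symm.norm_map x)

lemma hassoc_htmul (x : E) (y : F) (z : G) :
    hassoc E F G (htmul x (htmul y z)) = htmul (htmul x y) z := by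
  rw [← toHTensorRight_tmul, ← toHTensorLeft_tmul]
  exact LinearEquiv.extendOfIsometry_eq _ _ _ _ _ _ (x ⊗ₜ (y ⊗ₜ z))

variable (E F) in
/-- `B(E) ⊗_min B(F)`: the norm closure in `B(E ⊗ F)` of the span of the operators `A ⊗ B`. -/
def minTensor : Submodule ℂ (HTensor E F →L[ℂ] HTensor E F) :=
  (Submodule.span ℂ {T | ∃ (A : E →L[ℂ] E) (B : F →L[ℂ] F), T = opTensor A B}).topologicalClosure

/-- A `p × p` matrix of operators on `E`, as an operator on the Hilbert direct sum `E^p`. -/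
def matrixOp {p : ℕ} (M : Fin p → Fin p → (E →L[ℂ] E)) :
    PiLp 2 (fun _ : Fin p => E) →L[ℂ] PiLp 2 (fun _ : Fin p => E) :=
  ((PiLp.continuousLinearEquiv 2 ℂ (fun _ : Fin p => E)).symm :
      (Fin p → E) →L[ℂ] PiLp 2 (fun _ : Fin p => E)) ∘L
    (ContinuousLinearMap.pi fun i => ∑ j, M i j ∘L ContinuousLinearMap.proj j) ∘L
    (PiLp.continuousLinearEquiv 2 ℂ (fun _ : Fin p => E) :
      PiLp 2 (fun _ : Fin p => E) →L[ℂ] (Fin p → E))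

lemma matrixOp_apply {p : ℕ} (M : Fin p → Fin p → (E →L[ℂ] E))
    (x : PiLp 2 (fun _ : Fin p => E)) (i : Fin p) : matrixOp M x i = ∑ j, M i j (x j) := by
  simp [matrixOp]

end HilbertTensor

/-! ### Words, Fock spaces and the universal model -/

section Fock

variable {k : ℕ}

/-- `k`-tuples `(α₁, …, α_k)` of words, `αᵢ` in the free semigroup on `nᵢ` generators.  A word is
the list of (the indices of) its letters. -/
abbrev MultiWord (n : Fin k → ℕ) : Type := ∀ i : Fin k, List (Fin (n i))

/-- The weight `b^{(m)}_β = binom(|β| + m - 1, m - 1)` as a function of the length of `β`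
(used for `m ≥ 1` only). -/
def weight (m p : ℕ) : ℝ := ((p + m - 1).choose (m - 1) : ℕ)

/-- The tensor product `F²(H_{n₁}) ⊗ ⋯ ⊗ F²(H_{n_k})` of full Fock spaces, realized as the `ℓ²`
space over its standard orthonormal basis `e_α = e_{α₁} ⊗ ⋯ ⊗ e_{α_k}`. -/
abbrev Fock (n : Fin k → ℕ) : Type := lp (fun _ : MultiWord n => ℂ) 2

/-- The basis vector `e_α = e_{α₁} ⊗ ⋯ ⊗ e_{α_k}`. -/
def fockBasis (n : Fin k → ℕ) (α : MultiWord n) : Fock n := lp.single 2 α (1 : ℂ)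

lemma orthonormal_fockBasis (n : Fin k → ℕ) : Orthonormal ℂ (fockBasis n) := by
  rw [orthonormal_iff_ite]
  intro α β
  simp only [fockBasis, lp.inner_single_left, lp.coeFn_single]
  by_cases h : α = β
  · subst h; simp
  · simp [h]

variable {n : Fin k → ℕ}

/-- Prepending the letter `g_j` to the `i`-th word. -/
def consAt (i : Fin k) (j : Fin (n i)) (α : MultiWord n) : MultiWord n :=
  Function.update α i (j :: α i)

lemma consAt_injective (i : Fin k) (j : Fin (n i)) : Function.Injective (consAt i j) := by
  intro α β h
  funext l
  have hl := congrFun h l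
  by_cases hli : l = i
  · subst hli
    simpa [consAt] using hl
  · simpa [consAt, hli] using hl

/-- The left creation operator `I ⊗ ⋯ ⊗ S_{i,j} ⊗ ⋯ ⊗ I`, `e_α ↦ e_{g_j α}` in the `i`-th slot. -/
def creation (i : Fin k) (j : Fin (n i)) : Fock n →L[ℂ] Fock n :=
  (((orthonormal_fockBasis n).comp _ (consAt_injective i j)).orthogonalFamily.linearIsometry
    ).toContinuousLinearMap

lemma creation_fockBasis (i : Fin k) (j : Fin (n i)) (α : MultiWord n) :
    creation i j (fockBasis n α) = fockBasis n (consAt i j α) := by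
  have h := ((orthonormal_fockBasis n).comp _
    (consAt_injective i j)).orthogonalFamily.linearIsometry_apply_single (i := α) (1 : ℂ)
  simpa [creation, fockBasis] using h

/-- The diagonal operator `e_α ↦ d(α) e_α`, for weights `d` with values in `[-1, 1]`. -/
def diagonal (d : MultiWord n → ℝ) (hd : ∀ α, |d α| ≤ 1) : Fock n →L[ℂ] Fock n :=
  have hle : ∀ (f : Fock n) (α : MultiWord n), ‖(d α : ℂ) * f α‖ ≤ ‖f α‖ := fun f α => by
    rw [norm_mul, Complex.norm_real, Real.norm_eq_abs]
    exact mul_le_of_le_one_left (norm_nonneg _) (hd α)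
  LinearMap.mkContinuous
    { toFun := fun f => ⟨fun α => (d α : ℂ) * f α, (lp.memℓp f).mono' (hle f)⟩
      map_add' := fun f g => by ext α; exact mul_add _ _ _
      map_smul' := fun c f => by ext α; exact mul_left_comm _ _ _ }
    1 (fun f => by
      rw [one_mul]
      exact lp.norm_mono (by norm_num) (hle f))

lemma diagonal_apply (d : MultiWord n → ℝ) (hd : ∀ α, |d α| ≤ 1) (f : Fock n) (α : MultiWord n) :
    diagonal d hd f α = (d α : ℂ) * f α := rfl

lemma abs_sqrt_weight_le (m p : ℕ) : |√(weight m p / weight m (p + 1))| ≤ 1 := by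
  rw [abs_of_nonneg (Real.sqrt_nonneg _)]
  refine Real.sqrt_le_one.mpr (div_le_one_of_le₀ ?_ (Nat.cast_nonneg _))
  exact Nat.cast_le.mpr (Nat.choose_le_choose _ (by omega))

/-- The universal model operator `𝐖_{i,j} = I ⊗ ⋯ ⊗ S_{i,j} D_{i,j} ⊗ ⋯ ⊗ I`, with
`D_{i,j} e_α = √(b_α / b_{g_j α}) e_α`. -/
def universalModel (n m : Fin k → ℕ) (i : Fin k) (j : Fin (n i)) : Fock n →L[ℂ] Fock n :=
  creation i j ∘L
    diagonal (fun α => √(weight (m i) (α i).length / weight (m i) ((α i).length + 1)))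
      (fun _ => abs_sqrt_weight_le _ _)

lemma universalModel_fockBasis (m : Fin k → ℕ) (i : Fin k) (j : Fin (n i)) (α : MultiWord n) :
    universalModel n m i j (fockBasis n α) =
      ((√(weight (m i) (α i).length / weight (m i) ((α i).length + 1)) : ℝ) : ℂ) •
        fockBasis n (consAt i j α) := by
  rw [← creation_fockBasis, ← map_smul, universalModel, ContinuousLinearMap.comp_apply]
  congr 1
  ext β
  rw [diagonal_apply, fockBasis, lp.coeFn_smul, Pi.smul_apply, lp.coeFn_single, smul_eq_mul]
  by_cases h : α = β
  · subst h; rfl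
  · simp [h]

end Fock

/-! ### The poly-hyperball -/

section Ball

variable {k : ℕ}

/-- `B(E)^{n₁} × ⋯ × B(E)^{n_k}`, with the norm topology. -/
abbrev OpTuple (n : Fin k → ℕ) (E : Type*) [NormedAddCommGroup E] [InnerProductSpace ℂ E] :
    Type _ := ∀ i : Fin k, Fin (n i) → (E →L[ℂ] E)

variable {n : Fin k → ℕ} {E : Type*} [NormedAddCommGroup E] [InnerProductSpace ℂ E]

/-- `X_α = X_{1,α₁} ⋯ X_{k,α_k}`, where `X_{i,α} = X_{i,j₁} ⋯ X_{i,j_p}` for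
`α = g_{j₁} ⋯ g_{j_p}`. -/
def wordOp (X : OpTuple n E) (α : MultiWord n) : E →L[ℂ] E :=
  ((List.finRange k).map fun i => ((α i).map (X i)).prod).prod

variable [CompleteSpace E]

/-- `Φ_{X_i}(Y) = ∑_j X_{i,j} Y X_{i,j}^*`. -/
def cpMap (X : OpTuple n E) (i : Fin k) : Module.End ℂ (E →L[ℂ] E) :=
  ∑ j, LinearMap.mulLeftRight ℂ (X i j, (X i j).adjoint)

lemma cpMap_apply (X : OpTuple n E) (i : Fin k) (Y : E →L[ℂ] E) :
    cpMap X i Y = ∑ j, X i j * Y * (X i j).adjoint := by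
  simp [cpMap, LinearMap.sum_apply]

/-- The defect operator `Δ_X^p(I) = (id - Φ_{X_1})^{p_1} ∘ ⋯ ∘ (id - Φ_{X_k})^{p_k} (I)`. -/
def defect (X : OpTuple n E) (p : Fin k → ℕ) : E →L[ℂ] E :=
  ((List.finRange k).map fun i => (1 - cpMap X i) ^ p i).prod 1

end Ball

/-- The (closed) noncommutative poly-hyperball `𝐃_n^m(E)`. -/
def polyHyperball {k : ℕ} (n m : Fin k → ℕ) (E : Type*) [NormedAddCommGroup E]
    [InnerProductSpace ℂ E] [CompleteSpace E] : Set (OpTuple n E) :=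
  {X | (∀ p q : Fin k, p ≠ q → ∀ (a : Fin (n p)) (b : Fin (n q)), Commute (X p a) (X q b)) ∧
    ∀ p : Fin k → ℕ, p ≤ m → (defect X p).IsPositive}

/-- The radial part `⋃_{0 ≤ r < 1} r 𝐃_n^m(E)`. -/
def radialPart {k : ℕ} (n m : Fin k → ℕ) (E : Type*) [NormedAddCommGroup E]
    [InnerProductSpace ℂ E] [CompleteSpace E] : Set (OpTuple n E) :=
  {X | ∃ r : ℝ, 0 ≤ r ∧ r < 1 ∧ ∃ Y ∈ polyHyperball n m E, X = (r : ℂ) • Y}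

/-! ### Free `k`-pluriharmonic functions -/

/-- `x` is the sum of the iterated series `∑_{s₁ ∈ ℤ} ⋯ ∑_{s_k ∈ ℤ} f (s₁, …, s_k)`, where
`∑_{s ∈ ℤ} g s` means `lim_{N → ∞} ∑_{|s| ≤ N} g s`. -/
def HasIteratedSum {V : Type*} [AddCommMonoid V] [TopologicalSpace V] :
    (k : ℕ) → ((Fin k → ℤ) → V) → V → Prop
  | 0, f, x => f Fin.elim0 = x
  | k + 1, f, x => ∃ g : ℤ → V, (∀ s, HasIteratedSum k (fun t => f (Fin.cons s t)) (g s)) ∧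
      Tendsto (fun N : ℕ => ∑ s ∈ Finset.Icc (-(N : ℤ)) N, g s) atTop (𝓝 x)

lemma HasIteratedSum.add {V : Type*} [AddCommMonoid V] [TopologicalSpace V] [ContinuousAdd V] :
    ∀ {k : ℕ} {f f' : (Fin k → ℤ) → V} {x x' : V}, HasIteratedSum k f x →
      HasIteratedSum k f' x' → HasIteratedSum k (f + f') (x + x')
  | 0, f, f', x, x', h, h' => by
    simp only [HasIteratedSum] at h h' ⊢
    simp [h, h']
  | k + 1, f, f', x, x', ⟨g, hg, hx⟩, ⟨g', hg', hx'⟩ =>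
    ⟨g + g', fun s => HasIteratedSum.add (hg s) (hg' s), by
      simpa [Finset.sum_add_distrib] using hx.add hx'⟩

lemma HasIteratedSum.const_smul {V : Type*} [AddCommMonoid V] [TopologicalSpace V] [Module ℂ V]
    [ContinuousConstSMul ℂ V] (c : ℂ) :
    ∀ {k : ℕ} {f : (Fin k → ℤ) → V} {x : V}, HasIteratedSum k f x →
      HasIteratedSum k (c • f) (c • x)
  | 0, f, x, h => by
    simp only [HasIteratedSum] at h ⊢
    simp [h]
  | k + 1, f, x, ⟨g, hg, hx⟩ =>
    ⟨c • g, fun s => HasIteratedSum.const_smul c (hg s), by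
      simpa [Finset.smul_sum] using hx.const_smul c⟩

section Pluriharmonic

variable {k : ℕ} {n : Fin k → ℕ}
  {K : Type*} [NormedAddCommGroup K] [InnerProductSpace ℂ K]
  {E : Type*} [NormedAddCommGroup E] [InnerProductSpace ℂ E] [CompleteSpace E]

variable (n K) in
/-- Coefficient families `A_{(α,β)} ∈ B(K)`; only the values with `|αᵢ| = sᵢ⁺`, `|βᵢ| = sᵢ⁻` for
some `s ∈ ℤ^k` are ever used. -/
abbrev Coeffs : Type _ := MultiWord n → MultiWord n → (K →L[ℂ] K)

/-- `q_{s₁,…,s_k}(X, X^*) = ∑_{|αᵢ| = sᵢ⁺, |βᵢ| = sᵢ⁻} A_{(α,β)} ⊗ X_α X_β^*`. -/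
def homogeneousPart (A : Coeffs n K) (X : OpTuple n E) (s : Fin k → ℤ) :
    HTensor K E →L[ℂ] HTensor K E :=
  ∑ α : ∀ i, List.Vector (Fin (n i)) (s i).toNat,
    ∑ β : ∀ i, List.Vector (Fin (n i)) (-s i).toNat,
      opTensor (A (fun i => (α i).toList) (fun i => (β i).toList))
        (wordOp X (fun i => (α i).toList) ∘L (wordOp X (fun i => (β i).toList)).adjoint)

/-- The series with coefficients `A` converges in norm at `X`, with sum `Y`. -/
def HasValue (A : Coeffs n K) (X : OpTuple n E) (Y : HTensor K E →L[ℂ] HTensor K E) : Prop :=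
  HasIteratedSum k (homogeneousPart A X) Y

lemma HasValue.add {A B : Coeffs n K} {X : OpTuple n E} {Y Z : HTensor K E →L[ℂ] HTensor K E}
    (hY : HasValue A X Y) (hZ : HasValue B X Z) : HasValue (A + B) X (Y + Z) := by
  have h : homogeneousPart (A + B) X = homogeneousPart A X + homogeneousPart B X := by
    funext s
    simp only [homogeneousPart, Pi.add_apply, ← Finset.sum_add_distrib, opTensor_add_left]
  unfold HasValue
  rw [h]
  exact HasIteratedSum.add hY hZ

lemma HasValue.smul {A : Coeffs n K} {X : OpTuple n E} {Y : HTensor K E →L[ℂ] HTensor K E}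
    (c : ℂ) (hY : HasValue A X Y) : HasValue (c • A) X (c • Y) := by
  have h : homogeneousPart (c • A) X = c • homogeneousPart A X := by
    funext s
    simp only [homogeneousPart, Pi.smul_apply, Finset.smul_sum, opTensor_smul_left]
  unfold HasValue
  rw [h]
  exact HasIteratedSum.const_smul c hY

lemma HasValue.zero (X : OpTuple n E) : HasValue (0 : Coeffs n K) X 0 := by
  have h0 : homogeneousPart (0 : Coeffs n K) X = 0 := by
    funext s
    simp [homogeneousPart, opTensor_zero_left]
  have hz : ∀ k : ℕ, HasIteratedSum k (0 : (Fin k → ℤ) → HTensor K E →L[ℂ] HTensor K E) 0 := by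
    intro k
    induction k with
    | zero => rfl
    | succ k ih => exact ⟨0, fun s => ih, by simp⟩
  unfold HasValue
  rw [h0]
  exact hz k

variable {m : Fin k → ℕ}

/-- `F : 𝐃_{n,rad}^m(E) → B(K) ⊗_min B(E)` is the representation on `E` of the free
`k`-pluriharmonic function with coefficients `A`. -/
def Represents (A : Coeffs n K) (F : radialPart n m E → minTensor K E) : Prop :=
  ∀ X : radialPart n m E, HasValue A X.1 (F X)

/-- `F` is a free `k`-pluriharmonic function on the radial poly-hyperball. -/
def IsFreePluriharmonic (F : radialPart n m E → minTensor K E) : Prop :=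
  ∃ A : Coeffs n K, Represents A F

/-- `Y = F(X)`, for a free `k`-pluriharmonic function `F` (given on the space `E`) and a tuple `X`
of operators on another Hilbert space `E'`. -/
def IsValueAt {E' : Type*} [NormedAddCommGroup E'] [InnerProductSpace ℂ E'] [CompleteSpace E']
    (F : radialPart n m E → minTensor K E) (X : OpTuple n E')
    (Y : HTensor K E' →L[ℂ] HTensor K E') : Prop :=
  ∃ A : Coeffs n K, Represents A F ∧ HasValue A X Y

/-- `F(r𝐖)` is defined for every `r ∈ [0,1)` and converges to `T` in norm as `r → 1`. -/
def HasRadialLimit (F : radialPart n m E → minTensor K E)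
    (T : HTensor K (Fock n) →L[ℂ] HTensor K (Fock n)) : Prop :=
  ∃ G : ℝ → (HTensor K (Fock n) →L[ℂ] HTensor K (Fock n)),
    (∀ r : ℝ, 0 ≤ r → r < 1 → IsValueAt F ((r : ℂ) • universalModel n m) (G r)) ∧
    Tendsto G (𝓝[<] 1) (𝓝 T)

/-- `F` has a norm continuous extension to `𝐃_n^m(E)`. -/
def HasContinuousExtension (F : radialPart n m E → minTensor K E) : Prop :=
  ∃ G : OpTuple n E → minTensor K E, ContinuousOn G (polyHyperball n m E) ∧
    ∀ X : radialPart n m E, G X.1 = F X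

variable (m) in
/-- `V` is the noncommutative Berezin kernel of `X`:
`V h = ∑_β √b_{β₁} ⋯ √b_{β_k} e_β ⊗ Δ_X^m(I)^{1/2} X_β^* h` for every `h`. -/
def IsBerezinKernel (X : OpTuple n E) (V : E →L[ℂ] HTensor (Fock n) E) : Prop :=
  ∀ h : E, HasSum (fun β : MultiWord n =>
    ((∏ i, √(weight (m i) (β i).length) : ℝ) : ℂ) •
      htmul (fockBasis n β) (CFC.sqrt (defect X m) ((wordOp X β).adjoint h))) (V h)

open Classical in
variable (m) in
/-- The noncommutative Berezin kernel `K_X : E → (⊗ᵢ F²(H_{nᵢ})) ⊗ E` (meaningful for `X` in the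
poly-hyperball, where the defining series converges to a contraction). -/
def berezinKernel (X : OpTuple n E) : E →L[ℂ] HTensor (Fock n) E :=
  if h : ∃ V, IsBerezinKernel m X V then h.choose else 0

variable (m) in
/-- The extended Berezin transform `(I_K ⊗ K_X^*) (T ⊗ I_E) (I_K ⊗ K_X)`. -/
def berezinTransform (X : OpTuple n E) (T : HTensor K (Fock n) →L[ℂ] HTensor K (Fock n)) :
    HTensor K E →L[ℂ] HTensor K E :=
  let V : HTensor K E →L[ℂ] HTensor (HTensor K (Fock n)) E :=
    ((hassoc K (Fock n) E : HTensor K (HTensor (Fock n) E) ≃L[ℂ] HTensor (HTensor K (Fock n)) E) :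
      HTensor K (HTensor (Fock n) E) →L[ℂ] HTensor (HTensor K (Fock n)) E) ∘L
      opTensor (ContinuousLinearMap.id ℂ K) (berezinKernel m X)
  V.adjoint ∘L opTensor T (ContinuousLinearMap.id ℂ E) ∘L V

end Pluriharmonic

section OperatorSpaces

universe u v

variable {k : ℕ} (n m : Fin k → ℕ) (K : Type v) [NormedAddCommGroup K] [InnerProductSpace ℂ K]

/-- `𝓖`: the norm closed span of the operators `C ⊗ 𝐖_α 𝐖_β^*`, where `C ∈ B(K)` and
`|αᵢ| = sᵢ⁺`, `|βᵢ| = sᵢ⁻` for some `s ∈ ℤ^k`. -/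
def modelSpace : Submodule ℂ (HTensor K (Fock n) →L[ℂ] HTensor K (Fock n)) :=
  (Submodule.span ℂ {T | ∃ (C : K →L[ℂ] K) (α β : MultiWord n) (s : Fin k → ℤ),
    (∀ i, (α i).length = (s i).toNat ∧ (β i).length = (-s i).toNat) ∧
    T = opTensor C (wordOp (universalModel n m) α ∘L
      (wordOp (universalModel n m) β).adjoint)}).topologicalClosure

variable (H : Type u) [NormedAddCommGroup H] [InnerProductSpace ℂ H] [CompleteSpace H]

/-- `PH_K^c`: the free `k`-pluriharmonic functions, identified with their representations on `H`,
which have norm continuous extensions to `𝐃_n^m(E)` for every Hilbert space `E`. -/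
def continuousPluriharmonic : Submodule ℂ (radialPart n m H → minTensor K H) where
  carrier := {F | ∃ A : Coeffs n K, Represents A F ∧
    ∀ (E : Type u) [NormedAddCommGroup E] [InnerProductSpace ℂ E] [CompleteSpace E],
      ∃ G : radialPart n m E → minTensor K E, Represents A G ∧ HasContinuousExtension G}
  zero_mem' := ⟨0, fun X => HasValue.zero X.1, fun E _ _ _ =>
    ⟨0, fun X => HasValue.zero X.1, 0, continuousOn_const, fun _ => rfl⟩⟩
  add_mem' := by
    rintro F F' ⟨A, hA, hF⟩ ⟨A', hA', hF'⟩
    refine ⟨A + A', fun X => (hA X).add (hA' X), fun E _ _ _ => ?_⟩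
    obtain ⟨G, hG, P, hPc, hP⟩ := hF E
    obtain ⟨G', hG', P', hPc', hP'⟩ := hF' E
    exact ⟨G + G', fun X => (hG X).add (hG' X), P + P', hPc.add hPc', fun X => by
      simp [hP, hP']⟩
  smul_mem' := by
    rintro c F ⟨A, hA, hF⟩
    refine ⟨c • A, fun X => (hA X).smul c, fun E _ _ _ => ?_⟩
    obtain ⟨G, hG, P, hPc, hP⟩ := hF E
    exact ⟨c • G, fun X => (hG X).smul c, c • P, hPc.const_smul c, fun X => by simp [hP]⟩

variable {n m K H}

/-- The numbers `‖[F_{ij}(X)]‖`, for all Hilbert spaces `E` and all `X` in the radial part of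
`𝐃_n^m(E)`; their supremum is the matrix norm `‖[F_{ij}]‖_p`. -/
def matrixValueNorms {p : ℕ} (F : Fin p → Fin p → (radialPart n m H → minTensor K H)) : Set ℝ :=
  {c | ∃ (E : Type u) (_ : NormedAddCommGroup E) (_ : InnerProductSpace ℂ E) (_ : CompleteSpace E)
    (X : OpTuple n E) (Y : Fin p → Fin p → (HTensor K E →L[ℂ] HTensor K E)),
    X ∈ radialPart n m E ∧ (∀ i j, IsValueAt (F i j) X (Y i j)) ∧ c = ‖matrixOp Y‖}

end OperatorSpaces

end PolyHyperball

end

open PolyHyperball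

open Filter Topology
open scoped TensorProduct

namespace PolyHyperball

set_option synthInstance.maxHeartbeats 200000

/-! ### Hilbert space tensor products of operators -/

section TensorOperators

variable {E F E' F' E'' F'' G : Type*}
  [NormedAddCommGroup E] [InnerProductSpace ℂ E]
  [NormedAddCommGroup F] [InnerProductSpace ℂ F]
  [NormedAddCommGroup E'] [InnerProductSpace ℂ E']
  [NormedAddCommGroup F'] [InnerProductSpace ℂ F']
  [NormedAddCommGroup E''] [InnerProductSpace ℂ E'']
  [NormedAddCommGroup F''] [InnerProductSpace ℂ F'']
  [NormedAddCommGroup G] [InnerProductSpace ℂ G]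

/-! The theorem is a Poisson-type correspondence between functions on the poly-hyperball and
boundary data in `𝓖`, carried by the Berezin transform. It rests on three facts.

Compression. On the radial part each `Φ_{X_i}` has norm less than one, so `∏ (id - Φ_{X_i})^{m_i}`
is inverted by a convergent series whose coefficients are the weights `b`. Applied to the defect
operator this series gives the identity, which says that `K_X` is an isometry
(`hasSum_cpMapL_defect`, `exists_isBerezinKernel`). The weights also make `K_X` intertwine
`X_{i,j}^*` with `𝐖_{i,j}^* ⊗ I` (`berezinKernel_comp_adjoint`). Hence the Berezin transform is
completely contractive and sends `C ⊗ 𝐖_α 𝐖_β^*` to `C ⊗ X_α X_β^*` (`berezinL_model`,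
`norm_matrixOp_berezinL_le`).

Fourier series. A generator of `𝓖` is detected by one matrix entry (`inner_model_matrix_entry`), so
every operator on `K ⊗ 𝓕` has coefficients. For `T ∈ 𝓖` the homogeneous parts are limits of averages
of Berezin transforms over rotated tuples and have norm at most `‖T‖`. At `X = tZ` the part of
degree `s` gains the factor `∏ t^{|s_i|}`, so the series converges absolutely, and its sum is the
Berezin transform (`hasValue_berezinL`).

Approximation. The transforms are contractions, so convergence on `𝓖` and continuous extension to
the closed ball need only be checked on generators, where the dependence on `X` is polynomial in the
entries and their adjoints.

If `F(r𝐖) → T`, then `F(rY)` is the transform of `F(t𝐖)` at `(r/t)Y`, and `t → 1` gives the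
transform of `T`. Conversely, `H` is unitarily equivalent to `𝓕`, so `𝐖` has a copy on `H` and a
continuous extension at that copy produces the radial limit. The same copy shows that values at `r𝐖`
depend only on `F`, whichever coefficients represent it, and that the supremum of the matrix norms
is attained in the limit `r → 1`; the opposite inequality is complete contractivity. -/

lemma inner_htmul (x x' : E) (y y' : F) :
    inner ℂ (htmul x y) (htmul x' y') = inner ℂ x x' * inner ℂ y y' := by
  simp [htmul, UniformSpace.Completion.inner_coe, TensorProduct.inner_tmul]

lemma norm_htmul (x : E) (y : F) : ‖htmul x y‖ = ‖x‖ * ‖y‖ := by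
  simp [htmul]

/-- `y ↦ x ⊗ y` as a bounded operator. -/
noncomputable def htmulL (x : E) : F →L[ℂ] HTensor E F :=
  UniformSpace.Completion.toComplL ∘L TensorProduct.mkL ℂ E F x

/-- `x ↦ x ⊗ y` as a bounded operator. -/
noncomputable def htmulR (y : F) : E →L[ℂ] HTensor E F :=
  UniformSpace.Completion.toComplL ∘L (TensorProduct.mkL ℂ E F).flip y

@[simp] lemma htmulL_apply (x : E) (y : F) : htmulL x y = htmul x y := rfl

@[simp] lemma htmulR_apply (x : E) (y : F) : htmulR y x = htmul x y := rfl

/-- Elementary tensors span a dense subspace of the completion, so bounded operators are determined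
by them. -/
lemma hext {A B : HTensor E F →L[ℂ] G} (h : ∀ x y, A (htmul x y) = B (htmul x y)) : A = B := by
  refine ContinuousLinearMap.ext fun v => ?_
  induction v using UniformSpace.Completion.induction_on with
  | hp => exact isClosed_eq A.continuous B.continuous
  | ih v =>
    induction v with
    | zero => simp [UniformSpace.Completion.coe_zero]
    | add x y hx hy => simp only [UniformSpace.Completion.coe_add, map_add, hx, hy]
    | tmul x y => exact h x y

lemma opTensor_comp (A : E' →L[ℂ] E'') (A' : E →L[ℂ] E') (B : F' →L[ℂ] F'') (B' : F →L[ℂ] F') :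
    opTensor (A ∘L A') (B ∘L B') = opTensor A B ∘L opTensor A' B' :=
  hext fun x y => by simp [opTensor_htmul]

lemma opTensor_id_id :
    opTensor (ContinuousLinearMap.id ℂ E) (ContinuousLinearMap.id ℂ F) = .id ℂ _ :=
  hext fun x y => by simp [opTensor_htmul]

lemma htmul_add (x : E) (y y' : F) : htmul x (y + y') = htmul x y + htmul x y' :=
  map_add (htmulL x) y y'

lemma htmul_smul (c : ℂ) (x : E) (y : F) : htmul x (c • y) = c • htmul x y :=
  map_smul (htmulL x) c y

lemma smul_htmul (c : ℂ) (x : E) (y : F) : htmul (c • x) y = c • htmul x y :=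
  map_smul (htmulR y) c x

lemma opTensor_add_right (A : E →L[ℂ] E') (B B' : F →L[ℂ] F') :
    opTensor A (B + B') = opTensor A B + opTensor A B' :=
  hext fun x y => by simp [opTensor_htmul, htmul_add]

lemma opTensor_smul_right (c : ℂ) (A : E →L[ℂ] E') (B : F →L[ℂ] F') :
    opTensor A (c • B) = c • opTensor A B :=
  hext fun x y => by simp [opTensor_htmul, htmul_smul]

lemma norm_opTensor_le (A : E →L[ℂ] E') (B : F →L[ℂ] F') : ‖opTensor A B‖ ≤ ‖A‖ * ‖B‖ := by
  refine ContinuousLinearMap.opNorm_le_bound _ (by positivity) fun v => ?_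
  induction v using UniformSpace.Completion.induction_on with
  | hp =>
    exact isClosed_le (opTensor A B).continuous.norm (continuous_const.mul continuous_norm)
  | ih v =>
    rw [opTensor, ContinuousLinearMap.completion_apply_coe, UniformSpace.Completion.norm_coe,
      UniformSpace.Completion.norm_coe]
    exact (TensorProduct.mapL A B).le_of_opNorm_le (TensorProduct.norm_mapL_le A B) v

variable (E E') in
/-- `A ↦ A ⊗ B` as a linear map. -/
noncomputable def opTensorLeftₗ (B : F →L[ℂ] F') :
    (E →L[ℂ] E') →ₗ[ℂ] HTensor E F →L[ℂ] HTensor E' F' where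
  toFun := fun A => opTensor A B
  map_add' := fun A A' => opTensor_add_left A A' B
  map_smul' := fun c A => opTensor_smul_left c A B

variable (E E') in
/-- `A ↦ A ⊗ B` as a bounded operator. -/
noncomputable def opTensorLeft (B : F →L[ℂ] F') :
    (E →L[ℂ] E') →L[ℂ] HTensor E F →L[ℂ] HTensor E' F' :=
  { opTensorLeftₗ E E' B with
    cont := AddMonoidHomClass.continuous_of_bound (opTensorLeftₗ E E' B) ‖B‖ fun A => by
      rw [mul_comm]
      exact norm_opTensor_le A B }

variable (F F') in
/-- `B ↦ A ⊗ B` as a linear map. -/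
noncomputable def opTensorRightₗ (A : E →L[ℂ] E') :
    (F →L[ℂ] F') →ₗ[ℂ] HTensor E F →L[ℂ] HTensor E' F' where
  toFun := fun B => opTensor A B
  map_add' := fun B B' => opTensor_add_right A B B'
  map_smul' := fun c B => opTensor_smul_right c A B

variable (F F') in
/-- `B ↦ A ⊗ B` as a bounded operator. -/
noncomputable def opTensorRight (A : E →L[ℂ] E') :
    (F →L[ℂ] F') →L[ℂ] HTensor E F →L[ℂ] HTensor E' F' :=
  { opTensorRightₗ F F' A with
    cont := AddMonoidHomClass.continuous_of_bound (opTensorRightₗ F F' A) ‖A‖ fun B =>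
      norm_opTensor_le A B }

@[simp] lemma opTensorLeft_apply (A : E →L[ℂ] E') (B : F →L[ℂ] F') :
    opTensorLeft E E' B A = opTensor A B := rfl

@[simp] lemma opTensorRight_apply (A : E →L[ℂ] E') (B : F →L[ℂ] F') :
    opTensorRight F F' A B = opTensor A B := rfl

lemma opTensor_mem_minTensor (A : E →L[ℂ] E) (B : F →L[ℂ] F) : opTensor A B ∈ minTensor E F :=
  Submodule.le_topologicalClosure _ (Submodule.subset_span ⟨A, B, rfl⟩)

lemma isClosed_minTensor : IsClosed (minTensor E F : Set (HTensor E F →L[ℂ] HTensor E F)) :=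
  Submodule.isClosed_topologicalClosure _

lemma inner_ext_htmul {A B : HTensor E F →L[ℂ] HTensor E' F'}
    (h : ∀ x y x' y', inner ℂ (htmul x' y') (A (htmul x y)) =
      inner ℂ (htmul x' y') (B (htmul x y))) : A = B := by
  refine hext fun x y => ?_
  refine ext_inner_left ℂ fun v => ?_
  induction v using UniformSpace.Completion.induction_on with
  | hp => exact isClosed_eq (by fun_prop) (by fun_prop)
  | ih v =>
    induction v with
    | zero => simp [UniformSpace.Completion.coe_zero]
    | add x y hx hy => simp only [UniformSpace.Completion.coe_add, inner_add_left, hx, hy]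
    | tmul x' y' => exact h x y x' y'

lemma adjoint_opTensor [CompleteSpace E] [CompleteSpace F] [CompleteSpace E'] [CompleteSpace F']
    (A : E →L[ℂ] E') (B : F →L[ℂ] F') :
    (opTensor A B).adjoint = opTensor A.adjoint B.adjoint := by
  refine inner_ext_htmul fun x y x' y' => ?_
  rw [ContinuousLinearMap.adjoint_inner_right, opTensor_htmul, opTensor_htmul, inner_htmul,
    inner_htmul, ContinuousLinearMap.adjoint_inner_right, ContinuousLinearMap.adjoint_inner_right]

end TensorOperators

/-! ### Norms of operator matrices -/

section MatrixNorm

variable {E F G : Type*}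
  [NormedAddCommGroup E] [InnerProductSpace ℂ E]
  [NormedAddCommGroup F] [InnerProductSpace ℂ F]
  [NormedAddCommGroup G] [InnerProductSpace ℂ G] {p : ℕ}

/-- The inclusion of the `i`-th summand of `E^p`. -/
noncomputable def inclAt (i : Fin p) : E →L[ℂ] PiLp 2 (fun _ : Fin p => E) :=
  ((PiLp.continuousLinearEquiv 2 ℂ (fun _ : Fin p => E)).symm :
      (Fin p → E) →L[ℂ] PiLp 2 (fun _ : Fin p => E)) ∘L
    ContinuousLinearMap.single ℂ (fun _ : Fin p => E) i

/-- The projection onto the `i`-th summand of `E^p`. -/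
noncomputable def projAt (i : Fin p) : PiLp 2 (fun _ : Fin p => E) →L[ℂ] E :=
  ContinuousLinearMap.proj i ∘L
    (PiLp.continuousLinearEquiv 2 ℂ (fun _ : Fin p => E) :
      PiLp 2 (fun _ : Fin p => E) →L[ℂ] (Fin p → E))

@[simp] lemma projAt_apply (i : Fin p) (x : PiLp 2 (fun _ : Fin p => E)) : projAt i x = x i := rfl

lemma inclAt_apply (i j : Fin p) (x : E) : inclAt i x j = if j = i then x else 0 := by
  by_cases h : j = i
  · subst h; simp [inclAt]
  · simp [inclAt, h]

lemma matrixOp_eq_sum (M : Fin p → Fin p → (E →L[ℂ] E)) :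
    matrixOp M = ∑ i, ∑ j, inclAt i ∘L M i j ∘L projAt j := by
  ext x l
  simp [matrixOp_apply, sum_apply, inclAt_apply]

lemma continuous_matrixOp :
    Continuous (matrixOp : (Fin p → Fin p → (E →L[ℂ] E)) → _) := by
  have : (matrixOp : (Fin p → Fin p → (E →L[ℂ] E)) → _) =
      fun M => ∑ i, ∑ j, inclAt i ∘L M i j ∘L projAt j := funext matrixOp_eq_sum
  rw [this]
  refine continuous_finsetSum _ fun i _ => continuous_finsetSum _ fun j _ => ?_
  exact continuous_const.clm_comp
    (((continuous_apply j).comp (continuous_apply i)).clm_comp continuous_const)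

lemma adjoint_projAt [CompleteSpace E] (i : Fin p) :
    (projAt i : PiLp 2 (fun _ : Fin p => E) →L[ℂ] E).adjoint = inclAt i := by
  symm
  rw [ContinuousLinearMap.eq_adjoint_iff]
  intro x y
  simp only [PiLp.inner_apply, inclAt_apply, projAt_apply]
  rw [Finset.sum_eq_single i] <;> simp +contextual

lemma projAt_comp_inclAt (i j : Fin p) :
    (projAt i : _ →L[ℂ] E) ∘L inclAt j = if i = j then .id ℂ E else 0 := by
  ext x
  by_cases h : i = j <;> simp [inclAt_apply, h]

lemma sum_inclAt_comp_projAt :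
    ∑ i : Fin p, (inclAt i : E →L[ℂ] _) ∘L projAt i = .id ℂ _ := by
  ext x l
  simp [sum_apply, inclAt_apply]

/-- The matrix on the left factors as `diag(A) · M · diag(B)`, and the diagonal amplification of a
contraction is a contraction on the Hilbert direct sum. -/
lemma norm_matrixOp_comp_le (M : Fin p → Fin p → (F →L[ℂ] F)) (A : F →L[ℂ] E) (B : E →L[ℂ] F)
    (hA : ‖A‖ ≤ 1) (hB : ‖B‖ ≤ 1) :
    ‖matrixOp fun i j => A ∘L M i j ∘L B‖ ≤ ‖matrixOp M‖ := by
  refine ContinuousLinearMap.opNorm_le_bound _ (norm_nonneg (matrixOp M)) fun x => ?_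
  set y : PiLp 2 (fun _ : Fin p => F) := WithLp.toLp 2 fun i => B (x i) with hy
  have h1 : ‖y‖ ≤ ‖x‖ := by
    rw [← sq_le_sq₀ (norm_nonneg _) (norm_nonneg _), PiLp.norm_sq_eq_of_L2, PiLp.norm_sq_eq_of_L2]
    gcongr with i
    simpa [hy] using B.le_of_opNorm_le hB (x i)
  have h2 : ‖matrixOp (fun i j => A ∘L M i j ∘L B) x‖ ≤ ‖matrixOp M y‖ := by
    rw [← sq_le_sq₀ (norm_nonneg _) (norm_nonneg _), PiLp.norm_sq_eq_of_L2, PiLp.norm_sq_eq_of_L2]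
    gcongr with i
    simpa [matrixOp_apply, hy] using A.le_of_opNorm_le hA (∑ j, M i j (B (x j)))
  exact h2.trans (((matrixOp M).le_opNorm y).trans (by gcongr))

/-- The canonical map `E^p ⊗ G → (E ⊗ G)^p`. -/
noncomputable def piTensor (p : ℕ) (E G : Type*) [NormedAddCommGroup E] [InnerProductSpace ℂ E]
    [NormedAddCommGroup G] [InnerProductSpace ℂ G] :
    HTensor (PiLp 2 (fun _ : Fin p => E)) G →L[ℂ] PiLp 2 (fun _ : Fin p => HTensor E G) :=
  ∑ i, inclAt i ∘L opTensor (projAt i) (.id ℂ G)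

lemma projAt_comp_piTensor (i : Fin p) :
    projAt i ∘L piTensor p E G = opTensor (projAt i) (.id ℂ G) := by
  refine ContinuousLinearMap.ext fun x => ?_
  simp [piTensor, sum_apply, inclAt_apply]

lemma adjoint_piTensor_comp_inclAt [CompleteSpace E] [CompleteSpace G] (i : Fin p) :
    (piTensor p E G).adjoint ∘L inclAt i = opTensor (inclAt i) (.id ℂ G) := by
  rw [← adjoint_projAt, ← ContinuousLinearMap.adjoint_comp, projAt_comp_piTensor,
    adjoint_opTensor, adjoint_projAt, ContinuousLinearMap.adjoint_id]

lemma ext_projAt {A B : G →L[ℂ] PiLp 2 (fun _ : Fin p => E)}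
    (h : ∀ i, projAt i ∘L A = projAt i ∘L B) : A = B := by
  ext x i
  exact congrArg (fun f => f x) (h i)

lemma ext_inclAt {A B : PiLp 2 (fun _ : Fin p => E) →L[ℂ] G}
    (h : ∀ i, A ∘L inclAt i = B ∘L inclAt i) : A = B := by
  rw [← A.comp_id, ← B.comp_id, ← sum_inclAt_comp_projAt, ContinuousLinearMap.comp_finsetSum,
    ContinuousLinearMap.comp_finsetSum]
  refine Finset.sum_congr rfl fun i _ => ?_
  rw [← ContinuousLinearMap.comp_assoc, h, ContinuousLinearMap.comp_assoc]

lemma projAt_comp_matrixOp_comp_inclAt (M : Fin p → Fin p → (E →L[ℂ] E)) (i j : Fin p) :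
    projAt i ∘L matrixOp M ∘L inclAt j = M i j := by
  ext x
  simp only [ContinuousLinearMap.comp_apply, projAt_apply, matrixOp_apply, inclAt_apply]
  rw [Finset.sum_eq_single j] <;> simp +contextual

/-- Under the identification of `E^p ⊗ G` with `(E ⊗ G)^p`, the matrix index passes through the
tensor product; this is verified entry by entry. It reduces complete contractivity of `M ↦ M ⊗ I` to
the single bound for `matrixOp M ⊗ I`. -/
lemma matrixOp_opTensor_id [CompleteSpace E] [CompleteSpace G]
    (M : Fin p → Fin p → (E →L[ℂ] E)) :
    matrixOp (fun i j => opTensor (M i j) (.id ℂ G)) =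
      piTensor p E G ∘L opTensor (matrixOp M) (.id ℂ G) ∘L (piTensor p E G).adjoint := by
  refine ext_inclAt fun j => ext_projAt fun i => ?_
  have h : projAt i ∘L (piTensor p E G ∘L opTensor (matrixOp M) (.id ℂ G) ∘L
      (piTensor p E G).adjoint) ∘L inclAt j = (projAt i ∘L piTensor p E G) ∘L
        opTensor (matrixOp M) (.id ℂ G) ∘L ((piTensor p E G).adjoint ∘L inclAt j) := rfl
  rw [projAt_comp_matrixOp_comp_inclAt, h, projAt_comp_piTensor, adjoint_piTensor_comp_inclAt,
    ← opTensor_comp, ← opTensor_comp, projAt_comp_matrixOp_comp_inclAt,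
    ContinuousLinearMap.id_comp, ContinuousLinearMap.id_comp]

lemma piTensor_comp_adjoint [CompleteSpace E] [CompleteSpace G] :
    piTensor p E G ∘L (piTensor p E G).adjoint = .id ℂ _ := by
  refine ext_inclAt fun j => ext_projAt fun i => ?_
  have h : projAt i ∘L (piTensor p E G ∘L (piTensor p E G).adjoint) ∘L inclAt j =
      (projAt i ∘L piTensor p E G) ∘L ((piTensor p E G).adjoint ∘L inclAt j) := rfl
  rw [h, projAt_comp_piTensor, adjoint_piTensor_comp_inclAt, ← opTensor_comp,
    ContinuousLinearMap.id_comp, ContinuousLinearMap.id_comp, projAt_comp_inclAt,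
    projAt_comp_inclAt]
  by_cases hij : i = j
  · simp only [hij, if_true, opTensor_id_id]
  · simp only [hij, if_false, opTensor_zero_left]

lemma norm_matrixOp_opTensor_id_le [CompleteSpace E] [CompleteSpace G]
    (M : Fin p → Fin p → (E →L[ℂ] E)) :
    ‖matrixOp (fun i j => opTensor (M i j) (.id ℂ G))‖ ≤ ‖matrixOp M‖ := by
  -- The relation `J J^* = I` makes `J^*` isometric. This half of unitarity already bounds both `J`
  -- and `J^*`.
  have hJ : ‖(piTensor p E G).adjoint‖ ≤ 1 := by
    refine ContinuousLinearMap.opNorm_le_bound _ zero_le_one fun x => ?_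
    rw [one_mul, ← sq_le_sq₀ (norm_nonneg _) (norm_nonneg _), ← inner_self_eq_norm_sq (𝕜 := ℂ),
      ← inner_self_eq_norm_sq (𝕜 := ℂ), ContinuousLinearMap.adjoint_inner_right,
      ← ContinuousLinearMap.comp_apply, piTensor_comp_adjoint]
    rfl
  have hJ' : ‖piTensor p E G‖ ≤ 1 := by
    rwa [← LinearIsometryEquiv.norm_map ContinuousLinearMap.adjoint]
  rw [matrixOp_opTensor_id]
  have hM : ‖opTensor (matrixOp M) (.id ℂ G)‖ ≤ ‖matrixOp M‖ :=
    (norm_opTensor_le _ _).trans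
      (mul_le_of_le_one_right (norm_nonneg (matrixOp M)) ContinuousLinearMap.norm_id_le)
  calc _ ≤ ‖piTensor p E G‖ * (‖opTensor (matrixOp M) (.id ℂ G)‖ * ‖(piTensor p E G).adjoint‖) :=
        (ContinuousLinearMap.opNorm_comp_le _ _).trans
          (mul_le_mul_of_nonneg_left (ContinuousLinearMap.opNorm_comp_le _ _)
            (norm_nonneg (piTensor p E G)))
    _ ≤ 1 * (‖matrixOp M‖ * 1) := by gcongr
    _ = _ := by ring

end MatrixNorm

/-! ### Words in commuting families -/

section Words

/-- `wordOp` is a product over the slots in a fixed order, so a letter prepended in slot `i` must be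
moved to the front past the earlier slots. This is where cross-commutation of the tuple enters. -/
lemma list_prod_map_update_mul {ι M : Type*} [DecidableEq ι] [Monoid M] {i : ι} {a : M}
    (f : ι → M) (L : List ι) (hL : L.Nodup) (hi : i ∈ L) (ha : ∀ l ∈ L, l ≠ i → Commute a (f l)) :
    (L.map (Function.update f i (a * f i))).prod = a * (L.map f).prod := by
  induction L with
  | nil => simp at hi
  | cons l L ih =>
    rw [List.nodup_cons] at hL
    by_cases h : l = i
    · subst h
      have : L.map (Function.update f l (a * f l)) = L.map f :=
        List.map_congr_left fun x hx => by
          rw [Function.update_of_ne]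
          rintro rfl
          exact hL.1 hx
      simp [this, mul_assoc]
    · have hi' : i ∈ L := by
        rcases List.mem_cons.mp hi with h' | h'
        · exact absurd h'.symm h
        · exact h'
      rw [List.map_cons, List.prod_cons, List.map_cons, List.prod_cons,
        ih hL.2 hi' fun x hx => ha x (List.mem_cons_of_mem _ hx), Function.update_of_ne h,
        ← mul_assoc, ← mul_assoc, (ha l List.mem_cons_self h).eq]

variable {k : ℕ} {n : Fin k → ℕ}

variable (n) in
/-- The tuple of empty words. -/
def emptyWord : MultiWord n := fun _ => []

/-- Induction on the total length: a multi-word that is not empty has a slot from which a first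
letter can be stripped. Together with `wordOp_consAt` it reduces identities between word operators
to a single letter. -/
lemma multiWord_induction {P : MultiWord n → Prop} (h0 : P (emptyWord n))
    (h1 : ∀ i j α, P α → P (consAt i j α)) (α : MultiWord n) : P α := by
  induction hN : ∑ i, (α i).length generalizing α with
  | zero =>
    have : α = emptyWord n := by
      funext i
      have := (Finset.sum_eq_zero_iff.mp hN) i (Finset.mem_univ i)
      exact List.length_eq_zero_iff.mp this
    rw [this]
    exact h0
  | succ N ih =>
    obtain ⟨i, -, hi⟩ : ∃ i ∈ Finset.univ, (α i).length ≠ 0 := by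
      by_contra! h
      rw [Finset.sum_eq_zero h] at hN
      omega
    obtain ⟨j, w, hw⟩ : ∃ j w, α i = j :: w := by
      cases h : α i with
      | nil => simp [h] at hi
      | cons j w => exact ⟨j, w, rfl⟩
    have hα : α = consAt i j (Function.update α i w) := by
      funext l
      by_cases hl : l = i
      · subst hl; simp [consAt, hw]
      · simp [consAt, hl]
    rw [hα]
    refine h1 i j _ (ih _ ?_)
    rw [← Finset.add_sum_erase _ _ (Finset.mem_univ i)] at hN ⊢
    have : ∑ l ∈ Finset.univ.erase i, (Function.update α i w l).length =
        ∑ l ∈ Finset.univ.erase i, (α l).length :=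
      Finset.sum_congr rfl fun l hl => by rw [Function.update_of_ne (Finset.ne_of_mem_erase hl)]
    rw [this]
    simp only [Function.update_self]
    rw [hw, List.length_cons] at hN
    omega

lemma length_consAt (i : Fin k) (j : Fin (n i)) (α : MultiWord n) (l : Fin k) :
    (consAt i j α l).length = (α l).length + if l = i then 1 else 0 := by
  by_cases h : l = i
  · subst h; simp [consAt]
  · simp [consAt, h]

lemma prod_pow_length_consAt {M : Type*} [CommMonoid M] (c : Fin k → M) (i : Fin k)
    (j : Fin (n i)) (α : MultiWord n) :
    ∏ l, c l ^ (consAt i j α l).length = c i * ∏ l, c l ^ (α l).length := by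
  simp_rw [length_consAt, pow_add, Finset.prod_mul_distrib, pow_ite, pow_one, pow_zero]
  rw [Finset.prod_ite_eq' Finset.univ i, if_pos (Finset.mem_univ i), mul_comm]

variable {E : Type*} [NormedAddCommGroup E] [InnerProductSpace ℂ E]

/-- The entries of a tuple with different first index commute. -/
def CrossCommute (X : OpTuple n E) : Prop :=
  ∀ p q : Fin k, p ≠ q → ∀ (a : Fin (n p)) (b : Fin (n q)), Commute (X p a) (X q b)

lemma wordOp_empty (X : OpTuple n E) : wordOp X (emptyWord n) = 1 := by
  simp [wordOp, emptyWord]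

lemma wordOp_consAt {X : OpTuple n E} (hX : CrossCommute X) (i : Fin k) (j : Fin (n i))
    (α : MultiWord n) : wordOp X (consAt i j α) = X i j * wordOp X α := by
  have h : (fun l => ((consAt i j α l).map (X l)).prod) =
      Function.update (fun l => ((α l).map (X l)).prod) i
        (X i j * ((α i).map (X i)).prod) := by
    funext l
    by_cases hl : l = i
    · subst hl; simp [consAt]
    · simp [consAt, hl]
  rw [wordOp, h]
  refine list_prod_map_update_mul _ _ (List.nodup_finRange k) (List.mem_finRange i) ?_
  intro l _ hl
  refine Commute.list_prod_right _ _ fun x hx => ?_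
  obtain ⟨b, _, rfl⟩ := List.mem_map.mp hx
  exact hX i l (Ne.symm hl) j b

lemma wordOp_map {E' : Type*} [NormedAddCommGroup E'] [InnerProductSpace ℂ E']
    (φ : (E →L[ℂ] E) →+* (E' →L[ℂ] E')) (X : OpTuple n E) (α : MultiWord n) :
    wordOp (fun i j => φ (X i j)) α = φ (wordOp X α) := by
  simp [wordOp, map_list_prod, List.map_map, Function.comp_def]

lemma CrossCommute.smul {X : OpTuple n E} (hX : CrossCommute X) (c : Fin k → ℂ) :
    CrossCommute (fun i j => c i • X i j) :=
  fun p q hpq a b => ((hX p q hpq a b).smul_left _).smul_right _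

lemma wordOp_smul {X : OpTuple n E} (hX : CrossCommute X) (c : Fin k → ℂ) (α : MultiWord n) :
    wordOp (fun i j => c i • X i j) α = (∏ l, c l ^ (α l).length) • wordOp X α := by
  induction α using multiWord_induction with
  | h0 => simp [wordOp_empty, emptyWord]
  | h1 i j α ih =>
    rw [wordOp_consAt (hX.smul c), wordOp_consAt hX, ih, prod_pow_length_consAt]
    rw [smul_mul_smul_comm]

lemma continuous_wordOp (α : MultiWord n) : Continuous fun X : OpTuple n E => wordOp X α := by
  unfold wordOp
  refine continuous_list_prod _ fun i _ => continuous_list_prod _ fun j _ => ?_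
  exact (continuous_apply j).comp (continuous_apply i)

end Words

/-! ### Defect operators -/

section Defect

/-- Commuting elements generate a commutative subalgebra, in which polynomials can be evaluated.
Identities for the maps `Φ_{X_i}`, which live in a noncommutative endomorphism ring, can then be
proved among polynomials. -/
lemma exists_algHom_of_commute {ι R A : Type*} [CommRing R] [Ring A] [Algebra R A] (x : ι → A)
    (hx : ∀ i j, Commute (x i) (x j)) :
    ∃ φ : MvPolynomial ι R →ₐ[R] A, ∀ i, φ (MvPolynomial.X i) = x i := by
  have := Algebra.isMulCommutative_adjoin R (s := Set.range x)
    (by rintro _ ⟨i, rfl⟩ _ ⟨j, rfl⟩; exact hx i j)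
  let : CommRing (Algebra.adjoin R (Set.range x)) :=
    { (inferInstance : Ring (Algebra.adjoin R (Set.range x))) with
      mul_comm := fun a b => this.is_comm.comm a b }
  refine ⟨(Algebra.adjoin R (Set.range x)).val.comp (MvPolynomial.aeval fun i =>
    (⟨x i, Algebra.subset_adjoin ⟨i, rfl⟩⟩ : Algebra.adjoin R (Set.range x))), fun i => ?_⟩
  simp

variable {k : ℕ} {n : Fin k → ℕ} {E : Type*} [NormedAddCommGroup E] [InnerProductSpace ℂ E]
  [CompleteSpace E]

lemma commute_adjoint {A B : E →L[ℂ] E} (h : Commute A B) : Commute A.adjoint B.adjoint := by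
  simpa [ContinuousLinearMap.star_eq_adjoint] using h.star_star

lemma commute_cpMap {X : OpTuple n E} (hX : CrossCommute X) (p q : Fin k) :
    Commute (cpMap X p) (cpMap X q) := by
  by_cases hpq : p = q
  · rw [hpq]
  refine LinearMap.ext fun Y => ?_
  simp only [Module.End.mul_apply, cpMap_apply, Finset.mul_sum, Finset.sum_mul]
  rw [Finset.sum_comm]
  refine Finset.sum_congr rfl fun b _ => Finset.sum_congr rfl fun a _ => ?_
  have h := hX p q hpq a b
  have h' := commute_adjoint h
  calc X p a * (X q b * Y * (X q b).adjoint) * (X p a).adjoint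
      = (X p a * X q b) * Y * ((X q b).adjoint * (X p a).adjoint) := by simp only [mul_assoc]
    _ = (X q b * X p a) * Y * ((X p a).adjoint * (X q b).adjoint) := by rw [h.eq, h'.eq]
    _ = _ := by simp only [mul_assoc]

lemma cpMap_smul (X : OpTuple n E) (c : Fin k → ℂ) (i : Fin k) :
    cpMap (fun i j => c i • X i j) i = ((‖c i‖ ^ 2 : ℝ) : ℂ) • cpMap X i := by
  refine LinearMap.ext fun Y => ?_
  rw [LinearMap.smul_apply, cpMap_apply, cpMap_apply, Finset.smul_sum]
  refine Finset.sum_congr rfl fun j _ => ?_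
  rw [map_smulₛₗ, smul_mul_assoc, smul_mul_smul_comm]
  congr 1
  rw [Complex.mul_conj, Complex.normSq_eq_norm_sq]

/-- The polynomial calculus of the commuting maps `Φ_{X_i}`. -/
lemma exists_cpMap_calculus {X : OpTuple n E} (hX : CrossCommute X) :
    ∃ φ : MvPolynomial (Fin k) ℂ →ₐ[ℂ] Module.End ℂ (E →L[ℂ] E),
      ∀ i, φ (MvPolynomial.X i) = cpMap X i :=
  exists_algHom_of_commute _ (commute_cpMap hX)

lemma list_prod_eq_calculus {A : Type*} [Ring A] [Algebra ℂ A]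
    (φ : MvPolynomial (Fin k) ℂ →ₐ[ℂ] A) (f : Fin k → MvPolynomial (Fin k) ℂ) :
    ((List.finRange k).map fun i => φ (f i)).prod = φ (∏ i, f i) := by
  rw [Fin.prod_univ_def, map_list_prod, List.map_map]
  rfl

/-- Scaling replaces `1 - Φ` by `1 - |c|²Φ = |c|²(1 - Φ) + (1 - |c|²)`, and the binomial theorem in
each slot expands the defect into defects of lower order. This explains why positivity is required
for all orders below `m`. -/
lemma defect_smul {X : OpTuple n E} (hX : CrossCommute X) (c : Fin k → ℂ) (p : Fin k → ℕ) :
    defect (fun i j => c i • X i j) p =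
      ∑ q ∈ Fintype.piFinset fun i => Finset.range (p i + 1),
        ((∏ i, (‖c i‖ ^ 2) ^ q i * (1 - ‖c i‖ ^ 2) ^ (p i - q i) * (p i).choose (q i) : ℝ) : ℂ) •
          defect X q := by
  obtain ⟨φ, hφ⟩ := exists_cpMap_calculus hX
  have hdef : ∀ q, defect X q = φ (∏ i, (1 - MvPolynomial.X i) ^ q i) 1 := fun q => by
    rw [← list_prod_eq_calculus]
    simp [defect, hφ]
  have h1 : ∀ i, (1 - cpMap (fun i j => c i • X i j) i) ^ p i =
      φ ((MvPolynomial.C (((‖c i‖ ^ 2 : ℝ) : ℂ)) * (1 - MvPolynomial.X i) +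
        MvPolynomial.C ((1 - ‖c i‖ ^ 2 : ℝ) : ℂ)) ^ p i) := fun i => by
    rw [cpMap_smul, map_pow, ← MvPolynomial.algebraMap_eq]
    congr 1
    rw [map_add, map_mul, map_sub, map_one, hφ, AlgHom.commutes, AlgHom.commutes]
    rw [← Algebra.smul_def, Algebra.algebraMap_eq_smul_one, smul_sub]
    push_cast
    rw [sub_smul, one_smul]
    abel
  rw [defect]
  simp_rw [h1]
  rw [list_prod_eq_calculus]
  simp_rw [add_pow]
  rw [Finset.prod_univ_sum, map_sum, LinearMap.sum_apply]
  refine Finset.sum_congr rfl fun q _ => ?_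
  rw [hdef, ← LinearMap.smul_apply, ← map_smul]
  congr 2
  rw [MvPolynomial.smul_eq_C_mul, Complex.ofReal_prod, map_prod, ← Finset.prod_mul_distrib]
  refine Finset.prod_congr rfl fun i _ => ?_
  simp only [mul_pow, Complex.ofReal_mul, Complex.ofReal_pow, map_mul, map_pow,
    Complex.ofReal_natCast, map_natCast]
  ring

/-- For `|c_i| ≤ 1` all coefficients of the binomial expansion are nonnegative. Independent factors
in the slots are needed for the rotations by roots of unity. -/
lemma smul_mem_polyHyperball {m : Fin k → ℕ} {X : OpTuple n E} (hX : X ∈ polyHyperball n m E)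
    (c : Fin k → ℂ) (hc : ∀ i, ‖c i‖ ≤ 1) :
    (fun i j => c i • X i j) ∈ polyHyperball n m E := by
  have hcc : CrossCommute X := hX.1
  refine ⟨hcc.smul c, fun p hp => ?_⟩
  rw [defect_smul hcc]
  refine ContinuousLinearMap.isPositive_sum _ fun q hq => ?_
  have hqp : q ≤ p := fun i => by
    have := (Fintype.mem_piFinset.mp hq) i
    exact Nat.lt_succ_iff.mp (Finset.mem_range.mp this)
  refine (hX.2 q (hqp.trans hp)).smul_of_nonneg ?_
  refine Complex.zero_le_real.mpr (Finset.prod_nonneg fun i _ => ?_)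
  have h1 : ‖c i‖ ^ 2 ≤ 1 := pow_le_one₀ (norm_nonneg _) (hc i)
  have : 0 ≤ 1 - ‖c i‖ ^ 2 := by linarith
  positivity

/-- Defects are built from products, sums and adjoints, hence commute with `*`-homomorphisms.
Conjugation by a unitary is the case needed. -/
lemma defect_map {E' : Type*} [NormedAddCommGroup E'] [InnerProductSpace ℂ E'] [CompleteSpace E']
    (φ : (E →L[ℂ] E) →⋆ₐ[ℂ] (E' →L[ℂ] E')) (X : OpTuple n E) (p : Fin k → ℕ) :
    defect (fun i j => φ (X i j)) p = φ (defect X p) := by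
  have hc : ∀ (i : Fin k) (Y : E →L[ℂ] E), cpMap (fun i j => φ (X i j)) i (φ Y) = φ (cpMap X i Y) := fun i Y => by
    simp only [cpMap_apply, map_sum, map_mul, ← ContinuousLinearMap.star_eq_adjoint, map_star]
  have hp : ∀ (i : Fin k) (q : ℕ) (Y : E →L[ℂ] E), ((1 - cpMap (fun i j => φ (X i j)) i) ^ q) (φ Y) =
      φ (((1 - cpMap X i) ^ q) Y) := fun i q => by
    induction q with
    | zero => intro Y; rfl
    | succ q ih =>
      intro Y
      rw [pow_succ, pow_succ, Module.End.mul_apply, Module.End.mul_apply, ← ih]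
      simp [hc]
  have hl : ∀ (L : List (Fin k)) (Y : E →L[ℂ] E),
      (L.map fun i => (1 - cpMap (fun i j => φ (X i j)) i) ^ p i).prod (φ Y) =
        φ ((L.map fun i => (1 - cpMap X i) ^ p i).prod Y) := fun L Y => by
    induction L with
    | nil => rfl
    | cons i L ih =>
      rw [List.map_cons, List.prod_cons, List.map_cons, List.prod_cons, Module.End.mul_apply, ih,
        hp, Module.End.mul_apply]
  rw [defect, defect, ← hl, map_one φ]

end Defect

/-! ### The universal model belongs to the poly-hyperball -/

section Model

/-- The form with `multichoose` obeys a Pascal rule and has the right value at parameter `0`, which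
occurs in the defect of full order `m`. The truncated subtraction in `weight` does not give that
value. -/
lemma weight_eq_multichoose {m : ℕ} (hm : 1 ≤ m) (q : ℕ) :
    weight m q = (Nat.multichoose m q : ℕ) := by
  rw [weight, Nat.multichoose_eq, ← Nat.choose_symm (by omega : m - 1 ≤ q + m - 1)]
  congr 2 <;> omega

lemma weight_pos {m : ℕ} (q : ℕ) : 0 < weight m q :=
  Nat.cast_pos.mpr (Nat.choose_pos (by omega))

lemma weight_zero (m : ℕ) : weight m 0 = 1 := by simp [weight]

variable {k : ℕ} {n : Fin k → ℕ}

lemma inner_fockBasis_left (α : MultiWord n) (f : Fock n) : inner ℂ (fockBasis n α) f = f α := by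
  simp [fockBasis, lp.inner_single_left]

lemma fockBasis_apply (α β : MultiWord n) : fockBasis n α β = if β = α then 1 else 0 := by
  rw [fockBasis, lp.coeFn_single]
  by_cases h : β = α
  · subst h; simp
  · simp [h]

lemma fock_ext {V : Type*} [NormedAddCommGroup V] [NormedSpace ℂ V] {A B : Fock n →L[ℂ] V}
    (h : ∀ α, A (fockBasis n α) = B (fockBasis n α)) : A = B := by
  refine ContinuousLinearMap.ext fun f => ?_
  have hf := lp.hasSum_single (E := fun _ : MultiWord n => ℂ) (p := 2) (by norm_num) f
  have h1 : ∀ α, lp.single 2 α (f α) = f α • fockBasis n α := fun α => by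
    rw [fockBasis, ← lp.single_smul, smul_eq_mul, mul_one]
  simp_rw [h1] at hf
  have hA := A.hasSum hf
  have hB := B.hasSum hf
  simp only [map_smul, h] at hA hB
  exact hA.unique hB

/-- The weight of `𝐖_{i,j}` at `e_α`. -/
noncomputable def modelWeight (m : Fin k → ℕ) (i : Fin k) (q : ℕ) : ℝ :=
  √(weight (m i) q / weight (m i) (q + 1))

lemma model_fockBasis (m : Fin k → ℕ) (i : Fin k) (j : Fin (n i)) (α : MultiWord n) :
    universalModel n m i j (fockBasis n α) =
      (modelWeight m i (α i).length : ℂ) • fockBasis n (consAt i j α) :=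
  universalModel_fockBasis m i j α

lemma consAt_comm {p q : Fin k} (h : p ≠ q) (a : Fin (n p)) (b : Fin (n q)) (α : MultiWord n) :
    consAt p a (consAt q b α) = consAt q b (consAt p a α) := by
  simp only [consAt, Function.update_of_ne h, Function.update_of_ne h.symm]
  exact Function.update_comm h.symm _ _ _

lemma crossCommute_universalModel (m : Fin k → ℕ) : CrossCommute (universalModel n m) := by
  intro p q hpq a b
  refine fock_ext fun α => ?_
  rw [mul_apply_eq_comp, mul_apply_eq_comp, model_fockBasis,
    model_fockBasis, map_smul, map_smul, model_fockBasis, model_fockBasis, consAt_comm hpq,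
    smul_smul, smul_smul, mul_comm]
  simp [consAt, hpq, hpq.symm]

lemma adjoint_model_fockBasis_consAt (m : Fin k → ℕ) (i : Fin k) (j : Fin (n i))
    (α : MultiWord n) :
    (universalModel n m i j).adjoint (fockBasis n (consAt i j α)) =
      (modelWeight m i (α i).length : ℂ) • fockBasis n α := by
  ext β
  rw [← inner_fockBasis_left, ContinuousLinearMap.adjoint_inner_right, model_fockBasis,
    inner_smul_left, inner_fockBasis_left, fockBasis_apply, lp.coeFn_smul, Pi.smul_apply,
    fockBasis_apply]
  by_cases h : β = α
  · subst h; simp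
  · have : consAt i j β ≠ consAt i j α := fun h' => h (consAt_injective i j h')
    simp [h, this]

lemma adjoint_model_fockBasis_of_ne (m : Fin k → ℕ) (i : Fin k) (j : Fin (n i))
    (α : MultiWord n) (hα : ∀ β, consAt i j β ≠ α) :
    (universalModel n m i j).adjoint (fockBasis n α) = 0 := by
  ext β
  rw [← inner_fockBasis_left, ContinuousLinearMap.adjoint_inner_right, model_fockBasis,
    inner_smul_left, inner_fockBasis_left, fockBasis_apply]
  simp [hα β]

/-- `T e_α = d(α) e_α` for all `α`. -/
def IsDiagonal (T : Fock n →L[ℂ] Fock n) (d : MultiWord n → ℝ) : Prop :=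
  ∀ α, T (fockBasis n α) = (d α : ℂ) • fockBasis n α

lemma IsDiagonal.isPositive {T : Fock n →L[ℂ] Fock n} {d : MultiWord n → ℝ}
    (hT : IsDiagonal T d) (hd : ∀ α, 0 ≤ d α) : T.IsPositive := by
  have happ : ∀ (f : Fock n) α, T f α = d α * f α := fun f α => by
    have : (innerSL ℂ (fockBasis n α)) ∘L T = (d α : ℂ) • innerSL ℂ (fockBasis n α) := by
      refine fock_ext fun β => ?_
      simp only [ContinuousLinearMap.comp_apply, hT β, map_smul, innerSL_apply_apply,
        smul_apply, inner_fockBasis_left, fockBasis_apply]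
      by_cases h : α = β
      · subst h; simp
      · simp [h]
    have h := congrArg (fun g => g f) this
    simpa only [ContinuousLinearMap.comp_apply, innerSL_apply_apply, inner_fockBasis_left,
      smul_apply, smul_eq_mul] using h
  rw [ContinuousLinearMap.isPositive_iff_complex]
  intro x
  have hs : HasSum (fun α => ((d α * ‖x α‖ ^ 2 : ℝ) : ℂ)) (inner ℂ (T x) x) := by
    have h := lp.hasSum_inner (𝕜 := ℂ) (T x) x
    have he : (fun α => inner ℂ (T x α) (x α)) = fun α => ((d α * ‖x α‖ ^ 2 : ℝ) : ℂ) := by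
      funext α
      rw [happ, RCLike.inner_apply, map_mul, Complex.conj_ofReal, mul_left_comm, RCLike.mul_conj]
      push_cast
      rfl
    rw [he] at h
    exact h
  have hre : HasSum (fun α => d α * ‖x α‖ ^ 2) (inner ℂ (T x) x).re := by
    exact Complex.hasSum_re hs
  refine ⟨?_, hre.nonneg fun α => mul_nonneg (hd α) (sq_nonneg _)⟩
  exact (Complex.hasSum_ofReal.mpr hre).unique hs

variable {m : Fin k → ℕ}

/-- The diagonal entries of the defect operators of `𝐖`. -/
noncomputable def defectEntry (m a : Fin k → ℕ) (α : MultiWord n) : ℝ :=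
  ∏ l, ((m l - a l).multichoose (α l).length : ℝ) / weight (m l) (α l).length

/-- `Φ_{𝐖_i}` carries the diagonal entry at `γ` to `g_j γ`, multiplied by the ratio of weights.
After clearing the common denominator, subtraction is Pascal's rule for `multichoose`, the
coefficient form of `(1 - x)(1 - x)^{-(c+1)} = (1 - x)^{-c}`; so the parameter `m i - a i` drops by
one. -/
lemma isDiagonal_one_sub_cpMap {T : Fock n →L[ℂ] Fock n} {a : Fin k → ℕ}
    (hT : IsDiagonal T (defectEntry m a)) (i : Fin k) (hi : a i < m i) :
    IsDiagonal ((1 - cpMap (universalModel n m) i) T)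
      (defectEntry m (Function.update a i (a i + 1))) := by
  intro α
  have hsplit : ∀ (b : Fin k → ℕ) (β : MultiWord n), defectEntry m b β =
      ((m i - b i).multichoose (β i).length : ℝ) / weight (m i) (β i).length *
        ∏ l ∈ Finset.univ.erase i, ((m l - b l).multichoose (β l).length : ℝ) /
          weight (m l) (β l).length := fun b β =>
    (Finset.mul_prod_erase _ _ (Finset.mem_univ i)).symm
  have hrest : ∀ (b : Fin k → ℕ) (β : MultiWord n), (∀ l, l ≠ i → b l = a l) →
      (∀ l, l ≠ i → β l = α l) →
      ∏ l ∈ Finset.univ.erase i, ((m l - b l).multichoose (β l).length : ℝ) /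
          weight (m l) (β l).length = 
      ∏ l ∈ Finset.univ.erase i, ((m l - a l).multichoose (α l).length : ℝ) /
          weight (m l) (α l).length := fun b β hb hβ =>
    Finset.prod_congr rfl fun l hl => by
      rw [hb l (Finset.ne_of_mem_erase hl), hβ l (Finset.ne_of_mem_erase hl)]
  obtain ⟨c, hc⟩ : ∃ c, m i - a i = c + 1 := ⟨m i - a i - 1, by omega⟩
  have hc' : m i - (a i + 1) = c := by omega
  have hw := fun q => (weight_pos (m := m i) q).ne'
  rw [LinearMap.sub_apply, Module.End.one_apply, sub_apply, hT α, cpMap_apply,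
    sum_apply]
  rw [hsplit a α, hsplit (Function.update a i (a i + 1)) α,
    hrest (Function.update a i (a i + 1)) α (fun l hl => Function.update_of_ne hl _ _)
      (fun _ _ => rfl), Function.update_self, hc', hc]
  set R := ∏ l ∈ Finset.univ.erase i, ((m l - a l).multichoose (α l).length : ℝ) /
          weight (m l) (α l).length with hR
  -- With an empty `i`-th word there is no letter to remove: the `Φ` term vanishes, and both
  -- `multichoose` values at length `0` are `1`. Otherwise only the creation operator of the first
  -- letter contributes.
  cases hαi : α i with
  | nil =>
    rw [Finset.sum_eq_zero]
    · simp
    · intro j _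
      rw [mul_apply_eq_comp, adjoint_model_fockBasis_of_ne, map_zero]
      intro β h
      have := congrFun h i
      simp [consAt, hαi] at this
  | cons j w =>
    obtain ⟨γ, rfl⟩ : ∃ γ, consAt i j γ = α := ⟨Function.update α i w, by
      funext l
      by_cases hl : l = i
      · subst hl; simp [consAt, hαi]
      · simp [consAt, hl]⟩
    have hw' : γ i = w := by simpa [consAt] using hαi
    rw [Finset.sum_eq_single j]
    · have hpos : (0:ℝ) ≤ weight (m i) w.length / weight (m i) (w.length + 1) :=
        div_nonneg (weight_pos _).le (weight_pos _).le
      rw [mul_apply_eq_comp, mul_apply_eq_comp,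
        adjoint_model_fockBasis_consAt, map_smul, hT γ, map_smul, map_smul, model_fockBasis,
        hsplit a γ, hrest a γ (fun _ _ => rfl) (fun l hl => by simp [consAt, hl]), hw', hc,
        smul_smul, smul_smul, ← sub_smul, List.length_cons]
      congr 1
      have hsq : (modelWeight m i w.length) * (modelWeight m i w.length) =
          weight (m i) w.length / weight (m i) (w.length + 1) := Real.mul_self_sqrt hpos
      rw [mul_right_comm, ← Complex.ofReal_mul, hsq, ← Complex.ofReal_mul, ← Complex.ofReal_sub]
      congr 1
      rw [Nat.multichoose_succ_succ]
      push_cast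
      have := hw w.length
      have := hw (w.length + 1)
      field_simp
      ring
    · intro j' _ hj'
      rw [mul_apply_eq_comp, adjoint_model_fockBasis_of_ne, map_zero]
      intro β h
      have := congrFun h i
      simp [consAt, hj'] at this
    · simp

/-- The slots are treated one at a time, each by `p i` applications of the one-step formula. Absence
of repetitions guarantees that slot `i` still has exponent `0` when its turn comes, and `p ≤ m`
keeps every step in the admissible range. -/
lemma isDiagonal_defect_list (hm : ∀ i, 1 ≤ m i) (p : Fin k → ℕ) (hp : p ≤ m)
    (L : List (Fin k)) (hL : L.Nodup) :
    IsDiagonal ((L.map fun i => (1 - cpMap (universalModel n m) i) ^ p i).prod 1)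
      (defectEntry m fun l => if l ∈ L then p l else 0) := by
  induction L with
  | nil =>
    intro α
    have : defectEntry m (fun l => if l ∈ ([] : List (Fin k)) then p l else 0) α = 1 := by
      refine Finset.prod_eq_one fun l _ => ?_
      simp only [List.not_mem_nil, if_false, Nat.sub_zero]
      rw [← weight_eq_multichoose (hm l), div_self (weight_pos _).ne']
    rw [this, List.map_nil, List.prod_nil, Complex.ofReal_one, one_smul]
    rfl
  | cons i L ih =>
    rw [List.nodup_cons] at hL
    have key : ∀ q ≤ p i, IsDiagonal (((1 - cpMap (universalModel n m) i) ^ q)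
        ((L.map fun i => (1 - cpMap (universalModel n m) i) ^ p i).prod 1))
        (defectEntry m (Function.update (fun l => if l ∈ L then p l else 0) i q)) := fun q => by
      induction q with
      | zero =>
        intro _
        have : Function.update (fun l => if l ∈ L then p l else 0) i 0 =
            fun l => if l ∈ L then p l else 0 := by
          rw [Function.update_eq_self_iff]
          simp [hL.1]
        rw [this]
        exact ih hL.2
      | succ q ihq =>
        intro hq
        have h := isDiagonal_one_sub_cpMap (ihq (by omega)) i
          (by rw [Function.update_self]; exact lt_of_lt_of_le hq (hp i))
        rw [Function.update_self, Function.update_idem] at h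
        rw [pow_succ']
        exact h
    have h := key (p i) le_rfl
    rw [List.map_cons, List.prod_cons]
    have hu : (fun l => if l ∈ i :: L then p l else 0) =
        Function.update (fun l => if l ∈ L then p l else 0) i (p i) := by
      funext l
      by_cases hl : l = i
      · subst hl; simp
      · simp [hl]
    rw [hu]
    exact h

lemma universalModel_mem_polyHyperball (hm : ∀ i, 1 ≤ m i) :
    (universalModel n m : OpTuple n (Fock n)) ∈ polyHyperball n m (Fock n) := by
  refine ⟨crossCommute_universalModel m, fun p hp => ?_⟩
  refine (isDiagonal_defect_list hm p hp _ (List.nodup_finRange k)).isPositive fun α => ?_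
  exact Finset.prod_nonneg fun l _ => div_nonneg (Nat.cast_nonneg _) (weight_pos _).le

end Model

/-! ### Products of series in noncommutative Banach algebras -/

section Series

/-- Both products run in the same order, so the inverse pairs meet only after being moved past the
other factors. -/
lemma list_prod_mul_list_prod_eq_one {ι R : Type*} [Monoid R] {g u : ι → R}
    (hgu : ∀ i, g i * u i = 1) (hc : ∀ i j, Commute (g i) (u j)) (L : List ι) :
    (L.map g).prod * (L.map u).prod = 1 := by
  induction L with
  | nil => simp
  | cons i L ih =>
    have h : Commute (L.map g).prod (u i) :=
      Commute.list_prod_left _ _ fun x hx => by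
        obtain ⟨j, _, rfl⟩ := List.mem_map.mp hx
        exact hc j i
    calc ((i :: L).map g).prod * ((i :: L).map u).prod
        = g i * ((L.map g).prod * u i) * (L.map u).prod := by simp [mul_assoc]
      _ = (g i * u i) * ((L.map g).prod * (L.map u).prod) := by rw [h.eq]; simp [mul_assoc]
      _ = 1 := by rw [hgu, ih, one_mul]

/-- The Cauchy product of finitely many series, with the order of the factors preserved. Summability
of the norms is carried through the induction since multiplying two series requires it. -/
lemma hasSum_pi_list_prod {R : Type*} [NormedRing R] [CompleteSpace R] :
    ∀ {k : ℕ} {ι : Fin k → Type} (f : ∀ i, ι i → R) (g : Fin k → R),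
      (∀ i, HasSum (f i) (g i)) → (∀ i, Summable fun q => ‖f i q‖) →
      HasSum (fun q : ∀ i, ι i => ((List.finRange k).map fun i => f i (q i)).prod)
        ((List.finRange k).map g).prod ∧
      Summable fun q : ∀ i, ι i => ‖((List.finRange k).map fun i => f i (q i)).prod‖
  | 0, ι, f, g, _, _ => by
    simp only [List.finRange_zero, List.map_nil, List.prod_nil]
    exact ⟨hasSum_unique fun _ : (∀ i : Fin 0, ι i) => (1 : R),
      (hasSum_unique fun _ : (∀ i : Fin 0, ι i) => ‖(1 : R)‖).summable⟩
  | k + 1, ι, f, g, hf, hs => by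
    obtain ⟨h1, h2⟩ := hasSum_pi_list_prod (fun i : Fin k => f i.succ) (fun i => g i.succ)
      (fun i => hf i.succ) (fun i => hs i.succ)
    have hn := (hs 0).mul_norm h2
    have hp := (hf 0).mul h1 hn.of_norm
    have he : ∀ q : ∀ i, ι i, ((List.finRange (k + 1)).map fun i => f i (q i)).prod =
        f 0 (q 0) * ((List.finRange k).map fun i => f i.succ (q i.succ)).prod := fun q => by
      rw [List.finRange_succ, List.map_cons, List.prod_cons, List.map_map]
      rfl
    have hg : ((List.finRange (k + 1)).map g).prod =
        g 0 * ((List.finRange k).map fun i => g i.succ).prod := by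
      rw [List.finRange_succ, List.map_cons, List.prod_cons, List.map_map]
      rfl
    simp_rw [he]
    rw [hg]
    rw [← (Fin.consEquiv ι).hasSum_iff, ← (Fin.consEquiv ι).summable_iff]
    exact ⟨hp, hn⟩

/-- Assuming only `‖1‖ ≤ 1` includes operators on the zero space, where `‖1‖ = 0`. -/
lemma norm_pow_le_of_norm_one_le {R : Type*} [NormedRing R] (h1 : ‖(1 : R)‖ ≤ 1) (a : R) (q : ℕ) :
    ‖a ^ q‖ ≤ ‖a‖ ^ q := by
  induction q with
  | zero => simpa using h1
  | succ q ih =>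
    rw [pow_succ, pow_succ]
    exact (norm_mul_le _ _).trans (mul_le_mul_of_nonneg_right ih (norm_nonneg a))

lemma hasSum_weight_smul_pow {R : Type*} [NormedRing R] [NormedAlgebra ℂ R] [CompleteSpace R]
    {m : ℕ} (hm : 1 ≤ m) {a : R} (ha : ‖a‖ < 1) :
    HasSum (fun q => (weight m q : ℂ) • a ^ q) (Ring.inverse (1 - a) ^ m) := by
  have h := hasSum_choose_mul_geometric_of_norm_lt_one' (m - 1) ha
  rw [Nat.sub_add_cancel hm] at h
  convert h using 2 with q
  rw [weight, ← Nat.add_sub_assoc hm, Complex.ofReal_natCast, Nat.cast_smul_eq_nsmul,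
    nsmul_eq_mul]

lemma summable_norm_weight_smul_pow {R : Type*} [NormedRing R] [NormedAlgebra ℂ R]
    (h1 : ‖(1 : R)‖ ≤ 1) {m : ℕ} (hm : 1 ≤ m) {a : R} (ha : ‖a‖ < 1) :
    Summable fun q => ‖(weight m q : ℂ) • a ^ q‖ := by
  have ha' : ‖(‖a‖ : ℝ)‖ < 1 := by simpa using ha
  refine Summable.of_nonneg_of_le (fun _ => norm_nonneg _) (fun q => ?_)
    (summable_choose_mul_geometric_of_norm_lt_one (m - 1) ha')
  rw [norm_smul, Complex.norm_real, Real.norm_of_nonneg (weight_pos q).le, weight,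
    ← Nat.add_sub_assoc hm]
  exact mul_le_mul_of_nonneg_left (norm_pow_le_of_norm_one_le h1 a q) (Nat.cast_nonneg _)

lemma hasSum_sigma_of_nonneg {ι : Type*} {κ : ι → Type*} {f : (Σ i, κ i) → ℝ} (hf : ∀ x, 0 ≤ f x)
    {g : ι → ℝ} {a : ℝ} (hg : ∀ i, HasSum (fun j => f ⟨i, j⟩) (g i)) (ha : HasSum g a) :
    HasSum f a := by
  have hs : Summable f := by
    refine (summable_sigma_of_nonneg hf).mpr ⟨fun i => (hg i).summable, ?_⟩
    simp_rw [fun i => (hg i).tsum_eq]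
    exact ha.summable
  have := hs.hasSum.sigma hg
  rw [← this.unique ha]
  exact hs.hasSum

end Series

/-! ### The resolution of the identity given by a pure tuple -/

section Resolution

variable {k : ℕ} {n : Fin k → ℕ} {E : Type*} [NormedAddCommGroup E] [InnerProductSpace ℂ E]
  [CompleteSpace E]

/-- `Φ_{X_i}` as a bounded operator on `B(E)`. -/
noncomputable def cpMapL (X : OpTuple n E) (i : Fin k) : (E →L[ℂ] E) →L[ℂ] (E →L[ℂ] E) :=
  ∑ j, ContinuousLinearMap.mulLeftRight ℂ (E →L[ℂ] E) (X i j) (X i j).adjoint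

lemma cpMapL_apply (X : OpTuple n E) (i : Fin k) (T : E →L[ℂ] E) :
    cpMapL X i T = cpMap X i T := by
  simp [cpMapL, cpMap_apply, sum_apply]

lemma commute_cpMapL {X : OpTuple n E} (hX : CrossCommute X) (p q : Fin k) :
    Commute (cpMapL X p) (cpMapL X q) := by
  refine ContinuousLinearMap.ext fun T => ?_
  simp only [mul_apply_eq_comp, cpMapL_apply]
  exact congrArg (fun f => f T) (commute_cpMap hX p q).eq

lemma one_sub_cpMapL_pow_apply (X : OpTuple n E) (i : Fin k) (q : ℕ) (T : E →L[ℂ] E) :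
    ((1 - cpMapL X i) ^ q) T = ((1 - cpMap X i) ^ q) T := by
  induction q generalizing T with
  | zero => rfl
  | succ q ih =>
    rw [pow_succ, pow_succ, mul_apply_eq_comp, Module.End.mul_apply, ← ih]
    simp [cpMapL_apply]

lemma defect_eq_cpMapL (X : OpTuple n E) (p : Fin k → ℕ) :
    defect X p = ((List.finRange k).map fun i => (1 - cpMapL X i) ^ p i).prod 1 := by
  rw [defect]
  generalize List.finRange k = L
  induction L with
  | nil => rfl
  | cons i L ih =>
    rw [List.map_cons, List.prod_cons, List.map_cons, List.prod_cons, Module.End.mul_apply,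
      mul_apply_eq_comp, ih, one_sub_cpMapL_pow_apply]

lemma defect_single {X : OpTuple n E} (hX : CrossCommute X) (i : Fin k) :
    defect X (Pi.single i 1) = 1 - cpMap X i 1 := by
  obtain ⟨φ, hφ⟩ := exists_cpMap_calculus hX
  have : defect X (Pi.single i 1) =
      φ (∏ l, (1 - MvPolynomial.X l) ^ (Pi.single i 1 : Fin k → ℕ) l) 1 := by
    rw [← list_prod_eq_calculus]
    simp [defect, hφ]
  rw [this, Finset.prod_eq_single i (fun l _ hl => by rw [Pi.single_eq_of_ne hl, pow_zero])
    (by simp), Pi.single_eq_same, pow_one]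
  simp [hφ]

/-- Since `m i ≥ 1`, the defect of order one in slot `i` is among the positive ones, which says that
`X_i` is a row contraction. -/
lemma sum_norm_sq_adjoint_le {m : Fin k → ℕ} (hm : ∀ i, 1 ≤ m i) {X : OpTuple n E}
    (hX : X ∈ polyHyperball n m E) (i : Fin k) (h : E) :
    ∑ j, ‖(X i j).adjoint h‖ ^ 2 ≤ ‖h‖ ^ 2 := by
  have hp : (Pi.single i 1 : Fin k → ℕ) ≤ m := fun l => by
    by_cases hl : l = i
    · subst hl; simpa using hm l
    · simp [hl]
  have h1 := (hX.2 _ hp).inner_nonneg_left h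
  rw [defect_single hX.1, cpMap_apply] at h1
  have h2 : inner ℂ ((1 - ∑ j, X i j * 1 * (X i j).adjoint) h) h =
      ((‖h‖ ^ 2 - ∑ j, ‖(X i j).adjoint h‖ ^ 2 : ℝ) : ℂ) := by
    simp only [mul_one, sub_apply, sum_apply, mul_apply_eq_comp, inner_sub_left, sum_inner,
      one_apply_eq_self, ← ContinuousLinearMap.adjoint_inner_right,
      inner_self_eq_norm_sq_to_K]
    push_cast
    rfl
  rw [h2, Complex.zero_le_real] at h1
  linarith

/-- `Φ_{X_i}(T)` is `T ⊗ I` compressed by a row contraction. Without forming the row, the bound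
comes from pairing `g = Φ(T)h` with itself, applying Cauchy–Schwarz over `j`, and cancelling one
factor `‖g‖`. -/
lemma norm_cpMapL_le {m : Fin k → ℕ} (hm : ∀ i, 1 ≤ m i) {X : OpTuple n E}
    (hX : X ∈ polyHyperball n m E) (i : Fin k) : ‖cpMapL X i‖ ≤ 1 := by
  refine ContinuousLinearMap.opNorm_le_bound _ zero_le_one fun T => ?_
  rw [one_mul]
  refine ContinuousLinearMap.opNorm_le_bound _ (norm_nonneg T) fun h => ?_
  rw [cpMapL_apply]
  set g := cpMap X i T h with hg
  have h1 : ‖g‖ * ‖g‖ ≤ ‖T‖ * ‖h‖ * ‖g‖ := by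
    calc ‖g‖ * ‖g‖ = ‖inner ℂ g g‖ := by simp [inner_self_eq_norm_sq_to_K, sq]
      _ = ‖∑ j, inner ℂ ((X i j).adjoint g) (T ((X i j).adjoint h))‖ := by
        congr 1
        have hg' : g = ∑ j, X i j (T ((X i j).adjoint h)) := by
          rw [hg, cpMap_apply, sum_apply]
          rfl
        conv_lhs => arg 3; rw [hg']
        rw [inner_sum]
        simp only [ContinuousLinearMap.adjoint_inner_left]
      _ ≤ ∑ j, ‖(X i j).adjoint g‖ * (‖T‖ * ‖(X i j).adjoint h‖) := by
        refine (norm_sum_le _ _).trans (Finset.sum_le_sum fun j _ => ?_)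
        exact (norm_inner_le_norm _ _).trans
          (mul_le_mul_of_nonneg_left (T.le_opNorm _) (norm_nonneg _))
      _ = ‖T‖ * ∑ j, ‖(X i j).adjoint g‖ * ‖(X i j).adjoint h‖ := by
        rw [Finset.mul_sum]
        exact Finset.sum_congr rfl fun j _ => by ring
      _ ≤ ‖T‖ * (√(∑ j, ‖(X i j).adjoint g‖ ^ 2) * √(∑ j, ‖(X i j).adjoint h‖ ^ 2)) := by
        gcongr
        exact Real.sum_mul_le_sqrt_mul_sqrt _ _ _
      _ ≤ ‖T‖ * (‖g‖ * ‖h‖) := by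
        gcongr
        · exact Real.sqrt_le_iff.mpr ⟨norm_nonneg _, sum_norm_sq_adjoint_le hm hX i g⟩
        · exact Real.sqrt_le_iff.mpr ⟨norm_nonneg _, sum_norm_sq_adjoint_le hm hX i h⟩
      _ = _ := by ring
  rcases (norm_nonneg g).eq_or_lt with h0 | h0
  · rw [← h0]; positivity
  · exact le_of_mul_le_mul_right h1 h0

lemma norm_cpMapL_lt_one {m : Fin k → ℕ} (hm : ∀ i, 1 ≤ m i) {X : OpTuple n E}
    (hX : X ∈ radialPart n m E) (i : Fin k) : ‖cpMapL X i‖ < 1 := by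
  obtain ⟨r, hr0, hr1, Y, hY, rfl⟩ := hX
  have h : cpMapL ((r : ℂ) • Y) i = ((r ^ 2 : ℝ) : ℂ) • cpMapL Y i := by
    refine ContinuousLinearMap.ext fun T => ?_
    rw [smul_apply, cpMapL_apply, cpMapL_apply, ← LinearMap.smul_apply]
    have := cpMap_smul Y (fun _ => (r : ℂ)) i
    rw [Complex.norm_real, Real.norm_of_nonneg hr0] at this
    exact congrArg (fun f => f T) this
  rw [h, norm_smul, Complex.norm_real, Real.norm_of_nonneg (by positivity)]
  calc r ^ 2 * ‖cpMapL Y i‖ ≤ r ^ 2 * 1 := by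
        gcongr
        exact norm_cpMapL_le hm hY i
    _ < 1 := by nlinarith

lemma radialPart_subset_polyHyperball {m : Fin k → ℕ} :
    radialPart n m E ⊆ polyHyperball n m E := by
  rintro _ ⟨r, hr0, hr1, Y, hY, rfl⟩
  exact smul_mem_polyHyperball hY (fun _ => (r : ℂ)) fun _ => by
    rw [Complex.norm_real, Real.norm_of_nonneg hr0]
    exact hr1.le

/-- `∑_q ∏ᵢ b_{qᵢ} Φ_{X_1}^{q_1} ⋯ Φ_{X_k}^{q_k}` inverts the defect map. -/
lemma hasSum_cpMapL_defect {m : Fin k → ℕ} (hm : ∀ i, 1 ≤ m i) {X : OpTuple n E}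
    (hX : X ∈ radialPart n m E) :
    HasSum (fun q : Fin k → ℕ =>
      ((List.finRange k).map fun i => (weight (m i) (q i) : ℂ) • cpMapL X i ^ q i).prod
        (defect X m)) 1 := by
  have hc : CrossCommute X := (radialPart_subset_polyHyperball hX).1
  have h1 : ‖(1 : (E →L[ℂ] E) →L[ℂ] (E →L[ℂ] E))‖ ≤ 1 := ContinuousLinearMap.norm_id_le
  have h := (hasSum_pi_list_prod (fun i q => (weight (m i) q : ℂ) • cpMapL X i ^ q)
    (fun i => Ring.inverse (1 - cpMapL X i) ^ m i)
    (fun i => hasSum_weight_smul_pow (hm i) (norm_cpMapL_lt_one hm hX i))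
    (fun i => summable_norm_weight_smul_pow h1 (hm i) (norm_cpMapL_lt_one hm hX i))).1
  have h2 := (ContinuousLinearMap.apply ℂ (E →L[ℂ] E) (defect X m)).hasSum h
  -- The defect is `∏ (1 - Φ_i)^{m_i}` applied to the identity operator, and the sum of the series
  -- is the product of the inverse powers. All these maps commute, so the product of the two is `1`.
  have h3 : ((List.finRange k).map fun i => Ring.inverse (1 - cpMapL X i) ^ m i).prod (defect X m) = 1 := by
    have hu : ∀ i, IsUnit (1 - cpMapL X i) := fun i =>
      isUnit_one_sub_of_norm_lt_one (norm_cpMapL_lt_one hm hX i)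
    rw [defect_eq_cpMapL, ← mul_apply_eq_comp, list_prod_mul_list_prod_eq_one]
    · rfl
    · intro i
      obtain ⟨u, hu'⟩ := hu i
      rw [← hu', Ring.inverse_unit, ← (Commute.units_inv_left (Commute.refl u.val)).mul_pow,
        Units.inv_mul, one_pow]
    · intro i j
      refine Commute.pow_pow ?_ _ _
      obtain ⟨u, hu'⟩ := hu i
      rw [← hu', Ring.inverse_unit]
      refine Commute.units_inv_left ?_
      rw [hu']
      exact (Commute.one_left _).sub_left ((Commute.one_right _).sub_right (commute_cpMapL hc i j))
  simp only [ContinuousLinearMap.apply_apply] at h2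
  rw [h3] at h2
  exact h2

end Resolution

/-! ### The noncommutative Berezin kernel -/

section WordSums

/-- Expanding the `q`-th power of a sum of noncommuting elements produces each word of length `q`
exactly once. -/
lemma sum_vector_list_prod {α R : Type*} [Fintype α] [Semiring R] (y : α → R) (q : ℕ) :
    ∑ w : List.Vector α q, (w.toList.map y).prod = (∑ j, y j) ^ q := by
  induction q with
  | zero =>
    rw [pow_zero, Finset.sum_eq_single List.Vector.nil]
    · simp
    · exact fun v _ hv => absurd (Subtype.ext (List.length_eq_zero_iff.mp v.2)) hv
    · simp
  | succ q ih =>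
    let e : α × List.Vector α q ≃ List.Vector α (q + 1) :=
      { toFun := fun p => p.1 ::ᵥ p.2
        invFun := fun v => (v.head, v.tail)
        left_inv := fun p => by simp
        right_inv := fun v => by simp }
    rw [← e.sum_comp, Fintype.sum_prod_type, pow_succ', ← ih, Finset.sum_mul]
    refine Finset.sum_congr rfl fun j _ => ?_
    rw [Finset.mul_sum]
    refine Finset.sum_congr rfl fun w _ => ?_
    simp [e]

lemma list_prod_map_smul {ι R : Type*} [Ring R] [Algebra ℂ R] (c : ι → ℂ) (x : ι → R)
    (L : List ι) :
    (L.map fun i => c i • x i).prod = (L.map c).prod • (L.map x).prod := by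
  induction L with
  | nil => simp
  | cons i L ih =>
    simp only [List.map_cons, List.prod_cons]
    rw [ih, smul_mul_smul_comm]

variable {k : ℕ} {n : Fin k → ℕ}

/-- Multi-words sorted by the lengths of their components. -/
def sigmaVectorEquiv (n : Fin k → ℕ) :
    (Σ q : Fin k → ℕ, ∀ i, List.Vector (Fin (n i)) (q i)) ≃ MultiWord n where
  toFun x := fun i => (x.2 i).toList
  invFun β := ⟨fun i => (β i).length, fun i => ⟨β i, rfl⟩⟩
  left_inv := by
    rintro ⟨q, v⟩
    obtain ⟨w, hw, rfl⟩ : ∃ (w : MultiWord n) (hw : ∀ i, (w i).length = q i),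
        v = fun i => ⟨w i, hw i⟩ := ⟨fun i => (v i).toList, fun i => (v i).2, rfl⟩
    obtain rfl : (fun i => (w i).length) = q := funext hw
    rfl
  right_inv β := rfl

variable {E : Type*} [NormedAddCommGroup E] [InnerProductSpace ℂ E] [CompleteSpace E]

/-- `A ↦ (T ↦ A T A^*)` is multiplicative. -/
noncomputable def conjMap (E : Type*) [NormedAddCommGroup E] [InnerProductSpace ℂ E]
    [CompleteSpace E] : (E →L[ℂ] E) →* ((E →L[ℂ] E) →L[ℂ] (E →L[ℂ] E)) where
  toFun A := ContinuousLinearMap.mulLeftRight ℂ (E →L[ℂ] E) A A.adjoint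
  map_one' := by
    refine ContinuousLinearMap.ext fun T => ?_
    rw [← ContinuousLinearMap.star_eq_adjoint, star_one]
    simp
  map_mul' A B := by
    refine ContinuousLinearMap.ext fun T => ?_
    rw [← ContinuousLinearMap.star_eq_adjoint, star_mul]
    simp [mul_assoc, ContinuousLinearMap.star_eq_adjoint]

lemma conjMap_apply (A T : E →L[ℂ] E) : conjMap E A T = A * T * A.adjoint := by
  simp [conjMap]

/-- Conjugation is multiplicative, so summing it over all words of prescribed lengths gives powers
of the `Φ_{X_i}`. This connects the word sum in the Berezin kernel with the series inverting the
defect map. -/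
lemma sum_conjMap_wordOp (X : OpTuple n E) (c : Fin k → ℂ) (q : Fin k → ℕ) :
    ∑ v : ∀ i, List.Vector (Fin (n i)) (q i),
        (∏ i, c i) • conjMap E (wordOp X fun i => (v i).toList) =
      ((List.finRange k).map fun i => c i • cpMapL X i ^ q i).prod := by
  have h := (hasSum_pi_list_prod (ι := fun i => List.Vector (Fin (n i)) (q i))
    (fun i v => c i • (v.toList.map fun j => conjMap E (X i j)).prod) _
    (fun i => hasSum_fintype _) (fun i => (hasSum_fintype _).summable)).1.unique (hasSum_fintype _)
  have h1 : ∀ i, ∑ v : List.Vector (Fin (n i)) (q i),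
      c i • (v.toList.map fun j => conjMap E (X i j)).prod = c i • cpMapL X i ^ q i := fun i => by
    rw [← Finset.smul_sum, sum_vector_list_prod]
    rfl
  simp_rw [h1] at h
  rw [h]
  refine Finset.sum_congr rfl fun v _ => ?_
  have h2 : conjMap E (wordOp X fun i => (v i).toList) = ((List.finRange k).map fun i =>
      ((v i).toList.map fun j => conjMap E (X i j)).prod).prod := by
    simp only [wordOp, map_list_prod, List.map_map, Function.comp_def]
  rw [h2, Fin.prod_univ_def]
  exact (list_prod_map_smul c _ _).symm

end WordSums

/-! ### Orthogonal copies of `E` in `𝓕 ⊗ E` -/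

section BasisTensor

variable {k : ℕ} {n : Fin k → ℕ} {E : Type*} [NormedAddCommGroup E] [InnerProductSpace ℂ E]

lemma norm_fockBasis (β : MultiWord n) : ‖fockBasis n β‖ = 1 :=
  (orthonormal_fockBasis n).1 β

variable (E) in
/-- The isometry `x ↦ e_β ⊗ x`. -/
noncomputable def basisTensor (β : MultiWord n) : E →ₗᵢ[ℂ] HTensor (Fock n) E where
  toLinearMap := (htmulL (fockBasis n β) : E →L[ℂ] HTensor (Fock n) E).toLinearMap
  norm_map' x := by
    change ‖htmul (fockBasis n β) x‖ = ‖x‖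
    rw [norm_htmul, norm_fockBasis, one_mul]

lemma basisTensor_apply (β : MultiWord n) (x : E) :
    basisTensor E β x = htmul (fockBasis n β) x := rfl

lemma orthogonalFamily_basisTensor :
    OrthogonalFamily ℂ (fun _ : MultiWord n => E) (basisTensor E) := by
  intro β γ hβγ x y
  rw [basisTensor_apply, basisTensor_apply, inner_htmul, (orthonormal_fockBasis n).2 hβγ, zero_mul]

end BasisTensor

/-! ### Isometry and intertwining properties of the Berezin kernel -/

section Kernel

variable {k : ℕ} {n m : Fin k → ℕ}
  {E : Type*} [NormedAddCommGroup E] [InnerProductSpace ℂ E] [CompleteSpace E]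

/-- The weight `√b_{β₁} ⋯ √b_{β_k}`. -/
noncomputable def wordWeight (m : Fin k → ℕ) (β : MultiWord n) : ℝ :=
  ∏ i, √(weight (m i) (β i).length)

lemma wordWeight_pos (m : Fin k → ℕ) (β : MultiWord n) : 0 < wordWeight m β :=
  Finset.prod_pos fun _ _ => Real.sqrt_pos.mpr (weight_pos _)

lemma wordWeight_empty (m : Fin k → ℕ) : wordWeight m (emptyWord n) = 1 := by
  simp [wordWeight, emptyWord, weight_zero]

lemma wordWeight_sq (m : Fin k → ℕ) (β : MultiWord n) :
    wordWeight m β ^ 2 = ∏ i, weight (m i) (β i).length := by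
  rw [wordWeight, ← Finset.prod_pow]
  exact Finset.prod_congr rfl fun i _ => Real.sq_sqrt (weight_pos _).le

/-- The kernel weights and the weights of `𝐖` are matched so that removing a letter cancels; the
intertwining relation depends on this. -/
lemma wordWeight_consAt (m : Fin k → ℕ) (i : Fin k) (j : Fin (n i)) (β : MultiWord n) :
    wordWeight m (consAt i j β) * modelWeight m i (β i).length = wordWeight m β := by
  have h : ∏ l ∈ Finset.univ.erase i, √(weight (m l) (consAt i j β l).length) =
      ∏ l ∈ Finset.univ.erase i, √(weight (m l) (β l).length) :=
    Finset.prod_congr rfl fun l hl => by simp [length_consAt, Finset.ne_of_mem_erase hl]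
  rw [wordWeight, wordWeight, ← Finset.mul_prod_erase _ _ (Finset.mem_univ i), h,
    ← Finset.mul_prod_erase Finset.univ (fun l => √(weight (m l) (β l).length))
      (Finset.mem_univ i), mul_right_comm]
  congr 1
  rw [length_consAt, if_pos rfl, modelWeight, Real.sqrt_div (weight_pos _).le]
  have := (Real.sqrt_pos.mpr (weight_pos (m := m i) ((β i).length + 1))).ne'
  field_simp

lemma norm_sq_sqrt_apply {T : E →L[ℂ] E} (hT : T.IsPositive) (x : E) :
    inner ℂ (T x) x = ((‖CFC.sqrt T x‖ ^ 2 : ℝ) : ℂ) := by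
  have h0 : 0 ≤ T := (ContinuousLinearMap.nonneg_iff_isPositive T).mpr hT
  have hsa : (CFC.sqrt T).adjoint = CFC.sqrt T :=
    (CFC.sqrt_nonneg T).isSelfAdjoint.star_eq
  conv_lhs => rw [← CFC.sqrt_mul_sqrt_self T h0]
  rw [mul_apply_eq_comp, ← ContinuousLinearMap.adjoint_inner_right, hsa,
    inner_self_eq_norm_sq_to_K]
  push_cast
  rfl

lemma hasSum_wordWeight_norm_sq (hm : ∀ i, 1 ≤ m i) {X : OpTuple n E}
    (hX : X ∈ radialPart n m E) (h : E) :
    HasSum (fun β : MultiWord n => wordWeight m β ^ 2 *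
      ‖CFC.sqrt (defect X m) ((wordOp X β).adjoint h)‖ ^ 2) (‖h‖ ^ 2) := by
  have hpos := (radialPart_subset_polyHyperball hX).2 m le_rfl
  rw [← (sigmaVectorEquiv n).hasSum_iff]
  have hq := hasSum_cpMapL_defect hm hX
  have hq' := ((innerSL ℂ h) ∘L (ContinuousLinearMap.apply ℂ E h)).hasSum hq
  have hq'' := Complex.hasSum_re hq'
  simp only [ContinuousLinearMap.comp_apply, ContinuousLinearMap.apply_apply, innerSL_apply_apply,
    one_apply_eq_self] at hq''
  have e : (inner ℂ h h).re = ‖h‖ ^ 2 := by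
    rw [inner_self_eq_norm_sq_to_K]
    norm_cast
  rw [e] at hq''
  -- Grouped by lengths `q`, the terms add up to `⟪h, (∏ b_{q_i} Φ_i^{q_i})(Δ) h⟫`, and these sum to
  -- `‖h‖²`. Nonnegativity allows the grouping to be undone.
  refine hasSum_sigma_of_nonneg (fun x => mul_nonneg (sq_nonneg _) (sq_nonneg _)) (fun q => ?_) hq''
  convert hasSum_fintype _ using 1
  rw [← sum_conjMap_wordOp, sum_apply, sum_apply, inner_sum, Complex.re_sum]
  refine Finset.sum_congr rfl fun v _ => ?_
  rw [smul_apply, conjMap_apply, smul_apply, mul_apply_eq_comp, mul_apply_eq_comp, inner_smul_right,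
    ← ContinuousLinearMap.adjoint_inner_left, ← inner_conj_symm, norm_sq_sqrt_apply hpos,
    Complex.conj_ofReal, ← Complex.ofReal_prod, ← Complex.ofReal_mul, Complex.ofReal_re]
  simp only [wordWeight_sq]
  congr 1
  exact Finset.prod_congr rfl fun i _ => congrArg _ (v i).2.symm

/-- The coordinates of the kernel form an `ℓ²` sequence of norm `‖h‖`; the orthogonal isometries `x
↦ e_β ⊗ x` assemble it into a vector of `𝓕 ⊗ E` of the same norm. -/
lemma exists_isBerezinKernel (hm : ∀ i, 1 ≤ m i) {X : OpTuple n E} (hX : X ∈ radialPart n m E) :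
    ∃ V : E →L[ℂ] HTensor (Fock n) E, IsBerezinKernel m X V ∧ ∀ h, ‖V h‖ = ‖h‖ := by
  set c : MultiWord n → E →L[ℂ] E := fun β =>
    (wordWeight m β : ℂ) • (CFC.sqrt (defect X m) ∘L (wordOp X β).adjoint) with hc
  have hn : ∀ h β, ‖c β h‖ ^ (2 : ENNReal).toReal = wordWeight m β ^ 2 *
      ‖CFC.sqrt (defect X m) ((wordOp X β).adjoint h)‖ ^ 2 := fun h β => by
    simp only [hc, smul_apply, norm_smul, Complex.norm_real, ContinuousLinearMap.comp_apply,
      Real.norm_of_nonneg (wordWeight_pos m β).le, ENNReal.toReal_ofNat, Real.rpow_ofNat, mul_pow]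
  have hs : ∀ h, HasSum (fun β => ‖c β h‖ ^ (2 : ENNReal).toReal) (‖h‖ ^ 2) := fun h => by
    simp_rw [hn]
    exact hasSum_wordWeight_norm_sq hm hX h
  have hmem : ∀ h, Memℓp (fun β => c β h) 2 := fun h => memℓp_gen (hs h).summable
  let U : E →ₗ[ℂ] lp (fun _ : MultiWord n => E) 2 :=
    { toFun := fun h => ⟨fun β => c β h, hmem h⟩
      map_add' := fun h h' => by ext β; exact map_add (c β) h h'
      map_smul' := fun a h => by ext β; exact map_smul (c β) a h }
  have hU : ∀ h, ‖U h‖ = ‖h‖ := fun h => by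
    have h1 := lp.hasSum_norm (p := 2) (by norm_num) (U h)
    have h2 := h1.unique (hs h)
    rw [ENNReal.toReal_ofNat, Real.rpow_ofNat] at h2
    exact (sq_eq_sq₀ (norm_nonneg _) (norm_nonneg _)).mp h2
  let V : E →ₗᵢ[ℂ] HTensor (Fock n) E :=
    (orthogonalFamily_basisTensor (E := E) (n := n)).linearIsometry.comp ⟨U, hU⟩
  refine ⟨V.toContinuousLinearMap, fun h => ?_, V.norm_map⟩
  have h3 := (orthogonalFamily_basisTensor (E := E) (n := n)).hasSum_linearIsometry (U h)
  have h4 : (fun β => basisTensor E β (U h β)) = fun β : MultiWord n =>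
      ((∏ i, √(weight (m i) (β i).length) : ℝ) : ℂ) •
        htmul (fockBasis n β) (CFC.sqrt (defect X m) ((wordOp X β).adjoint h)) := by
    funext β
    rw [basisTensor_apply, ← htmul_smul]
    rfl
  rw [h4] at h3
  exact h3

lemma isBerezinKernel_unique {X : OpTuple n E} {V V' : E →L[ℂ] HTensor (Fock n) E}
    (h : IsBerezinKernel m X V) (h' : IsBerezinKernel m X V') : V = V' :=
  ContinuousLinearMap.ext fun x => (h x).unique (h' x)

lemma isBerezinKernel_berezinKernel (hm : ∀ i, 1 ≤ m i) {X : OpTuple n E}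
    (hX : X ∈ radialPart n m E) : IsBerezinKernel m X (berezinKernel m X) := by
  obtain ⟨V, hV, -⟩ := exists_isBerezinKernel hm hX
  have h : ∃ V, IsBerezinKernel m X V := ⟨V, hV⟩
  rw [berezinKernel, dif_pos h]
  exact h.choose_spec

lemma norm_berezinKernel_apply (hm : ∀ i, 1 ≤ m i) {X : OpTuple n E}
    (hX : X ∈ radialPart n m E) (h : E) : ‖berezinKernel m X h‖ = ‖h‖ := by
  obtain ⟨V, hV, hn⟩ := exists_isBerezinKernel hm hX
  rw [isBerezinKernel_unique (isBerezinKernel_berezinKernel hm hX) hV, hn]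

lemma adjoint_comp_berezinKernel (hm : ∀ i, 1 ≤ m i) {X : OpTuple n E}
    (hX : X ∈ radialPart n m E) :
    (berezinKernel m X).adjoint ∘L berezinKernel m X = .id ℂ E :=
  (ContinuousLinearMap.norm_map_iff_adjoint_comp_self _).mp (norm_berezinKernel_apply hm hX)

lemma berezinKernel_comp_adjoint (hm : ∀ i, 1 ≤ m i) {X : OpTuple n E}
    (hX : X ∈ radialPart n m E) (i : Fin k) (j : Fin (n i)) :
    berezinKernel m X ∘L (X i j).adjoint =
      opTensor (universalModel n m i j).adjoint (.id ℂ E) ∘L berezinKernel m X := by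
  have hc : CrossCommute X := (radialPart_subset_polyHyperball hX).1
  have hV := isBerezinKernel_berezinKernel hm hX
  refine ContinuousLinearMap.ext fun h => ?_
  have h1 := hV ((X i j).adjoint h)
  have h2 := (opTensor (universalModel n m i j).adjoint (.id ℂ E)).hasSum (hV h)
  -- `𝐖_{i,j}^*` kills `e_β` unless `β` begins with `g_j` in slot `i`, so the series may be
  -- reindexed by the words `g_j β`.
  rw [← (consAt_injective i j).hasSum_iff] at h2
  · refine h1.unique ?_
    have h3 : (⇑(opTensor (universalModel n m i j).adjoint (.id ℂ E)) ∘ fun β : MultiWord n =>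
        ((∏ i, √(weight (m i) (β i).length) : ℝ) : ℂ) • htmul (fockBasis n β)
          (CFC.sqrt (defect X m) ((wordOp X β).adjoint h))) ∘ consAt i j = fun β =>
        ((∏ i, √(weight (m i) (β i).length) : ℝ) : ℂ) • htmul (fockBasis n β)
          (CFC.sqrt (defect X m) ((wordOp X β).adjoint ((X i j).adjoint h))) := by
      funext β
      have hw : ∀ γ : MultiWord n, ∏ i, √(weight (m i) (γ i).length) = wordWeight m γ :=
        fun _ => rfl
      simp only [Function.comp_apply, map_smul, opTensor_htmul, hw]
      rw [adjoint_model_fockBasis_consAt, smul_htmul, smul_smul, ← Complex.ofReal_mul,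
        wordWeight_consAt, wordOp_consAt hc, ← ContinuousLinearMap.star_eq_adjoint (X i j * _),
        star_mul]
      rfl
    rw [← h3]
    exact h2
  · intro β hβ
    rw [map_smul, opTensor_htmul, adjoint_model_fockBasis_of_ne]
    · exact (congrArg _ (map_zero (htmulR _))).trans (smul_zero _)
    · exact fun γ hγ => hβ ⟨γ, hγ⟩

lemma comp_adjoint_berezinKernel (hm : ∀ i, 1 ≤ m i) {X : OpTuple n E}
    (hX : X ∈ radialPart n m E) (α : MultiWord n) :
    (berezinKernel m X).adjoint ∘L opTensor (wordOp (universalModel n m) α) (.id ℂ E) =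
      wordOp X α ∘L (berezinKernel m X).adjoint := by
  have hc : CrossCommute X := (radialPart_subset_polyHyperball hX).1
  induction α using multiWord_induction with
  | h0 =>
    rw [wordOp_empty, wordOp_empty]
    exact (congrArg _ opTensor_id_id).trans (ContinuousLinearMap.comp_id _)
  | h1 i j α ih =>
    have h1 := congrArg ContinuousLinearMap.adjoint (berezinKernel_comp_adjoint hm hX i j)
    rw [ContinuousLinearMap.adjoint_comp, ContinuousLinearMap.adjoint_comp, adjoint_opTensor,
      ContinuousLinearMap.adjoint_adjoint, ContinuousLinearMap.adjoint_adjoint,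
      ContinuousLinearMap.adjoint_id] at h1
    have h2 : opTensor (wordOp (universalModel n m) (consAt i j α)) (.id ℂ E) =
        opTensor (universalModel n m i j) (.id ℂ E) ∘L
          opTensor (wordOp (universalModel n m) α) (.id ℂ E) := by
      rw [wordOp_consAt (crossCommute_universalModel m), ← opTensor_comp]
      rfl
    rw [h2, ← ContinuousLinearMap.comp_assoc, ← h1, ContinuousLinearMap.comp_assoc, ih,
      wordOp_consAt hc]
    rfl

/-- Intertwining on both sides turns the compression into `X_α K_X^* K_X X_β^*`, and `K_X` is an
isometry. -/
lemma berezinKernel_compression (hm : ∀ i, 1 ≤ m i) {X : OpTuple n E}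
    (hX : X ∈ radialPart n m E) (α β : MultiWord n) :
    (berezinKernel m X).adjoint ∘L opTensor (wordOp (universalModel n m) α ∘L
        (wordOp (universalModel n m) β).adjoint) (.id ℂ E) ∘L berezinKernel m X =
      wordOp X α ∘L (wordOp X β).adjoint := by
  have h1 := comp_adjoint_berezinKernel hm hX α
  have h2 := congrArg ContinuousLinearMap.adjoint (comp_adjoint_berezinKernel hm hX β)
  rw [ContinuousLinearMap.adjoint_comp, ContinuousLinearMap.adjoint_comp, adjoint_opTensor,
    ContinuousLinearMap.adjoint_adjoint, ContinuousLinearMap.adjoint_id] at h2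
  have h3 : opTensor (wordOp (universalModel n m) α ∘L
      (wordOp (universalModel n m) β).adjoint) (.id ℂ E) =
      opTensor (wordOp (universalModel n m) α) (.id ℂ E) ∘L
        opTensor (wordOp (universalModel n m) β).adjoint (.id ℂ E) := by
    rw [← opTensor_comp, ContinuousLinearMap.id_comp]
  rw [h3, ContinuousLinearMap.comp_assoc, h2, ← ContinuousLinearMap.comp_assoc, h1,
    ContinuousLinearMap.comp_assoc, ← ContinuousLinearMap.comp_assoc _ _ (wordOp X β).adjoint,
    adjoint_comp_berezinKernel hm hX, ContinuousLinearMap.id_comp]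

end Kernel

/-! ### The Berezin transform -/

section HAssoc

variable {E F G E' F' G' : Type*}
  [NormedAddCommGroup E] [InnerProductSpace ℂ E]
  [NormedAddCommGroup F] [InnerProductSpace ℂ F]
  [NormedAddCommGroup G] [InnerProductSpace ℂ G]

lemma hext_right {V : Type*} [NormedAddCommGroup V] [NormedSpace ℂ V]
    {A B : HTensor E (HTensor F G) →L[ℂ] V}
    (h : ∀ x y z, A (htmul x (htmul y z)) = B (htmul x (htmul y z))) : A = B := by
  refine ContinuousLinearMap.ext fun v => ?_
  have hcl : IsClosed {v | A v = B v} := isClosed_eq A.continuous B.continuous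
  refine (denseRange_toHTensorRight (E := E) (F := F) (G := G)).induction_on v hcl fun w => ?_
  induction w with
  | zero => rw [LinearIsometry.map_zero, A.map_zero, B.map_zero]
  | add w w' h1 h2 => simp only [map_add, h1, h2]
  | tmul x w =>
    induction w with
    | zero => rw [TensorProduct.tmul_zero, LinearIsometry.map_zero, A.map_zero, B.map_zero]
    | add w w' h1 h2 => simp only [TensorProduct.tmul_add, map_add, h1, h2]
    | tmul y z =>
      rw [toHTensorRight_tmul]
      exact h x y z

lemma compression_of_intertwining [CompleteSpace E] [CompleteSpace F] [CompleteSpace G]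
    {a : F →L[ℂ] G} {b : E →L[ℂ] F} {S : G →L[ℂ] G} {S' : F →L[ℂ] F}
    (h1 : S ∘L a = a ∘L S') (h2 : a.adjoint ∘L a = .id ℂ F) :
    (a ∘L b).adjoint ∘L S ∘L (a ∘L b) = b.adjoint ∘L S' ∘L b := by
  rw [ContinuousLinearMap.adjoint_comp, ← ContinuousLinearMap.comp_assoc S, h1,
    ContinuousLinearMap.comp_assoc, ContinuousLinearMap.comp_assoc,
    ← ContinuousLinearMap.comp_assoc a.adjoint, h2, ContinuousLinearMap.id_comp]

end HAssoc

/-! ### The Berezin transform as a complete contraction -/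

section Berezin

variable {k : ℕ} {n m : Fin k → ℕ}
  {E : Type*} [NormedAddCommGroup E] [InnerProductSpace ℂ E] [CompleteSpace E]
  {K : Type*} [NormedAddCommGroup K] [InnerProductSpace ℂ K]

variable (m K) in
/-- The isometry `I_K ⊗ K_X`, with values in `(K ⊗ 𝓕) ⊗ E`. -/
noncomputable def berezinIso (X : OpTuple n E) : HTensor K E →L[ℂ] HTensor (HTensor K (Fock n)) E :=
  ((hassoc K (Fock n) E :
      HTensor K (HTensor (Fock n) E) ≃L[ℂ] HTensor (HTensor K (Fock n)) E) :
      HTensor K (HTensor (Fock n) E) →L[ℂ] HTensor (HTensor K (Fock n)) E) ∘L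
    opTensor (ContinuousLinearMap.id ℂ K) (berezinKernel m X)

lemma berezinTransform_eq (X : OpTuple n E) (T : HTensor K (Fock n) →L[ℂ] HTensor K (Fock n)) :
    berezinTransform m X T =
      (berezinIso m K X).adjoint ∘L opTensor T (.id ℂ E) ∘L berezinIso m K X := rfl

lemma norm_berezinIso_le (hm : ∀ i, 1 ≤ m i) {X : OpTuple n E} (hX : X ∈ radialPart n m E) :
    ‖berezinIso m K X‖ ≤ 1 := by
  have h1 : ‖berezinKernel m X‖ ≤ 1 :=
    ContinuousLinearMap.opNorm_le_bound _ zero_le_one fun x => by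
      rw [norm_berezinKernel_apply hm hX, one_mul]
  refine ContinuousLinearMap.opNorm_le_bound _ zero_le_one fun x => ?_
  have h2 : ‖berezinIso m K X x‖ = ‖opTensor (.id ℂ K) (berezinKernel m X) x‖ :=
    (hassoc K (Fock n) E).norm_map _
  rw [h2]
  refine ContinuousLinearMap.le_of_opNorm_le _ ((norm_opTensor_le _ _).trans ?_) x
  exact mul_le_one₀ ContinuousLinearMap.norm_id_le (norm_nonneg _) h1

lemma norm_adjoint_berezinIso_le (hm : ∀ i, 1 ≤ m i) {X : OpTuple n E}
    (hX : X ∈ radialPart n m E) : ‖(berezinIso m K X).adjoint‖ ≤ 1 := by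
  rw [LinearIsometryEquiv.norm_map]
  exact norm_berezinIso_le hm hX

variable (m K) in
/-- The Berezin transform at `X` as a bounded operator. -/
noncomputable def berezinL (X : OpTuple n E) :
    (HTensor K (Fock n) →L[ℂ] HTensor K (Fock n)) →L[ℂ] (HTensor K E →L[ℂ] HTensor K E) where
  toFun T := berezinTransform m X T
  map_add' T T' := by
    simp only [berezinTransform_eq, opTensor_add_left, ContinuousLinearMap.add_comp,
      ContinuousLinearMap.comp_add]
  map_smul' c T := by
    simp only [berezinTransform_eq, opTensor_smul_left, ContinuousLinearMap.smul_comp,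
      ContinuousLinearMap.comp_smul, RingHom.id_apply]
  cont := by
    have h : Continuous fun T : HTensor K (Fock n) →L[ℂ] HTensor K (Fock n) =>
        opTensor T (ContinuousLinearMap.id ℂ E) :=
      (opTensorLeft (HTensor K (Fock n)) (HTensor K (Fock n))
        (ContinuousLinearMap.id ℂ E)).continuous
    exact continuous_const.clm_comp (h.clm_comp continuous_const)

lemma berezinL_apply (X : OpTuple n E) (T : HTensor K (Fock n) →L[ℂ] HTensor K (Fock n)) :
    berezinL m K X T = berezinTransform m X T := rfl

lemma norm_berezinL_apply_le (hm : ∀ i, 1 ≤ m i) {X : OpTuple n E} (hX : X ∈ radialPart n m E)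
    (T : HTensor K (Fock n) →L[ℂ] HTensor K (Fock n)) : ‖berezinL m K X T‖ ≤ ‖T‖ := by
  have h1 := norm_berezinIso_le (K := K) hm hX
  have h2 := norm_adjoint_berezinIso_le (K := K) hm hX
  have h3 : ‖opTensor T (ContinuousLinearMap.id ℂ E)‖ ≤ ‖T‖ :=
    (norm_opTensor_le _ _).trans
      (mul_le_of_le_one_right (norm_nonneg T) ContinuousLinearMap.norm_id_le)
  refine ContinuousLinearMap.opNorm_le_bound _ (norm_nonneg T) fun x => ?_
  rw [berezinL_apply, berezinTransform_eq]
  refine (ContinuousLinearMap.le_of_opNorm_le _ h2 _).trans ?_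
  rw [one_mul]
  refine (ContinuousLinearMap.le_of_opNorm_le _ h3 _).trans ?_
  refine mul_le_mul_of_nonneg_left ?_ (norm_nonneg T)
  simpa using ContinuousLinearMap.le_of_opNorm_le _ h1 x

/-- All entries are `V^* (M_{ij} ⊗ I) V` with the same contraction `V`. -/
lemma norm_matrixOp_berezinL_le (hm : ∀ i, 1 ≤ m i) {X : OpTuple n E}
    (hX : X ∈ radialPart n m E) {p : ℕ}
    (M : Fin p → Fin p → (HTensor K (Fock n) →L[ℂ] HTensor K (Fock n))) :
    ‖matrixOp fun i j => berezinL m K X (M i j)‖ ≤ ‖matrixOp M‖ :=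
  (norm_matrixOp_comp_le (fun i j => opTensor (M i j) (.id ℂ E)) (berezinIso m K X).adjoint
    (berezinIso m K X) (norm_adjoint_berezinIso_le hm hX) (norm_berezinIso_le hm hX)).trans
    (norm_matrixOp_opTensor_id_le M)

variable [CompleteSpace K]

lemma berezinL_opTensor (X : OpTuple n E) (C : K →L[ℂ] K) (S : Fock n →L[ℂ] Fock n) :
    berezinL m K X (opTensor C S) = opTensor C ((berezinKernel m X).adjoint ∘L
      opTensor S (.id ℂ E) ∘L berezinKernel m X) := by
  set a : HTensor K (HTensor (Fock n) E) →L[ℂ] HTensor (HTensor K (Fock n)) E :=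
    ((hassoc K (Fock n) E :
      HTensor K (HTensor (Fock n) E) ≃L[ℂ] HTensor (HTensor K (Fock n)) E) :
      HTensor K (HTensor (Fock n) E) →L[ℂ] HTensor (HTensor K (Fock n)) E) with ha
  have h1 : opTensor (opTensor C S) (.id ℂ E) ∘L a = a ∘L opTensor C (opTensor S (.id ℂ E)) := by
    refine hext_right fun x y z => ?_
    have ha' : ∀ x y z, a (htmul x (htmul y z)) = htmul (htmul x y) z := hassoc_htmul
    simp only [ContinuousLinearMap.comp_apply, ha', opTensor_htmul, ContinuousLinearMap.id_apply]
  have h2 : a.adjoint ∘L a = .id ℂ _ :=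
    (ContinuousLinearMap.norm_map_iff_adjoint_comp_self _).mp (hassoc K (Fock n) E).norm_map
  have h3 : berezinIso m K X = a ∘L opTensor (.id ℂ K) (berezinKernel m X) := rfl
  rw [berezinL_apply, berezinTransform_eq, h3, compression_of_intertwining h1 h2,
    adjoint_opTensor, ContinuousLinearMap.adjoint_id, ← opTensor_comp, ← opTensor_comp,
    ContinuousLinearMap.id_comp, ContinuousLinearMap.comp_id]

lemma berezinL_model (hm : ∀ i, 1 ≤ m i) {X : OpTuple n E} (hX : X ∈ radialPart n m E)
    (C : K →L[ℂ] K) (α β : MultiWord n) :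
    berezinL m K X (opTensor C (wordOp (universalModel n m) α ∘L
      (wordOp (universalModel n m) β).adjoint)) =
      opTensor C (wordOp X α ∘L (wordOp X β).adjoint) := by
  rw [berezinL_opTensor, berezinKernel_compression hm hX]

end Berezin

/-! ### Fourier coefficients of operators on `K ⊗ 𝓕` -/

section ModelWords

variable {k : ℕ} {n m : Fin k → ℕ}

/-- Componentwise concatenation of multi-words. -/
def appendWord (α γ : MultiWord n) : MultiWord n := fun i => α i ++ γ i

lemma appendWord_empty (α : MultiWord n) : appendWord α (emptyWord n) = α := by
  funext i; simp [appendWord, emptyWord]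

lemma appendWord_injective (α : MultiWord n) : Function.Injective (appendWord α) := by
  intro γ γ' h
  funext i
  exact List.append_cancel_left (congrFun h i)

lemma appendWord_consAt (i : Fin k) (j : Fin (n i)) (α γ : MultiWord n) :
    appendWord (consAt i j α) γ = consAt i j (appendWord α γ) := by
  funext l
  by_cases h : l = i
  · subst h; simp [appendWord, consAt]
  · simp [appendWord, consAt, h]

/-- Away from the vacuum only the direction of the image matters, so the scalar is left unspecified.
-/
lemma exists_wordOp_model_fockBasis (m : Fin k → ℕ) (α γ : MultiWord n) :
    ∃ c : ℂ, wordOp (universalModel n m) α (fockBasis n γ) = c • fockBasis n (appendWord α γ) := by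
  induction α using multiWord_induction with
  | h0 => exact ⟨1, by rw [wordOp_empty, one_smul]; rfl⟩
  | h1 i j α ih =>
    obtain ⟨c, hc⟩ := ih
    refine ⟨c * modelWeight m i (appendWord α γ i).length, ?_⟩
    rw [wordOp_consAt (crossCommute_universalModel m), mul_apply_eq_comp, hc, map_smul,
      model_fockBasis, smul_smul, appendWord_consAt]

lemma wordOp_model_fockBasis_empty (m : Fin k → ℕ) (α : MultiWord n) :
    wordOp (universalModel n m) α (fockBasis n (emptyWord n)) =
      ((wordWeight m α)⁻¹ : ℂ) • fockBasis n α := by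
  induction α using multiWord_induction with
  | h0 => rw [wordOp_empty, wordWeight_empty]; simp
  | h1 i j α ih =>
    rw [wordOp_consAt (crossCommute_universalModel m), mul_apply_eq_comp, ih, map_smul,
      model_fockBasis, smul_smul, ← wordWeight_consAt m i j α]
    congr 1
    have h1 : wordWeight m (consAt i j α) ≠ 0 := (wordWeight_pos m _).ne'
    have h2 : modelWeight m i (α i).length ≠ 0 :=
      (Real.sqrt_pos.mpr (div_pos (weight_pos _) (weight_pos _))).ne'
    have h1' : (wordWeight m (consAt i j α) : ℂ) ≠ 0 := by exact_mod_cast h1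
    have h2' : (modelWeight m i (α i).length : ℂ) ≠ 0 := by exact_mod_cast h2
    push_cast
    field_simp

lemma adjoint_wordOp_model_of_ne (m : Fin k → ℕ) (β δ : MultiWord n)
    (h : ∀ γ, appendWord β γ ≠ δ) :
    (wordOp (universalModel n m) β).adjoint (fockBasis n δ) = 0 := by
  ext γ
  obtain ⟨c, hc⟩ := exists_wordOp_model_fockBasis m β γ
  rw [← inner_fockBasis_left, ContinuousLinearMap.adjoint_inner_right, hc, inner_smul_left,
    inner_fockBasis_left, fockBasis_apply, if_neg (h γ), mul_zero]
  rfl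

lemma exists_adjoint_wordOp_model (m : Fin k → ℕ) (β γ : MultiWord n) :
    ∃ c : ℂ, (wordOp (universalModel n m) β).adjoint (fockBasis n (appendWord β γ)) =
      c • fockBasis n γ := by
  obtain ⟨c, hc⟩ := exists_wordOp_model_fockBasis m β γ
  refine ⟨starRingEnd ℂ c, ?_⟩
  ext γ'
  rw [lp.coeFn_smul, Pi.smul_apply, fockBasis_apply, ← inner_fockBasis_left,
    ContinuousLinearMap.adjoint_inner_right]
  by_cases h : γ' = γ
  · subst h
    rw [hc, inner_smul_left, inner_fockBasis_left, fockBasis_apply]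
    simp
  · obtain ⟨c', hc'⟩ := exists_wordOp_model_fockBasis m β γ'
    have h' : appendWord β γ' ≠ appendWord β γ := fun e => h (appendWord_injective β e)
    rw [hc', inner_smul_left, inner_fockBasis_left, fockBasis_apply, if_neg h', if_neg h]
    simp

lemma adjoint_wordOp_model_self (m : Fin k → ℕ) (β : MultiWord n) :
    (wordOp (universalModel n m) β).adjoint (fockBasis n β) =
      ((wordWeight m β)⁻¹ : ℂ) • fockBasis n (emptyWord n) := by
  obtain ⟨c, hc⟩ := exists_adjoint_wordOp_model m β (emptyWord n)
  rw [appendWord_empty] at hc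
  rw [hc]
  have h1 : inner ℂ (fockBasis n (emptyWord n))
      ((wordOp (universalModel n m) β).adjoint (fockBasis n β)) = c := by
    rw [hc, inner_smul_right, inner_fockBasis_left, fockBasis_apply]
    simp
  rw [ContinuousLinearMap.adjoint_inner_right, wordOp_model_fockBasis_empty, inner_smul_left,
    inner_fockBasis_left, fockBasis_apply, if_pos rfl, mul_one] at h1
  rw [← h1]
  simp

/-- The lengths of `α` and `β` are the positive and negative parts of `s`. -/
def HasDegree (s : Fin k → ℤ) (α β : MultiWord n) : Prop :=
  ∀ i, (α i).length = (s i).toNat ∧ (β i).length = (-s i).toNat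

lemma HasDegree.unique {s s' : Fin k → ℤ} {α β : MultiWord n} (h : HasDegree s α β)
    (h' : HasDegree s' α β) : s = s' := by
  funext i
  have h1 := h i
  have h2 := h' i
  omega

/-- A nonzero entry forces `β = β'γ` and `α = α'γ` for a common `γ`. In every slot one of `α_i`,
`β_i` is empty, so `γ` is empty: among the generators, the entry at `(α, β)` sees only its own. -/
lemma inner_model_matrix_entry (m : Fin k → ℕ) {s s' : Fin k → ℤ} {α β α' β' : MultiWord n}
    (h : HasDegree s α β) (h' : HasDegree s' α' β') :
    (wordWeight m α * wordWeight m β : ℂ) * inner ℂ (fockBasis n α)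
      ((wordOp (universalModel n m) α' ∘L (wordOp (universalModel n m) β').adjoint)
        (fockBasis n β)) = if α = α' ∧ β = β' then 1 else 0 := by
  have ha : (wordWeight m α : ℂ) ≠ 0 := by exact_mod_cast (wordWeight_pos m α).ne'
  have hb : (wordWeight m β : ℂ) ≠ 0 := by exact_mod_cast (wordWeight_pos m β).ne'
  rw [ContinuousLinearMap.comp_apply]
  split_ifs with heq
  · obtain ⟨rfl, rfl⟩ := heq
    rw [adjoint_wordOp_model_self, map_smul, wordOp_model_fockBasis_empty, inner_smul_right,
      inner_smul_right, inner_fockBasis_left, fockBasis_apply, if_pos rfl]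
    field_simp
  · by_cases hβ : ∃ γ, appendWord β' γ = β
    · obtain ⟨γ, rfl⟩ := hβ
      obtain ⟨c, hc⟩ := exists_adjoint_wordOp_model m β' γ
      obtain ⟨c', hc'⟩ := exists_wordOp_model_fockBasis m α' γ
      rw [hc, map_smul, hc', inner_smul_right, inner_smul_right, inner_fockBasis_left,
        fockBasis_apply, if_neg]
      · simp
      · rintro rfl
        refine heq ?_
        have hγ : γ = emptyWord n := by
          funext i
          have h1 := h i
          have h2 := h' i
          simp only [appendWord, List.length_append] at h1
          exact List.length_eq_zero_iff.mp (by omega)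
        rw [hγ, appendWord_empty, appendWord_empty]
        exact ⟨rfl, rfl⟩
    · rw [adjoint_wordOp_model_of_ne m β' β fun γ hγ => hβ ⟨γ, hγ⟩]
      simp

end ModelWords

/-! ### Coefficients and homogeneous parts of operators on `K ⊗ 𝓕` -/

section Coefficients

variable {k : ℕ} {n m : Fin k → ℕ}
  {E : Type*} [NormedAddCommGroup E] [InnerProductSpace ℂ E] [CompleteSpace E]
  {K : Type*} [NormedAddCommGroup K] [InnerProductSpace ℂ K] [CompleteSpace K]

lemma adjoint_htmulR_htmul (α : MultiWord n) (y : K) (f : Fock n) :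
    (htmulR (fockBasis n α) : K →L[ℂ] HTensor K (Fock n)).adjoint (htmul y f) =
      inner ℂ (fockBasis n α) f • y := by
  refine ext_inner_left ℂ fun z => ?_
  rw [ContinuousLinearMap.adjoint_inner_right, htmulR_apply, inner_htmul, inner_smul_right,
    mul_comm]

variable (m K) in
/-- The coefficient `A_{(α,β)}` of an operator on `K ⊗ 𝓕`. -/
noncomputable def coeffL (α β : MultiWord n) :
    (HTensor K (Fock n) →L[ℂ] HTensor K (Fock n)) →L[ℂ] (K →L[ℂ] K) where
  toFun T := (wordWeight m α * wordWeight m β : ℂ) •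
    ((htmulR (fockBasis n α) : K →L[ℂ] HTensor K (Fock n)).adjoint ∘L T ∘L
      htmulR (fockBasis n β))
  map_add' T T' := by
    rw [ContinuousLinearMap.add_comp, ContinuousLinearMap.comp_add, smul_add]
  map_smul' c T := by
    rw [ContinuousLinearMap.smul_comp, ContinuousLinearMap.comp_smul, smul_comm,
      RingHom.id_apply]
  cont := by
    have h : Continuous fun T : HTensor K (Fock n) →L[ℂ] HTensor K (Fock n) =>
        (htmulR (fockBasis n α) : K →L[ℂ] HTensor K (Fock n)).adjoint ∘L T ∘L
          htmulR (fockBasis n β) :=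
      continuous_const.clm_comp (continuous_id.clm_comp continuous_const)
    exact h.const_smul (wordWeight m α * wordWeight m β : ℂ)

lemma coeffL_model (C : K →L[ℂ] K) {s s' : Fin k → ℤ} {α β α' β' : MultiWord n}
    (h : HasDegree s α β) (h' : HasDegree s' α' β') :
    coeffL m K α β (opTensor C (wordOp (universalModel n m) α' ∘L
      (wordOp (universalModel n m) β').adjoint)) = if α = α' ∧ β = β' then C else 0 := by
  refine ContinuousLinearMap.ext fun x => ?_
  change (wordWeight m α * wordWeight m β : ℂ) •
    (htmulR (fockBasis n α) : K →L[ℂ] HTensor K (Fock n)).adjoint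
      (opTensor C _ (htmul x (fockBasis n β))) = _
  rw [opTensor_htmul, adjoint_htmulR_htmul, smul_smul, inner_model_matrix_entry m h h']
  split_ifs <;> simp

variable (m) in
/-- The coefficient family of an operator on `K ⊗ 𝓕`. -/
noncomputable def modelCoeffs (T : HTensor K (Fock n) →L[ℂ] HTensor K (Fock n)) : Coeffs n K :=
  fun α β => coeffL m K α β T

variable (m K) in
/-- The homogeneous part of degree `s` at `X` as a bounded function of `T`. -/
noncomputable def homogeneousL (X : OpTuple n E) (s : Fin k → ℤ) :
    (HTensor K (Fock n) →L[ℂ] HTensor K (Fock n)) →L[ℂ] (HTensor K E →L[ℂ] HTensor K E) :=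
  ∑ α : ∀ i, List.Vector (Fin (n i)) (s i).toNat,
    ∑ β : ∀ i, List.Vector (Fin (n i)) (-s i).toNat,
      opTensorLeft K K
        (wordOp X (fun i => (α i).toList) ∘L (wordOp X (fun i => (β i).toList)).adjoint) ∘L
      coeffL m K (fun i => (α i).toList) (fun i => (β i).toList)

lemma homogeneousL_apply (X : OpTuple n E) (s : Fin k → ℤ)
    (T : HTensor K (Fock n) →L[ℂ] HTensor K (Fock n)) :
    homogeneousL m K X s T = homogeneousPart (modelCoeffs m T) X s := by
  simp only [homogeneousL, homogeneousPart, sum_apply, ContinuousLinearMap.comp_apply,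
    opTensorLeft_apply]
  rfl

lemma homogeneousL_model (X : OpTuple n E) (C : K →L[ℂ] K) {s s' : Fin k → ℤ}
    {α' β' : MultiWord n} (h' : HasDegree s' α' β') :
    homogeneousL m K X s (opTensor C (wordOp (universalModel n m) α' ∘L
      (wordOp (universalModel n m) β').adjoint)) =
      if s = s' then opTensor C (wordOp X α' ∘L (wordOp X β').adjoint) else 0 := by
  have hdeg : ∀ (α : ∀ i, List.Vector (Fin (n i)) (s i).toNat)
      (β : ∀ i, List.Vector (Fin (n i)) (-s i).toNat),
      HasDegree s (fun i => (α i).toList) (fun i => (β i).toList) :=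
    fun α β i => ⟨(α i).2, (β i).2⟩
  have hterm : ∀ (α : ∀ i, List.Vector (Fin (n i)) (s i).toNat)
      (β : ∀ i, List.Vector (Fin (n i)) (-s i).toNat),
      coeffL m K (fun i => (α i).toList) (fun i => (β i).toList)
        (opTensor C (wordOp (universalModel n m) α' ∘L
          (wordOp (universalModel n m) β').adjoint)) =
      if (fun i => (α i).toList) = α' ∧ (fun i => (β i).toList) = β' then C else 0 :=
    fun α β => coeffL_model C (hdeg α β) h'
  rw [homogeneousL_apply]
  unfold homogeneousPart
  simp only [modelCoeffs, hterm]
  split_ifs with hs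
  · subst hs
    rw [Finset.sum_eq_single (fun i => ⟨α' i, (h' i).1⟩),
      Finset.sum_eq_single (fun i => ⟨β' i, (h' i).2⟩)]
    · rw [if_pos ⟨rfl, rfl⟩]
      rfl
    · intro β _ hβ
      rw [if_neg, opTensor_zero_left]
      rintro ⟨-, h⟩
      exact hβ (funext fun i => Subtype.ext (congrFun h i))
    · exact fun h => absurd (Finset.mem_univ _) h
    · intro α _ hα
      refine Finset.sum_eq_zero fun β _ => ?_
      rw [if_neg, opTensor_zero_left]
      rintro ⟨h, -⟩
      exact hα (funext fun i => Subtype.ext (congrFun h i))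
    · exact fun h => absurd (Finset.mem_univ _) h
  · refine Finset.sum_eq_zero fun α _ => Finset.sum_eq_zero fun β _ => ?_
    rw [if_neg, opTensor_zero_left]
    rintro ⟨h1, h2⟩
    refine hs ((hdeg α β).unique ?_)
    rw [h1, h2]
    exact h'

end Coefficients

/-! ### Iterated sums -/

section IteratedSums

lemma tendsto_Icc_neg_natCast :
    Tendsto (fun N : ℕ => Finset.Icc (-(N : ℤ)) N) atTop atTop := by
  refine tendsto_atTop_finset_of_monotone (fun a b hab => ?_) fun x => ⟨x.natAbs, ?_⟩
  · exact Finset.Icc_subset_Icc (by omega) (by omega)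
  · rw [Finset.mem_Icc]
    omega

lemma hasIteratedSum_of_summable_norm {V : Type*} [NormedAddCommGroup V] [CompleteSpace V] :
    ∀ {k : ℕ} (f : (Fin k → ℤ) → V), Summable (fun s => ‖f s‖) → HasIteratedSum k f (∑' s, f s)
  | 0, f, _ => by
    change f Fin.elim0 = _
    rw [tsum_eq_single Fin.elim0 fun s hs => absurd (Subsingleton.elim s _) hs]
  | k + 1, f, hf => by
    let e := Fin.consEquiv fun _ : Fin (k + 1) => ℤ
    have hs : Summable fun p : ℤ × (Fin k → ℤ) => ‖f (Fin.cons p.1 p.2)‖ :=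
      e.summable_iff.mpr hf
    refine ⟨fun s => ∑' t, f (Fin.cons s t), fun s =>
      hasIteratedSum_of_summable_norm _ (hs.prod_factor s), ?_⟩
    have h1 : HasSum (fun p : ℤ × (Fin k → ℤ) => f (Fin.cons p.1 p.2)) (∑' s, f s) :=
      e.hasSum_iff.mpr hf.of_norm.hasSum
    exact (h1.prod_fiberwise fun s => (hs.prod_factor s).of_norm.hasSum).comp
      tendsto_Icc_neg_natCast

lemma HasIteratedSum.map {V W : Type*} [NormedAddCommGroup V] [NormedSpace ℂ V]
    [NormedAddCommGroup W] [NormedSpace ℂ W] (L : V →L[ℂ] W) :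
    ∀ {k : ℕ} {f : (Fin k → ℤ) → V} {x : V}, HasIteratedSum k f x →
      HasIteratedSum k (fun s => L (f s)) (L x)
  | 0, f, x, h => by
    change L (f Fin.elim0) = L x
    rw [show f Fin.elim0 = x from h]
  | k + 1, f, x, ⟨g, hg, hx⟩ =>
    ⟨fun s => L (g s), fun s => HasIteratedSum.map L (hg s), by
      simpa only [Function.comp_def, map_sum] using (L.continuous.tendsto x).comp hx⟩

lemma HasIteratedSum.mem {V : Type*} [NormedAddCommGroup V] [NormedSpace ℂ V]
    {S : Submodule ℂ V} (hS : IsClosed (S : Set V)) :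
    ∀ {k : ℕ} {f : (Fin k → ℤ) → V} {x : V}, HasIteratedSum k f x → (∀ s, f s ∈ S) → x ∈ S
  | 0, f, x, h, hf => (show f Fin.elim0 = x from h) ▸ hf _
  | k + 1, f, x, ⟨g, hg, hx⟩, hf =>
    hS.mem_of_tendsto hx (Eventually.of_forall fun N =>
      S.sum_mem fun s _ => HasIteratedSum.mem hS (hg s) fun t => hf _)

lemma HasIteratedSum.unique {V : Type*} [AddCommMonoid V] [TopologicalSpace V] [T2Space V] :
    ∀ {k : ℕ} {f : (Fin k → ℤ) → V} {x y : V}, HasIteratedSum k f x → HasIteratedSum k f y → x = y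
  | 0, f, x, y, h, h' => (show f Fin.elim0 = x from h).symm.trans h'
  | k + 1, f, x, y, ⟨g, hg, hx⟩, ⟨g', hg', hy⟩ => by
    have : g = g' := funext fun s => HasIteratedSum.unique (hg s) (hg' s)
    subst this
    exact tendsto_nhds_unique hx hy

lemma summable_pow_natAbs {t : ℝ} (h0 : 0 ≤ t) (h1 : t < 1) :
    Summable fun s : ℤ => t ^ s.natAbs := by
  refine Summable.of_nat_of_neg ?_ ?_ <;> simpa using summable_geometric_of_lt_one h0 h1

lemma summable_prod_pow_natAbs (k : ℕ) {t : ℝ} (h0 : 0 ≤ t) (h1 : t < 1) :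
    Summable fun s : Fin k → ℤ => ∏ i, t ^ (s i).natAbs := by
  have hs := summable_pow_natAbs h0 h1
  have h := (hasSum_pi_list_prod (R := ℝ) (ι := fun _ : Fin k => ℤ)
    (fun _ s => t ^ s.natAbs) _ (fun _ => hs.hasSum) fun _ => hs.norm).1.summable
  simpa only [Fin.prod_univ_def] using h

/-- Pointwise convergence of contractions on a closed subspace may be tested on generators. -/
lemma tendsto_of_mem_topologicalClosure_span {V W ι : Type*} [NormedAddCommGroup V]
    [NormedSpace ℂ V] [NormedAddCommGroup W] [NormedSpace ℂ W] {l : Filter ι}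
    {L : ι → V →L[ℂ] W} {L' : V →L[ℂ] W} {A : Set V} (hL : ∀ᶠ r in l, ∀ T, ‖L r T‖ ≤ ‖T‖)
    (hL' : ∀ T, ‖L' T‖ ≤ ‖T‖) (h : ∀ T ∈ A, Tendsto (fun r => L r T) l (𝓝 (L' T))) {T : V}
    (hT : T ∈ (Submodule.span ℂ A).topologicalClosure) :
    Tendsto (fun r => L r T) l (𝓝 (L' T)) := by
  have hspan : ∀ T ∈ Submodule.span ℂ A, Tendsto (fun r => L r T) l (𝓝 (L' T)) := fun T hT => by
    induction hT using Submodule.span_induction with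
    | mem T hT => exact h T hT
    | zero => simpa using tendsto_const_nhds
    | add T T' _ _ h1 h2 => simpa using h1.add h2
    | smul c T _ h1 => simpa using h1.const_smul c
  rw [Metric.tendsto_nhds]
  intro ε hε
  obtain ⟨S, hS, hd⟩ := Metric.mem_closure_iff.mp hT (ε / 3) (by positivity)
  filter_upwards [hL, (Metric.tendsto_nhds.mp (hspan S hS)) (ε / 3) (by positivity)] with r hr hr'
  have h1 : dist (L r T) (L r S) ≤ dist T S := by
    rw [dist_eq_norm, dist_eq_norm, ← map_sub]
    exact hr _
  have h2 : dist (L' S) (L' T) ≤ dist T S := by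
    rw [dist_comm T S, dist_eq_norm, dist_eq_norm, ← map_sub]
    exact hL' _
  have h3 := dist_triangle4 (L r T) (L r S) (L' S) (L' T)
  linarith

/-- Uniform bounds on a closed subspace may be tested on the linear span. -/
lemma norm_le_of_mem_topologicalClosure {V W : Type*} [NormedAddCommGroup V]
    [NormedSpace ℂ V] [NormedAddCommGroup W] [NormedSpace ℂ W] {L : V →L[ℂ] W}
    {S : Submodule ℂ V} (h : ∀ T ∈ S, ‖L T‖ ≤ ‖T‖) {T : V} (hT : T ∈ S.topologicalClosure) :
    ‖L T‖ ≤ ‖T‖ := by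
  have hcl : IsClosed {T | ‖L T‖ ≤ ‖T‖} := isClosed_le L.continuous.norm continuous_norm
  exact closure_minimal (fun T hT => h T hT) hcl hT

end IteratedSums

/-! ### Averages over roots of unity -/

section RootsOfUnity

lemma sum_pow_zpow_of_primitive {N : ℕ} {ζ : ℂ} (hζ : IsPrimitiveRoot ζ N) (d : ℤ) :
    ∑ a : Fin N, (ζ ^ (a : ℕ)) ^ d = if (N : ℤ) ∣ d then (N : ℂ) else 0 := by
  have h1 : ∀ a : ℕ, (ζ ^ a) ^ d = (ζ ^ d) ^ a := fun a => by
    rw [← zpow_natCast, ← zpow_natCast, ← zpow_mul, ← zpow_mul, mul_comm]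
  simp_rw [h1]
  rw [Fin.sum_univ_eq_sum_range fun a => (ζ ^ d) ^ a]
  split_ifs with hd
  · rw [(hζ.zpow_eq_one_iff_dvd d).mpr hd]
    simp
  · have hne : ζ ^ d ≠ 1 := fun h => hd ((hζ.zpow_eq_one_iff_dvd d).mp h)
    have hpow : (ζ ^ d) ^ N = 1 := by rw [← h1, hζ.pow_eq_one, one_zpow]
    rw [geom_sum_eq hne, hpow, sub_self, zero_div]

/-- Orthogonality of the characters of `(ℤ/N)^k`, from one geometric sum per slot. -/
lemma sum_prod_zpow_of_primitive {k N : ℕ} {ζ : ℂ} (hζ : IsPrimitiveRoot ζ N)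
    (d : Fin k → ℤ) :
    ∑ θ : Fin k → Fin N, ∏ i, (ζ ^ (θ i : ℕ)) ^ d i =
      if ∀ i, (N : ℤ) ∣ d i then (N : ℂ) ^ k else 0 := by
  have h := Finset.prod_univ_sum (fun _ : Fin k => (Finset.univ : Finset (Fin N)))
    (fun i a => (ζ ^ (a : ℕ)) ^ d i)
  rw [Fintype.piFinset_univ] at h
  rw [← h]
  simp_rw [sum_pow_zpow_of_primitive hζ]
  split_ifs with hd
  · rw [Finset.prod_congr rfl fun i _ => if_pos (hd i)]
    simp
  · push Not at hd
    obtain ⟨i, hi⟩ := hd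
    exact Finset.prod_eq_zero (Finset.mem_univ i) (if_neg hi)

end RootsOfUnity

/-! ### Series of bounded maps between spaces of operators -/

section OperatorSpaceLemmas

variable {P Q : Type*} [NormedAddCommGroup P] [InnerProductSpace ℂ P]
  [NormedAddCommGroup Q] [InnerProductSpace ℂ Q]

lemma norm_smul_op (c : ℂ) (T : P →L[ℂ] Q) : ‖c • T‖ = ‖c‖ * ‖T‖ := norm_smul c T

lemma norm_sum_op_le_card {ι : Type*} [Fintype ι] (T : ι → P →L[ℂ] Q) {c : ℝ}
    (h : ∀ i, ‖T i‖ ≤ c) : ‖∑ i, T i‖ ≤ Fintype.card ι * c := by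
  have h2 := norm_sum_le_of_le Finset.univ fun i _ => h i
  rwa [Finset.sum_const, Finset.card_univ, nsmul_eq_mul] at h2

lemma norm_op_le_of_mem_topologicalClosure {S : Submodule ℂ (P →L[ℂ] P)}
    {L : (P →L[ℂ] P) →L[ℂ] (Q →L[ℂ] Q)} (h : ∀ T ∈ S, ‖L T‖ ≤ ‖T‖) {T : P →L[ℂ] P}
    (hT : T ∈ S.topologicalClosure) : ‖L T‖ ≤ ‖T‖ :=
  norm_le_of_mem_topologicalClosure h hT

lemma summable_norm_op {ι : Type*} {f : ι → (Q →L[ℂ] Q)} {b : ι → ℝ} (hb : Summable b)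
    (h : ∀ i, ‖f i‖ ≤ b i) : Summable fun i => ‖f i‖ :=
  Summable.of_nonneg_of_le (fun _ => norm_nonneg _) h hb

/-- A series of operator-valued maps dominated by a summable sequence, which converges to a
contraction on a set of generators, converges to it on their closed span. -/
lemma hasIteratedSum_of_mem_topologicalClosure_span [CompleteSpace Q] {k : ℕ}
    {A : Set (P →L[ℂ] P)}
    {L : (Fin k → ℤ) → (P →L[ℂ] P) →L[ℂ] (Q →L[ℂ] Q)} {B : (P →L[ℂ] P) →L[ℂ] (Q →L[ℂ] Q)}
    {b : (Fin k → ℤ) → ℝ} (hb : Summable b) (hb0 : ∀ s, 0 ≤ b s)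
    (hL : ∀ s, ∀ T ∈ (Submodule.span ℂ A).topologicalClosure, ‖L s T‖ ≤ b s * ‖T‖)
    (hB : ∀ T, ‖B T‖ ≤ ‖T‖) (hA : ∀ T ∈ A, HasSum (fun s => L s T) (B T))
    {T : P →L[ℂ] P} (hT : T ∈ (Submodule.span ℂ A).topologicalClosure) :
    HasIteratedSum k (fun s => L s T) (B T) := by
  have hsn : ∀ S ∈ (Submodule.span ℂ A).topologicalClosure, Summable fun s => ‖L s S‖ :=
    fun S hS => summable_norm_op (hb.mul_right ‖S‖) fun s => hL s S hS
  have hspan : ∀ S ∈ Submodule.span ℂ A, HasSum (fun s => L s S) (B S) := fun S hS => by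
    induction hS using Submodule.span_induction with
    | mem S hS => exact hA S hS
    | zero => simp
    | add S S' _ _ h1 h2 => simpa using h1.add h2
    | smul c S _ h1 => simpa using h1.const_smul c
  set c := ∑' s, b s with hc
  have hc0 : 0 ≤ c := tsum_nonneg hb0
  have hbound : ∀ S ∈ (Submodule.span ℂ A).topologicalClosure, ‖∑' s, L s S‖ ≤ c * ‖S‖ :=
    fun S hS => tsum_of_norm_bounded (hb.hasSum.mul_right ‖S‖) fun s => hL s S hS
  have key : ∑' s, L s T = B T := by
    rw [← sub_eq_zero, ← norm_le_zero_iff]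
    refine le_of_forall_pos_le_add fun ε hε => ?_
    -- The sum of the series and `B` agree at `S`. At `T - S` the former has norm at most `c‖T - S‖`
    -- and the latter at most `‖T - S‖`, whence the divisor `c + 1`.
    obtain ⟨S, hS, hd⟩ := Metric.mem_closure_iff.mp hT (ε / (c + 1)) (by positivity)
    have hS' := Submodule.le_topologicalClosure _ hS
    have hTS := Submodule.sub_mem _ hT hS'
    have h1 : ∑' s, L s T - B T = ∑' s, L s (T - S) - B (T - S) := by
      simp only [map_sub]
      rw [(hsn T hT).of_norm.tsum_sub (hsn S hS').of_norm, (hspan S hS).tsum_eq]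
      abel
    rw [h1, zero_add]
    rw [dist_eq_norm, lt_div_iff₀ (by positivity)] at hd
    calc _ ≤ c * ‖T - S‖ + ‖T - S‖ :=
          (norm_sub_le _ _).trans (add_le_add (hbound _ hTS) (hB _))
      _ = ‖T - S‖ * (c + 1) := by ring
      _ ≤ ε := hd.le
  exact key ▸ hasIteratedSum_of_summable_norm _ (hsn T hT)

end OperatorSpaceLemmas

/-! ### The Berezin transform of the model space -/

section Transform

variable {k : ℕ} {n m : Fin k → ℕ}
  {E : Type*} [NormedAddCommGroup E] [InnerProductSpace ℂ E] [CompleteSpace E]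
  {K : Type*} [NormedAddCommGroup K] [InnerProductSpace ℂ K]

/-- Splitting `r = √r · √r` spends one factor on keeping `Z` in the radial part, where the Berezin
kernel is an isometry, and leaves the other for geometric decay of homogeneous parts. -/
lemma exists_radial_factor {X : OpTuple n E} (hX : X ∈ radialPart n m E) :
    ∃ t : ℝ, 0 ≤ t ∧ t < 1 ∧ ∃ Z ∈ radialPart n m E, X = (t : ℂ) • Z := by
  obtain ⟨r, hr0, hr1, Y, hY, rfl⟩ := hX
  have h1 : √r < 1 := (Real.sqrt_lt' one_pos).mpr (by simpa using hr1)
  refine ⟨√r, Real.sqrt_nonneg r, h1, (√r : ℂ) • Y, ⟨√r, Real.sqrt_nonneg r, h1, Y, hY, rfl⟩, ?_⟩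
  rw [smul_smul, ← Complex.ofReal_mul, Real.mul_self_sqrt hr0]

lemma smul_mem_radialPart {X : OpTuple n E} (hX : X ∈ radialPart n m E) (c : Fin k → ℂ)
    (hc : ∀ i, ‖c i‖ ≤ 1) : (fun i j => c i • X i j) ∈ radialPart n m E := by
  obtain ⟨r, hr0, hr1, Y, hY, rfl⟩ := hX
  refine ⟨r, hr0, hr1, _, smul_mem_polyHyperball hY c hc, ?_⟩
  funext i j
  exact smul_comm (c i) (r : ℂ) (Y i j)

lemma wordOp_smul_comp_adjoint {X : OpTuple n E} (hX : CrossCommute X) (c : Fin k → ℂ)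
    (α β : MultiWord n) :
    wordOp (fun i j => c i • X i j) α ∘L (wordOp (fun i j => c i • X i j) β).adjoint =
      (∏ i, c i ^ (α i).length * (starRingEnd ℂ (c i)) ^ (β i).length) •
        (wordOp X α ∘L (wordOp X β).adjoint) := by
  rw [wordOp_smul hX, wordOp_smul hX, map_smulₛₗ, ContinuousLinearMap.smul_comp,
    ContinuousLinearMap.comp_smul, smul_smul, map_prod, Finset.prod_mul_distrib]
  simp only [map_pow]

lemma prod_unimodular_of_hasDegree {c : Fin k → ℂ} (hc : ∀ i, ‖c i‖ = 1) {s : Fin k → ℤ}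
    {α β : MultiWord n} (h : HasDegree s α β) :
    ∏ i, c i ^ (α i).length * (starRingEnd ℂ (c i)) ^ (β i).length = ∏ i, c i ^ s i := by
  refine Finset.prod_congr rfl fun i _ => ?_
  have h0 : c i ≠ 0 := fun h => by simpa [h] using hc i
  have h1 : starRingEnd ℂ (c i) = (c i)⁻¹ := by
    rw [Complex.inv_def, Complex.normSq_eq_norm_sq, hc]
    simp
  rw [h1, (h i).1, (h i).2, ← zpow_natCast, ← zpow_natCast, inv_zpow', ← zpow_add₀ h0]
  congr 1
  omega

lemma prod_real_of_hasDegree (t : ℝ) {s : Fin k → ℤ} {α β : MultiWord n} (h : HasDegree s α β) :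
    ∏ i, (t : ℂ) ^ (α i).length * (starRingEnd ℂ (t : ℂ)) ^ (β i).length =
      ((∏ i, t ^ (s i).natAbs : ℝ) : ℂ) := by
  rw [Complex.ofReal_prod]
  refine Finset.prod_congr rfl fun i _ => ?_
  rw [Complex.conj_ofReal, ← pow_add, Complex.ofReal_pow]
  congr 1
  have := h i
  omega

lemma homogeneousPart_real_smul (A : Coeffs n K) {X : OpTuple n E} (hX : CrossCommute X) (t : ℝ)
    (s : Fin k → ℤ) :
    homogeneousPart A ((t : ℂ) • X) s =
      ((∏ i, t ^ (s i).natAbs : ℝ) : ℂ) • homogeneousPart A X s := by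
  unfold homogeneousPart
  simp only [Finset.smul_sum]
  refine Finset.sum_congr rfl fun α _ => Finset.sum_congr rfl fun β _ => ?_
  have hdeg : HasDegree s (fun i => (α i).toList) (fun i => (β i).toList) :=
    fun i => ⟨(α i).2, (β i).2⟩
  have h := wordOp_smul_comp_adjoint hX (fun _ => (t : ℂ)) (fun i => (α i).toList)
    (fun i => (β i).toList)
  rw [prod_real_of_hasDegree t hdeg] at h
  rw [← opTensor_smul_right]
  exact congrArg _ h

/-- The averages of Berezin transforms over the `N`-th roots of unity. -/
noncomputable def averageL (m : Fin k → ℕ) (K : Type*) [NormedAddCommGroup K]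
    [InnerProductSpace ℂ K] (X : OpTuple n E) (s : Fin k → ℤ) (N : ℕ) :
    (HTensor K (Fock n) →L[ℂ] HTensor K (Fock n)) →L[ℂ] (HTensor K E →L[ℂ] HTensor K E) :=
  ((N : ℂ) ^ k)⁻¹ • ∑ θ : Fin k → Fin N,
    (∏ i, (Complex.exp (2 * Real.pi * Complex.I / N) ^ (θ i : ℕ)) ^ (-s i)) •
      berezinL m K (fun i j => Complex.exp (2 * Real.pi * Complex.I / N) ^ (θ i : ℕ) • X i j)

lemma norm_rootOfUnity {N : ℕ} (hN : N ≠ 0) (a : ℕ) :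
    ‖Complex.exp (2 * Real.pi * Complex.I / N) ^ a‖ = 1 := by
  rw [norm_pow, (Complex.isPrimitiveRoot_exp N hN).norm'_eq_one hN, one_pow]

lemma norm_averageL_apply_le (hm : ∀ i, 1 ≤ m i) {X : OpTuple n E} (hX : X ∈ radialPart n m E)
    (s : Fin k → ℤ) {N : ℕ} (hN : N ≠ 0) (T : HTensor K (Fock n) →L[ℂ] HTensor K (Fock n)) :
    ‖averageL m K X s N T‖ ≤ ‖T‖ := by
  rw [averageL, smul_apply, sum_apply, norm_smul_op]
  have h1 : ∀ θ : Fin k → Fin N,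
      ‖((∏ i, (Complex.exp (2 * Real.pi * Complex.I / N) ^ (θ i : ℕ)) ^ (-s i)) • berezinL m K
        (fun i j => Complex.exp (2 * Real.pi * Complex.I / N) ^ (θ i : ℕ) • X i j)) T‖ ≤ ‖T‖ :=
      fun θ => by
    rw [smul_apply, norm_smul_op, norm_prod, Finset.prod_eq_one fun i _ => by
      rw [norm_zpow, norm_rootOfUnity hN, one_zpow], one_mul]
    exact norm_berezinL_apply_le hm
      (smul_mem_radialPart hX _ fun i => (norm_rootOfUnity hN _).le) T
  have h2 := norm_sum_op_le_card _ h1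
  rw [Fintype.card_fun, Fintype.card_fin, Fintype.card_fin] at h2
  have h3 : ‖((N : ℂ) ^ k)⁻¹‖ = ((N : ℝ) ^ k)⁻¹ := by simp
  have hpos : (0 : ℝ) < (N : ℝ) ^ k := pow_pos (Nat.cast_pos.mpr (Nat.pos_of_ne_zero hN)) k
  rw [h3, inv_mul_le_iff₀ hpos]
  exact_mod_cast h2

/-- Rotating `X` by `θ` multiplies a term of degree `s'` by `θ^{s'}`, so averaging against `θ^{-s}`
selects `s' = s`. The lower bound on `N` excludes aliasing: no nonzero `s' i - s i` is divisible by
`N`. -/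
lemma averageL_model [CompleteSpace K] (hm : ∀ i, 1 ≤ m i) {X : OpTuple n E} (hX : X ∈ radialPart n m E)
    (C : K →L[ℂ] K) (s : Fin k → ℤ) {s' : Fin k → ℤ} {α β : MultiWord n}
    (h : HasDegree s' α β) {N : ℕ} (hN : ∀ i, (s' i - s i).natAbs < N) (hN0 : N ≠ 0) :
    averageL m K X s N (opTensor C (wordOp (universalModel n m) α ∘L
      (wordOp (universalModel n m) β).adjoint)) =
      homogeneousL m K X s (opTensor C (wordOp (universalModel n m) α ∘L
        (wordOp (universalModel n m) β).adjoint)) := by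
  have hc : CrossCommute X := (radialPart_subset_polyHyperball hX).1
  set ζ := Complex.exp (2 * Real.pi * Complex.I / N) with hζdef
  have hζ : IsPrimitiveRoot ζ N := Complex.isPrimitiveRoot_exp N hN0
  have hζ0 : ζ ≠ 0 := hζ.ne_zero hN0
  have h1 : ∀ θ : Fin k → Fin N, ((∏ i, (ζ ^ (θ i : ℕ)) ^ (-s i)) • berezinL m K
      (fun i j => ζ ^ (θ i : ℕ) • X i j)) (opTensor C (wordOp (universalModel n m) α ∘L
      (wordOp (universalModel n m) β).adjoint)) =
      (∏ i, (ζ ^ (θ i : ℕ)) ^ (s' i - s i)) •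
        opTensor C (wordOp X α ∘L (wordOp X β).adjoint) := fun θ => by
    rw [smul_apply, berezinL_model hm
      (smul_mem_radialPart hX _ fun i => (norm_rootOfUnity hN0 _).le),
      wordOp_smul_comp_adjoint hc, prod_unimodular_of_hasDegree
        (fun i => norm_rootOfUnity hN0 _) h, opTensor_smul_right, smul_smul,
      ← Finset.prod_mul_distrib]
    congr 1
    refine Finset.prod_congr rfl fun i _ => ?_
    rw [← zpow_add₀ (pow_ne_zero _ hζ0)]
    congr 1
    ring
  have hdvd : (∀ i, (N : ℤ) ∣ s' i - s i) ↔ s = s' := by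
    constructor
    · intro hd
      funext i
      have := Int.eq_zero_of_dvd_of_natAbs_lt_natAbs (hd i) (by simpa using hN i)
      omega
    · rintro rfl i
      simp
  rw [homogeneousL_model X C h, averageL, smul_apply, sum_apply, Finset.sum_congr rfl fun θ _ => h1 θ,
    ← Finset.sum_smul, sum_prod_zpow_of_primitive hζ, smul_smul]
  simp only [hdvd]
  split_ifs with hs
  · rw [inv_mul_cancel₀ (pow_ne_zero _ (Nat.cast_ne_zero.mpr hN0)), one_smul]
  · rw [mul_zero, zero_smul]

/-- The generators of `𝓖`. -/
def modelGenerators (n m : Fin k → ℕ) (K : Type*) [NormedAddCommGroup K] [InnerProductSpace ℂ K] :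
    Set (HTensor K (Fock n) →L[ℂ] HTensor K (Fock n)) :=
  {T | ∃ (C : K →L[ℂ] K) (α β : MultiWord n) (s : Fin k → ℤ), HasDegree s α β ∧
    T = opTensor C (wordOp (universalModel n m) α ∘L (wordOp (universalModel n m) β).adjoint)}

lemma isClosed_modelSpace :
    IsClosed (modelSpace n m K : Set (HTensor K (Fock n) →L[ℂ] HTensor K (Fock n))) :=
  Submodule.isClosed_topologicalClosure _

/-- A Cauchy estimate, with finite averages over roots of unity in place of an integral over the
torus. On the algebraic span the homogeneous part equals such an average for all large `N`; the
bound does not involve `N` and passes to the closure. -/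
lemma norm_homogeneousL_apply_le [CompleteSpace K] (hm : ∀ i, 1 ≤ m i) {X : OpTuple n E}
    (hX : X ∈ radialPart n m E) (s : Fin k → ℤ)
    {T : HTensor K (Fock n) →L[ℂ] HTensor K (Fock n)} (hT : T ∈ modelSpace n m K) :
    ‖homogeneousL m K X s T‖ ≤ ‖T‖ := by
  refine norm_op_le_of_mem_topologicalClosure (fun T hT => ?_) hT
  have h : ∀ᶠ N in atTop, averageL m K X s N T = homogeneousL m K X s T := by
    induction hT using Submodule.span_induction with
    | mem T hT =>
      obtain ⟨C, α, β, s', h, rfl⟩ := hT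
      filter_upwards [eventually_gt_atTop (∑ i, (s' i - s i).natAbs)] with N hN
      refine averageL_model hm hX C s h (fun i => lt_of_le_of_lt ?_ hN) (by omega)
      exact Finset.single_le_sum (f := fun i => (s' i - s i).natAbs) (fun _ _ => Nat.zero_le _)
        (Finset.mem_univ i)
    | zero => exact Eventually.of_forall fun N => by rw [map_zero, map_zero]
    | add T T' _ _ h1 h2 =>
      filter_upwards [h1, h2] with N h1 h2
      rw [map_add, map_add, h1, h2]
    | smul c T _ h1 =>
      filter_upwards [h1] with N h1
      rw [map_smul, map_smul, h1]
  obtain ⟨N, hN, hN0⟩ := (h.and (eventually_ne_atTop 0)).exists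
  rw [← hN]
  exact norm_averageL_apply_le hm hX s hN0 T

lemma norm_homogeneousL_real_smul_le [CompleteSpace K] (hm : ∀ i, 1 ≤ m i) {Z : OpTuple n E}
    (hZ : Z ∈ radialPart n m E) {t : ℝ} (ht : 0 ≤ t) (s : Fin k → ℤ)
    {T : HTensor K (Fock n) →L[ℂ] HTensor K (Fock n)} (hT : T ∈ modelSpace n m K) :
    ‖homogeneousL m K ((t : ℂ) • Z) s T‖ ≤ (∏ i, t ^ (s i).natAbs) * ‖T‖ := by
  have hc : CrossCommute Z := (radialPart_subset_polyHyperball hZ).1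
  have h0 : 0 ≤ ∏ i, t ^ (s i).natAbs := Finset.prod_nonneg fun i _ => pow_nonneg ht _
  rw [homogeneousL_apply, homogeneousPart_real_smul _ hc, ← homogeneousL_apply, norm_smul_op,
    Complex.norm_real, Real.norm_of_nonneg h0]
  exact mul_le_mul_of_nonneg_left (norm_homogeneousL_apply_le hm hZ s hT) h0

/-- The Berezin transform of `T ∈ 𝓖` is free `k`-pluriharmonic. -/
theorem hasValue_berezinL [CompleteSpace K] (hm : ∀ i, 1 ≤ m i) {X : OpTuple n E}
    (hX : X ∈ radialPart n m E) {T : HTensor K (Fock n) →L[ℂ] HTensor K (Fock n)}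
    (hT : T ∈ modelSpace n m K) : HasValue (modelCoeffs m T) X (berezinL m K X T) := by
  obtain ⟨t, ht0, ht1, Z, hZ, hXZ⟩ := exists_radial_factor hX
  have h : HasIteratedSum k (fun s => homogeneousL m K X s T) (berezinL m K X T) := by
    refine hasIteratedSum_of_mem_topologicalClosure_span (A := modelGenerators n m K)
      (b := fun s => ∏ i, t ^ (s i).natAbs) (summable_prod_pow_natAbs k ht0 ht1)
      (fun s => Finset.prod_nonneg fun i _ => pow_nonneg ht0 _)
      (fun s S hS => hXZ ▸ norm_homogeneousL_real_smul_le hm hZ ht0 s hS)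
      (norm_berezinL_apply_le hm hX) ?_ hT
    rintro S ⟨C, α, β, s', h, rfl⟩
    rw [berezinL_model hm hX]
    simp_rw [homogeneousL_model X C h]
    -- On a generator the series has a single nonzero term, which is its Berezin transform.
    exact hasSum_ite_eq s' _
  simp only [homogeneousL_apply] at h
  exact h

end Transform

/-! ### Limits and continuous extension of families of contractions -/

section OperatorSpaceLemmas

variable {P Q : Type*} [NormedAddCommGroup P] [InnerProductSpace ℂ P]
  [NormedAddCommGroup Q] [InnerProductSpace ℂ Q]

lemma HasIteratedSum.map_op (L : (P →L[ℂ] P) →L[ℂ] (Q →L[ℂ] Q)) {k : ℕ}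
    {f : (Fin k → ℤ) → (P →L[ℂ] P)} {x : P →L[ℂ] P} (h : HasIteratedSum k f x) :
    HasIteratedSum k (fun s => L (f s)) (L x) :=
  h.map L

lemma HasIteratedSum.mem_op {S : Submodule ℂ (P →L[ℂ] P)}
    (hS : IsClosed (S : Set (P →L[ℂ] P))) {k : ℕ} {f : (Fin k → ℤ) → (P →L[ℂ] P)}
    {x : P →L[ℂ] P} (h : HasIteratedSum k f x) (hf : ∀ s, f s ∈ S) : x ∈ S :=
  h.mem hS hf

lemma HasIteratedSum.unique_op {k : ℕ} {f : (Fin k → ℤ) → (P →L[ℂ] P)}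
    {x y : P →L[ℂ] P} (h : HasIteratedSum k f x) (h' : HasIteratedSum k f y) : x = y :=
  h.unique h'

lemma tendsto_op_of_mem_topologicalClosure_span {ι : Type*} {l : Filter ι}
    {L : ι → (P →L[ℂ] P) →L[ℂ] (Q →L[ℂ] Q)} {L' : (P →L[ℂ] P) →L[ℂ] (Q →L[ℂ] Q)}
    {A : Set (P →L[ℂ] P)} (hL : ∀ᶠ r in l, ∀ T, ‖L r T‖ ≤ ‖T‖)
    (hL' : ∀ T, ‖L' T‖ ≤ ‖T‖) (h : ∀ T ∈ A, Tendsto (fun r => L r T) l (𝓝 (L' T)))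
    {T : P →L[ℂ] P} (hT : T ∈ (Submodule.span ℂ A).topologicalClosure) :
    Tendsto (fun r => L r T) l (𝓝 (L' T)) :=
  tendsto_of_mem_topologicalClosure_span hL hL' h hT

/-- In `L r (G r) = L r (G r - T) + L r T` the first term tends to zero by the uniform bound. -/
lemma tendsto_op_of_contractions {ι : Type*} {l : Filter ι}
    {L : ι → (P →L[ℂ] P) →L[ℂ] (Q →L[ℂ] Q)} {G : ι → (P →L[ℂ] P)} {T : P →L[ℂ] P}
    {Y : Q →L[ℂ] Q} (hL : ∀ᶠ r in l, ∀ T, ‖L r T‖ ≤ ‖T‖) (hG : Tendsto G l (𝓝 T))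
    (h : Tendsto (fun r => L r T) l (𝓝 Y)) : Tendsto (fun r => L r (G r)) l (𝓝 Y) := by
  have h1 : Tendsto (fun r => L r (G r - T)) l (𝓝 0) :=
    squeeze_zero_norm' (hL.mono fun r hr => hr (G r - T))
      (tendsto_iff_norm_sub_tendsto_zero.mp hG)
  simpa using h1.add h

lemma mem_of_tendsto_op {ι : Type*} {l : Filter ι} [l.NeBot] {S : Submodule ℂ (P →L[ℂ] P)}
    (hS : IsClosed (S : Set (P →L[ℂ] P))) {G : ι → (P →L[ℂ] P)} {T : P →L[ℂ] P}
    (hG : Tendsto G l (𝓝 T)) (h : ∀ᶠ r in l, G r ∈ S) : T ∈ S :=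
  hS.mem_of_tendsto hG h

/-- Contractions `L X`, depending continuously on `X` on a set of generators, extend continuously
in `X` to the closure, on the closed span of the generators. -/
lemma exists_continuousOn_extension {Ω : Type*} [TopologicalSpace Ω] [CompleteSpace Q]
    {L : Ω → (P →L[ℂ] P) →L[ℂ] (Q →L[ℂ] Q)} {R B : Set Ω} {A : Set (P →L[ℂ] P)}
    (hL : ∀ X ∈ R, ∀ T, ‖L X T‖ ≤ ‖T‖)
    (hA : ∀ T ∈ A, ∃ f : Ω → (Q →L[ℂ] Q), Continuous f ∧ ∀ X ∈ R, L X T = f X)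
    {T : P →L[ℂ] P} (hT : T ∈ (Submodule.span ℂ A).topologicalClosure)
    (hB : B ⊆ closure R) {M : Submodule ℂ (Q →L[ℂ] Q)} (hM : IsClosed (M : Set (Q →L[ℂ] Q)))
    (hLM : ∀ X ∈ R, L X T ∈ M) :
    ∃ G : Ω → M, ContinuousOn G B ∧ ∀ X ∈ R, (G X : Q →L[ℂ] Q) = L X T := by
  classical
  have hspan : ∀ T ∈ Submodule.span ℂ A,
      ∃ f : Ω → (Q →L[ℂ] Q), Continuous f ∧ ∀ X ∈ R, L X T = f X := fun T hT => by
    induction hT using Submodule.span_induction with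
    | mem T hT => exact hA T hT
    | zero => exact ⟨0, continuous_zero, fun X _ => by simp⟩
    | add T T' _ _ h1 h2 =>
      obtain ⟨f, hf, h1⟩ := h1
      obtain ⟨g, hg, h2⟩ := h2
      exact ⟨f + g, hf.add hg, fun X hX => by rw [map_add, h1 X hX, h2 X hX]; rfl⟩
    | smul c T _ h1 =>
      obtain ⟨f, hf, h1⟩ := h1
      exact ⟨c • f, hf.const_smul c, fun X hX => by rw [map_smul, h1 X hX]; rfl⟩
  have : CompleteSpace M := hM.completeSpace_coe
  let F : Ω → M := fun X => if h : X ∈ R then ⟨L X T, hLM X h⟩ else 0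
  have hF : ∀ X ∈ R, (F X : Q →L[ℂ] Q) = L X T := fun X hX => by simp [F, hX]
  have hlim : ∀ X ∈ closure R, ∃ Y, Tendsto F (𝓝[R] X) (𝓝 Y) := fun X hX => by
    have := mem_closure_iff_nhdsWithin_neBot.mp hX
    refine cauchy_map_iff_exists_tendsto.mp (Metric.cauchy_iff.mpr ⟨inferInstance, fun ε hε => ?_⟩)
    -- Two quarters pay for replacing `T` by `S` at the points `Z` and `Z'`, the other two for the
    -- distances of `f Z` and `f Z'` from `f X`.
    obtain ⟨S, hS, hd⟩ := Metric.mem_closure_iff.mp hT (ε / 4) (by positivity)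
    obtain ⟨f, hf, hfS⟩ := hspan S hS
    have hU : {Z | dist (f Z) (f X) < ε / 4} ∈ 𝓝[R] X :=
      mem_nhdsWithin_of_mem_nhds ((Metric.isOpen_ball.preimage hf).mem_nhds (by simpa using hε))
    refine ⟨F '' ({Z | dist (f Z) (f X) < ε / 4} ∩ R),
      image_mem_map (inter_mem hU self_mem_nhdsWithin), ?_⟩
    have hclose : ∀ Z ∈ R, dist (F Z : Q →L[ℂ] Q) (f Z) < ε / 4 := fun Z hZ => by
      rw [hF Z hZ, ← hfS Z hZ, dist_eq_norm, ← map_sub]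
      rw [dist_eq_norm] at hd
      exact (hL Z hZ _).trans_lt hd
    rintro _ ⟨Z, ⟨hZ, hZR⟩, rfl⟩ _ ⟨Z', ⟨hZ', hZR'⟩, rfl⟩
    rw [Subtype.dist_eq]
    have h1 := dist_triangle4 (F Z : Q →L[ℂ] Q) (f Z) (f Z') (F Z')
    have h2 := dist_triangle_right (f Z) (f Z') (f X)
    have h3 := hclose Z hZR
    have h4 := hclose Z' hZR'
    rw [dist_comm] at h4
    rw [Set.mem_ofPred_eq] at hZ hZ'
    linarith
  refine ⟨extendFrom R F, continuousOn_extendFrom hB fun X hX => hlim X (hB hX), fun X hX => ?_⟩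
  rw [← hF X hX]
  obtain ⟨Y, hY⟩ := hlim X (subset_closure hX)
  rw [extendFrom_eq (subset_closure hX) hY]
  -- For `X ∈ R` the filter `𝓝[R] X` contains the point `X` itself, so the limit is forced to be `F
  -- X`.
  exact congrArg _ (tendsto_nhds_unique (hY.mono_left (pure_le_nhdsWithin hX))
    (tendsto_pure_nhds F X))

end OperatorSpaceLemmas

/-! ### Radial approximation and boundary behaviour of Berezin transforms -/

section Radial

variable {k : ℕ} {n m : Fin k → ℕ}
  {E : Type*} [NormedAddCommGroup E] [InnerProductSpace ℂ E] [CompleteSpace E]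
  {K : Type*} [NormedAddCommGroup K] [InnerProductSpace ℂ K]

lemma real_smul_mem_radialPart {X : OpTuple n E} (hX : X ∈ polyHyperball n m E) {r : ℝ}
    (h0 : 0 ≤ r) (h1 : r < 1) : (r : ℂ) • X ∈ radialPart n m E :=
  ⟨r, h0, h1, X, hX, rfl⟩

lemma tendsto_real_smul (X : OpTuple n E) :
    Tendsto (fun r : ℝ => (r : ℂ) • X) (𝓝[<] 1) (𝓝 X) := by
  have h : Continuous fun r : ℝ => (r : ℂ) • X := by fun_prop
  have h1 := h.tendsto 1
  rw [Complex.ofReal_one, one_smul] at h1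
  exact h1.mono_left nhdsWithin_le_nhds

lemma eventually_mem_unit_Ico : ∀ᶠ r : ℝ in 𝓝[<] 1, 0 ≤ r ∧ r < 1 := by
  filter_upwards [self_mem_nhdsWithin, mem_nhdsWithin_of_mem_nhds (Ioi_mem_nhds one_pos)]
    with r h1 h0
  exact ⟨le_of_lt h0, h1⟩

lemma polyHyperball_subset_closure : polyHyperball n m E ⊆ closure (radialPart n m E) :=
  fun X hX => mem_closure_of_tendsto (tendsto_real_smul X)
    (eventually_mem_unit_Ico.mono fun _ hr => real_smul_mem_radialPart hX hr.1 hr.2)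

lemma continuous_opTensor_wordOp (C : K →L[ℂ] K) (α β : MultiWord n) :
    Continuous fun X : OpTuple n E => opTensor C (wordOp X α ∘L (wordOp X β).adjoint) := by
  have h1 : Continuous fun X : OpTuple n E => wordOp X α ∘L (wordOp X β).adjoint :=
    (continuous_wordOp α).clm_comp
      ((ContinuousLinearMap.adjoint (𝕜 := ℂ) (E := E) (F := E)).continuous.comp
        (continuous_wordOp β))
  exact (opTensorRight E E C).continuous.comp h1

lemma homogeneousPart_mem_modelSpace (A : Coeffs n K) (s : Fin k → ℤ) :
    homogeneousPart A (universalModel n m) s ∈ modelSpace n m K := by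
  refine Submodule.sum_mem _ fun α _ => Submodule.sum_mem _ fun β _ =>
    Submodule.le_topologicalClosure _ (Submodule.subset_span ⟨_, _, _, s, ?_, rfl⟩)
  exact fun i => ⟨(α i).2, (β i).2⟩

lemma HasValue.mem_modelSpace {A : Coeffs n K} {t : ℝ}
    {Y : HTensor K (Fock n) →L[ℂ] HTensor K (Fock n)}
    (h : HasValue A ((t : ℂ) • universalModel n m) Y) : Y ∈ modelSpace n m K := by
  refine HasIteratedSum.mem_op isClosed_modelSpace h fun s => ?_
  rw [homogeneousPart_real_smul _ (crossCommute_universalModel m)]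
  exact Submodule.smul_mem _ _ (homogeneousPart_mem_modelSpace A s)

lemma berezinL_homogeneousPart [CompleteSpace K] (hm : ∀ i, 1 ≤ m i) {Z : OpTuple n E}
    (hZ : Z ∈ radialPart n m E) (A : Coeffs n K) (s : Fin k → ℤ) :
    berezinL m K Z (homogeneousPart A (universalModel n m) s) = homogeneousPart A Z s := by
  simp only [homogeneousPart, map_sum, berezinL_model hm hZ]

/-- The value at `tZ` is the Berezin transform at `Z` of the value at `t𝐖`. -/
lemma HasValue.berezinL_smul [CompleteSpace K] (hm : ∀ i, 1 ≤ m i) {A : Coeffs n K} {t : ℝ}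
    {Y : HTensor K (Fock n) →L[ℂ] HTensor K (Fock n)}
    (h : HasValue A ((t : ℂ) • universalModel n m) Y) {Z : OpTuple n E}
    (hZ : Z ∈ radialPart n m E) : HasValue A ((t : ℂ) • Z) (berezinL m K Z Y) := by
  have h1 := HasIteratedSum.map_op (berezinL m K Z) h
  have h2 : (fun s => berezinL m K Z (homogeneousPart A ((t : ℂ) • universalModel n m) s)) =
      homogeneousPart A ((t : ℂ) • Z) := by
    funext s
    rw [homogeneousPart_real_smul _ (crossCommute_universalModel m),
      homogeneousPart_real_smul _ (radialPart_subset_polyHyperball hZ).1, map_smul,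
      berezinL_homogeneousPart hm hZ]
  rw [h2] at h1
  exact h1

lemma HasValue.unique {A : Coeffs n K} {X : OpTuple n E} {Y Y' : HTensor K E →L[ℂ] HTensor K E}
    (h : HasValue A X Y) (h' : HasValue A X Y') : Y = Y' :=
  HasIteratedSum.unique_op h h'

lemma homogeneousPart_mem_minTensor (A : Coeffs n K) (X : OpTuple n E) (s : Fin k → ℤ) :
    homogeneousPart A X s ∈ minTensor K E :=
  Submodule.sum_mem _ fun _ _ => Submodule.sum_mem _ fun _ _ => opTensor_mem_minTensor _ _

lemma berezinL_mem_minTensor [CompleteSpace K] (hm : ∀ i, 1 ≤ m i) {X : OpTuple n E}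
    (hX : X ∈ radialPart n m E) {T : HTensor K (Fock n) →L[ℂ] HTensor K (Fock n)}
    (hT : T ∈ modelSpace n m K) : berezinL m K X T ∈ minTensor K E :=
  HasIteratedSum.mem_op isClosed_minTensor (hasValue_berezinL hm hX hT)
    fun s => homogeneousPart_mem_minTensor _ _ s

lemma exists_extension_berezinL [CompleteSpace K] (hm : ∀ i, 1 ≤ m i)
    {T : HTensor K (Fock n) →L[ℂ] HTensor K (Fock n)} (hT : T ∈ modelSpace n m K) :
    ∃ G : OpTuple n E → minTensor K E, ContinuousOn G (polyHyperball n m E) ∧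
      ∀ X ∈ radialPart n m E,
        (G X : HTensor K E →L[ℂ] HTensor K E) = berezinL m K X T := by
  refine exists_continuousOn_extension (A := modelGenerators n m K)
    (fun X hX => norm_berezinL_apply_le hm hX) ?_ hT polyHyperball_subset_closure
    isClosed_minTensor (fun X hX => berezinL_mem_minTensor hm hX hT)
  rintro T ⟨C, α, β, s, -, rfl⟩
  exact ⟨_, continuous_opTensor_wordOp C α β, fun X hX => berezinL_model hm hX C α β⟩

lemma tendsto_berezinL_of_tendsto [CompleteSpace K] (hm : ∀ i, 1 ≤ m i) {ι : Type*} {l : Filter ι}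
    {X : ι → OpTuple n E} {Z : OpTuple n E} (hX : ∀ᶠ r in l, X r ∈ radialPart n m E)
    (hZ : Z ∈ radialPart n m E) (h : Tendsto X l (𝓝 Z))
    {T : HTensor K (Fock n) →L[ℂ] HTensor K (Fock n)} (hT : T ∈ modelSpace n m K) :
    Tendsto (fun r => berezinL m K (X r) T) l (𝓝 (berezinL m K Z T)) := by
  refine tendsto_op_of_mem_topologicalClosure_span (A := modelGenerators n m K)
    (hX.mono fun r hr => norm_berezinL_apply_le hm hr) (norm_berezinL_apply_le hm hZ) ?_ hT
  rintro T ⟨C, α, β, s, -, rfl⟩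
  rw [berezinL_model hm hZ]
  exact (((continuous_opTensor_wordOp C α β).tendsto Z).comp h).congr'
    (hX.mono fun r hr => (berezinL_model hm hr C α β).symm)

/-- On generators this is continuity of `r ↦ C ⊗ (r𝐖)_α (r𝐖)_β^*` at `r = 1`. The limiting map is
the identity, so no Berezin kernel at `𝐖` itself is needed. -/
lemma tendsto_berezinL_universalModel [CompleteSpace K] (hm : ∀ i, 1 ≤ m i)
    {T : HTensor K (Fock n) →L[ℂ] HTensor K (Fock n)} (hT : T ∈ modelSpace n m K) :
    Tendsto (fun r : ℝ => berezinL m K ((r : ℂ) • universalModel n m) T) (𝓝[<] 1) (𝓝 T) := by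
  have hW : ∀ᶠ r : ℝ in 𝓝[<] 1, (r : ℂ) • universalModel n m ∈ radialPart n m (Fock n) :=
    eventually_mem_unit_Ico.mono fun r hr =>
      real_smul_mem_radialPart (universalModel_mem_polyHyperball hm) hr.1 hr.2
  refine tendsto_op_of_mem_topologicalClosure_span (A := modelGenerators n m K)
    (L' := ContinuousLinearMap.id ℂ _)
    (hW.mono fun r hr => norm_berezinL_apply_le hm hr) (fun _ => le_rfl) ?_ hT
  rintro T ⟨C, α, β, s, -, rfl⟩
  exact (((continuous_opTensor_wordOp C α β).tendsto _).comp
    (tendsto_real_smul (universalModel n m))).congr'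
    (hW.mono fun r hr => (berezinL_model hm hr C α β).symm)

end Radial

/-! ### Unitary invariance of the poly-hyperball and of values -/

section UnitaryTransport

variable {k : ℕ} {n m : Fin k → ℕ}
  {E : Type*} [NormedAddCommGroup E] [InnerProductSpace ℂ E] [CompleteSpace E]
  {E' : Type*} [NormedAddCommGroup E'] [InnerProductSpace ℂ E'] [CompleteSpace E']
  {K : Type*} [NormedAddCommGroup K] [InnerProductSpace ℂ K]

/-- The tuple `U X U^*`. -/
noncomputable def conjTuple (U : E ≃ₗᵢ[ℂ] E') (X : OpTuple n E) : OpTuple n E' :=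
  fun i j => U.conjStarAlgEquiv (X i j)

lemma conjTuple_symm_conjTuple (U : E ≃ₗᵢ[ℂ] E') (X : OpTuple n E) :
    conjTuple U.symm (conjTuple U X) = X := by
  funext i j
  ext x
  simp [conjTuple]

lemma conjTuple_smul (U : E ≃ₗᵢ[ℂ] E') (c : ℂ) (X : OpTuple n E) :
    conjTuple U (c • X) = c • conjTuple U X := by
  funext i j
  exact map_smul U.conjStarAlgEquiv c (X i j)

lemma isPositive_conjStarAlgEquiv (U : E ≃ₗᵢ[ℂ] E') {T : E →L[ℂ] E} (hT : T.IsPositive) :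
    (U.conjStarAlgEquiv T).IsPositive := by
  have h := hT.conj_adjoint (U : E →L[ℂ] E')
  rwa [LinearIsometryEquiv.adjoint_eq_symm] at h

lemma conjTuple_mem_polyHyperball (U : E ≃ₗᵢ[ℂ] E') {X : OpTuple n E}
    (hX : X ∈ polyHyperball n m E) : conjTuple U X ∈ polyHyperball n m E' := by
  refine ⟨fun p q hpq a b => (hX.1 p q hpq a b).map U.conjStarAlgEquiv, fun p hp => ?_⟩
  have h := defect_map (U.conjStarAlgEquiv : (E →L[ℂ] E) →⋆ₐ[ℂ] (E' →L[ℂ] E')) X p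
  have h2 : defect (conjTuple U X) p = U.conjStarAlgEquiv (defect X p) := h
  rw [h2]
  exact isPositive_conjStarAlgEquiv U (hX.2 p hp)

/-- Conjugation of operators on `K ⊗ E` by `I ⊗ U`. -/
noncomputable def conjTensor (K : Type*) [NormedAddCommGroup K] [InnerProductSpace ℂ K]
    (U : E ≃ₗᵢ[ℂ] E') (T : HTensor K E →L[ℂ] HTensor K E) : HTensor K E' →L[ℂ] HTensor K E' :=
  opTensor (.id ℂ K) (U : E →L[ℂ] E') ∘L T ∘L opTensor (.id ℂ K) (U.symm : E' →L[ℂ] E)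

/-- Two-sided multiplication by fixed operators. -/
noncomputable def sandwichL {P Q : Type*} [NormedAddCommGroup P] [InnerProductSpace ℂ P]
    [NormedAddCommGroup Q] [InnerProductSpace ℂ Q] (A : P →L[ℂ] Q) (B : Q →L[ℂ] P) :
    (P →L[ℂ] P) →L[ℂ] (Q →L[ℂ] Q) where
  toFun T := A ∘L T ∘L B
  map_add' T T' := by simp
  map_smul' c T := by simp
  cont := continuous_const.clm_comp (continuous_id.clm_comp continuous_const)

/-- `conjTensor` as a bounded linear map. -/
noncomputable def conjTensorL (K : Type*) [NormedAddCommGroup K] [InnerProductSpace ℂ K]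
    (U : E ≃ₗᵢ[ℂ] E') :
    (HTensor K E →L[ℂ] HTensor K E) →L[ℂ] (HTensor K E' →L[ℂ] HTensor K E') :=
  sandwichL (opTensor (.id ℂ K) (U : E →L[ℂ] E')) (opTensor (.id ℂ K) (U.symm : E' →L[ℂ] E))

lemma conjTensorL_apply (U : E ≃ₗᵢ[ℂ] E') (T : HTensor K E →L[ℂ] HTensor K E) :
    conjTensorL K U T = conjTensor K U T := rfl

lemma conjTensor_opTensor (U : E ≃ₗᵢ[ℂ] E') (A : K →L[ℂ] K) (B : E →L[ℂ] E) :
    conjTensor K U (opTensor A B) = opTensor A (U.conjStarAlgEquiv B) := by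
  rw [conjTensor, ← opTensor_comp, ← opTensor_comp, ContinuousLinearMap.id_comp,
    ContinuousLinearMap.comp_id, LinearIsometryEquiv.conjStarAlgEquiv_apply]

lemma norm_opTensor_id_le (U : E ≃ₗᵢ[ℂ] E') :
    ‖opTensor (ContinuousLinearMap.id ℂ K) (U : E →L[ℂ] E')‖ ≤ 1 := by
  refine (norm_opTensor_le _ _).trans
    (mul_le_one₀ ContinuousLinearMap.norm_id_le (norm_nonneg _) ?_)
  exact ContinuousLinearMap.opNorm_le_bound _ zero_le_one fun x => by simp

lemma norm_matrixOp_conjTensor_le (U : E ≃ₗᵢ[ℂ] E') {p : ℕ}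
    (M : Fin p → Fin p → (HTensor K E →L[ℂ] HTensor K E)) :
    ‖matrixOp fun i j => conjTensor K U (M i j)‖ ≤ ‖matrixOp M‖ :=
  norm_matrixOp_comp_le M _ _ (norm_opTensor_id_le U) (norm_opTensor_id_le U.symm)

lemma conjTensorL_homogeneousPart (U : E ≃ₗᵢ[ℂ] E') (A : Coeffs n K) (X : OpTuple n E)
    (s : Fin k → ℤ) :
    conjTensorL K U (homogeneousPart A X s) = homogeneousPart A (conjTuple U X) s := by
  have h : ∀ α : MultiWord n, wordOp (conjTuple U X) α = U.conjStarAlgEquiv (wordOp X α) :=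
    wordOp_map (U.conjStarAlgEquiv : (E →L[ℂ] E) →+* (E' →L[ℂ] E')) X
  simp only [homogeneousPart, map_sum, conjTensorL_apply, conjTensor_opTensor, h]
  simp only [← ContinuousLinearMap.star_eq_adjoint, ← map_star]
  simp only [← ContinuousLinearMap.mul_def, ← map_mul]

lemma HasValue.conj (U : E ≃ₗᵢ[ℂ] E') {A : Coeffs n K} {X : OpTuple n E}
    {Y : HTensor K E →L[ℂ] HTensor K E} (h : HasValue A X Y) :
    HasValue A (conjTuple U X) (conjTensor K U Y) := by
  have h1 := HasIteratedSum.map_op (conjTensorL K U) h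
  simp only [conjTensorL_homogeneousPart] at h1
  exact h1

/-- The value of `F` at a tuple unitarily equivalent to an element of the radial part. -/
lemma IsValueAt.eq_conjTensor (U : E ≃ₗᵢ[ℂ] E') {F : radialPart n m E → minTensor K E}
    {X : radialPart n m E} {Y : HTensor K E' →L[ℂ] HTensor K E'}
    (h : IsValueAt F (conjTuple U X.1) Y) : Y = conjTensor K U (F X) := by
  obtain ⟨A, hA, hY⟩ := h
  exact hY.unique ((hA X).conj U)

end UnitaryTransport

/-! ### Unitary equivalence of `H` with the Fock space -/

section FockModel

variable {k : ℕ} {n : Fin k → ℕ}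

lemma infinite_multiWord (hk : 1 ≤ k) (hn : ∀ i, 1 ≤ n i) : Infinite (MultiWord n) := by
  have i₀ : Fin k := ⟨0, hk⟩
  refine Infinite.of_injective
    (fun q : ℕ => (fun i => List.replicate q ⟨0, hn i⟩ : MultiWord n)) fun a b hab => ?_
  simpa using congrArg List.length (congrFun hab i₀)

/-- Both spaces have countably infinite orthonormal bases; a bijection between the index sets
induces the unitary. -/
lemma nonempty_linearIsometryEquiv_fock (hk : 1 ≤ k) (hn : ∀ i, 1 ≤ n i) (H : Type*)
    [NormedAddCommGroup H] [InnerProductSpace ℂ H] [CompleteSpace H]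
    [TopologicalSpace.SeparableSpace H] (hH : ¬ FiniteDimensional ℂ H) :
    Nonempty (H ≃ₗᵢ[ℂ] Fock n) := by
  have := infinite_multiWord hk hn
  obtain ⟨w, b, hb⟩ := exists_hilbertBasis ℂ H
  have hinf : Infinite w := by
    by_contra hw
    have : Finite w := not_infinite_iff_finite.mp hw
    refine hH ?_
    have hspan := b.dense_span
    have hfd : FiniteDimensional ℂ (Submodule.span ℂ (Set.range b)) :=
      FiniteDimensional.span_of_finite ℂ (Set.finite_range b)
    rw [(Submodule.closed_of_finiteDimensional _).submodule_topologicalClosure_eq] at hspan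
    exact Module.finite_def.mpr (hspan ▸ (Submodule.fg_iff_finiteDimensional _).mpr hfd)
  have hcount : Countable w := by
    -- Distinct basis vectors are at distance `√2`, so balls of radius `1/2` around them are
    -- disjoint open sets, and separability allows only countably many.
    have hsep : ∀ i j : w, i ≠ j → 1 ≤ dist (b i) (b j) := fun i j hij => by
      have h1 : ‖b i - b j‖ ^ 2 = 2 := by
        rw [norm_sub_sq (𝕜 := ℂ), b.orthonormal.1, b.orthonormal.1, b.orthonormal.2 hij]
        norm_num
      rw [dist_eq_norm]
      nlinarith [norm_nonneg (b i - b j)]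
    refine Pairwise.countable_of_isOpen_disjoint (s := fun i => Metric.ball (b i) (1 / 2))
      (fun i j hij => Metric.ball_disjoint_ball ?_) (fun _ => Metric.isOpen_ball)
      fun i => ⟨b i, Metric.mem_ball_self (by norm_num)⟩
    have := hsep i j hij
    linarith
  obtain ⟨e₁⟩ := nonempty_denumerable (MultiWord n)
  obtain ⟨e₂⟩ := nonempty_denumerable w
  let e : MultiWord n ≃ w := (Denumerable.eqv (MultiWord n)).trans (Denumerable.eqv w).symm
  refine ⟨(HilbertBasis.mk (b.orthonormal.comp e e.injective) ?_).repr⟩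
  rw [e.surjective.range_comp]
  exact b.dense_span.ge

end FockModel

/-! ### Equivalence of the three conditions -/

section MainEquivalence

variable {k : ℕ} {n m : Fin k → ℕ}
  {H : Type*} [NormedAddCommGroup H] [InnerProductSpace ℂ H] [CompleteSpace H]
  {K : Type*} [NormedAddCommGroup K] [InnerProductSpace ℂ K]

/-- `F` is the Berezin transform of `T`. -/
def IsBerezinTransformOf (F : radialPart n m H → minTensor K H)
    (T : HTensor K (Fock n) →L[ℂ] HTensor K (Fock n)) : Prop :=
  ∀ X : radialPart n m H, (F X : HTensor K H →L[ℂ] HTensor K H) = berezinTransform m X.1 T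

lemma IsBerezinTransformOf.represents [CompleteSpace K] (hm : ∀ i, 1 ≤ m i) {F : radialPart n m H → minTensor K H}
    {T : HTensor K (Fock n) →L[ℂ] HTensor K (Fock n)} (hT : T ∈ modelSpace n m K)
    (h : IsBerezinTransformOf F T) : Represents (modelCoeffs m T) F := fun X => by
  rw [h X]
  exact hasValue_berezinL hm X.2 hT

lemma real_smul_universalModel_mem_radialPart (hm : ∀ i, 1 ≤ m i) {r : ℝ} (h0 : 0 ≤ r)
    (h1 : r < 1) : (r : ℂ) • universalModel n m ∈ radialPart n m (Fock n) :=
  real_smul_mem_radialPart (universalModel_mem_polyHyperball hm) h0 h1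

lemma IsBerezinTransformOf.isValueAt [CompleteSpace K] (hm : ∀ i, 1 ≤ m i) {F : radialPart n m H → minTensor K H}
    {T : HTensor K (Fock n) →L[ℂ] HTensor K (Fock n)} (hT : T ∈ modelSpace n m K)
    (h : IsBerezinTransformOf F T) {r : ℝ} (h0 : 0 ≤ r) (h1 : r < 1) :
    IsValueAt F ((r : ℂ) • universalModel n m)
      (berezinL m K ((r : ℂ) • universalModel n m) T) :=
  ⟨_, h.represents hm hT,
    hasValue_berezinL hm (real_smul_universalModel_mem_radialPart hm h0 h1) hT⟩

lemma IsBerezinTransformOf.hasRadialLimit [CompleteSpace K] (hm : ∀ i, 1 ≤ m i)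
    {F : radialPart n m H → minTensor K H} {T : HTensor K (Fock n) →L[ℂ] HTensor K (Fock n)}
    (hT : T ∈ modelSpace n m K) (h : IsBerezinTransformOf F T) : HasRadialLimit F T :=
  ⟨_, fun _ h0 h1 => h.isValueAt hm hT h0 h1, tendsto_berezinL_universalModel hm hT⟩

lemma IsBerezinTransformOf.hasContinuousExtension [CompleteSpace K] (hm : ∀ i, 1 ≤ m i)
    {F : radialPart n m H → minTensor K H} {T : HTensor K (Fock n) →L[ℂ] HTensor K (Fock n)}
    (hT : T ∈ modelSpace n m K) (h : IsBerezinTransformOf F T) : HasContinuousExtension F := by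
  obtain ⟨G, hG, hGT⟩ := exists_extension_berezinL (E := H) hm hT
  exact ⟨G, hG, fun X => Subtype.ext ((hGT X.1 X.2).trans (h X).symm)⟩

lemma HasRadialLimit.mem_modelSpace {F : radialPart n m H → minTensor K H}
    {T : HTensor K (Fock n) →L[ℂ] HTensor K (Fock n)} (h : HasRadialLimit F T) :
    T ∈ modelSpace n m K := by
  obtain ⟨G, hG, hlim⟩ := h
  refine mem_of_tendsto_op isClosed_modelSpace hlim (eventually_mem_unit_Ico.mono fun r hr => ?_)
  obtain ⟨A, -, hA⟩ := hG r hr.1 hr.2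
  exact hA.mem_modelSpace

/-- For `r < t < 1` the value `F(rY) = F(t · (r/t)Y)` is the transform of `F(t𝐖)` at `(r/t)Y`. As `t
→ 1` both the operator and the point converge, and the point stays in the radial part. -/
lemma HasRadialLimit.isBerezinTransformOf [CompleteSpace K] (hm : ∀ i, 1 ≤ m i)
    {F : radialPart n m H → minTensor K H} {T : HTensor K (Fock n) →L[ℂ] HTensor K (Fock n)}
    (h : HasRadialLimit F T) : IsBerezinTransformOf F T := by
  have hT := h.mem_modelSpace
  obtain ⟨G, hG, hlim⟩ := h
  rintro ⟨X, r, hr0, hr1, Y, hY, rfl⟩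
  have hev : ∀ᶠ t : ℝ in 𝓝[<] 1, r < t ∧ t < 1 := by
    filter_upwards [self_mem_nhdsWithin, mem_nhdsWithin_of_mem_nhds (Ioi_mem_nhds hr1)]
      with t h1 h0
    exact ⟨h0, h1⟩
  have hrad : ∀ t, r < t ∧ t < 1 → ((r / t : ℝ) : ℂ) • Y ∈ radialPart n m H := fun t ht =>
    real_smul_mem_radialPart hY (div_nonneg hr0 (hr0.trans ht.1.le))
      ((div_lt_one (hr0.trans_lt ht.1)).mpr ht.1)
  have hcont : Tendsto (fun t : ℝ => ((r / t : ℝ) : ℂ) • Y) (𝓝[<] 1) (𝓝 ((r : ℂ) • Y)) := by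
    have h1 : Tendsto (fun t : ℝ => r / t) (𝓝 1) (𝓝 (r / 1)) :=
      tendsto_const_nhds.div tendsto_id one_ne_zero
    rw [div_one] at h1
    exact ((Complex.continuous_ofReal.tendsto r).comp (h1.mono_left nhdsWithin_le_nhds)).smul_const Y
  have hX : (r : ℂ) • Y ∈ radialPart n m H := ⟨r, hr0, hr1, Y, hY, rfl⟩
  have hB := tendsto_op_of_contractions
    (hev.mono fun t ht => norm_berezinL_apply_le (K := K) hm (hrad t ht)) hlim
    (tendsto_berezinL_of_tendsto hm (hev.mono hrad) hX hcont hT)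
  have heq : ∀ t, r < t ∧ t < 1 → (F ⟨(r : ℂ) • Y, hX⟩ : HTensor K H →L[ℂ] HTensor K H) =
      berezinL m K (((r / t : ℝ) : ℂ) • Y) (G t) := fun t ht => by
    obtain ⟨A, hA, hAv⟩ := hG t (hr0.trans ht.1.le) ht.2
    have h1 := hAv.berezinL_smul hm (hrad t ht)
    rw [smul_smul, ← Complex.ofReal_mul, mul_div_cancel₀ r (hr0.trans_lt ht.1).ne'] at h1
    exact (hA ⟨_, hX⟩).unique h1
  exact tendsto_nhds_unique (tendsto_const_nhds.congr' (hev.mono heq)) hB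

/-- The unitary copy `W'` of `𝐖` on `H` lies in the closed poly-hyperball, so the extension is
continuous there. Its values along `rW' → W'`, transported back to the Fock space, are `F(r𝐖)`. -/
lemma HasContinuousExtension.exists_hasRadialLimit (hm : ∀ i, 1 ≤ m i) (U : H ≃ₗᵢ[ℂ] Fock n)
    {F : radialPart n m H → minTensor K H} (hF : IsFreePluriharmonic F)
    (h : HasContinuousExtension F) : ∃ T, HasRadialLimit F T := by
  obtain ⟨A, hA⟩ := hF
  obtain ⟨G, hG, hGF⟩ := h
  have hW' : conjTuple U.symm (universalModel n m) ∈ polyHyperball n m H :=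
    conjTuple_mem_polyHyperball U.symm (universalModel_mem_polyHyperball hm)
  have hUW : conjTuple U (conjTuple U.symm (universalModel n m)) = universalModel n m :=
    conjTuple_symm_conjTuple U.symm _
  set W' := conjTuple U.symm (universalModel n m)
  refine ⟨conjTensor K U (G W'), fun r => conjTensor K U (G ((r : ℂ) • W')),
    fun r h0 h1 => ⟨A, hA, ?_⟩, ?_⟩
  · have hr := real_smul_mem_radialPart hW' h0 h1
    have h2 := (hA ⟨_, hr⟩).conj U
    rw [conjTuple_smul, hUW] at h2
    rw [← hGF ⟨_, hr⟩] at h2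
    exact h2
  · have h2 : Tendsto (fun r : ℝ => (r : ℂ) • W') (𝓝[<] 1) (𝓝[polyHyperball n m H] W') :=
      tendsto_nhdsWithin_iff.mpr ⟨tendsto_real_smul W', eventually_mem_unit_Ico.mono fun r hr =>
        radialPart_subset_polyHyperball (real_smul_mem_radialPart hW' hr.1 hr.2)⟩
    exact ((conjTensorL K U).continuous.tendsto _).comp
      ((continuous_subtype_val.tendsto _).comp ((hG W' hW').tendsto.comp h2))

/-- `r𝐖` is unitarily equivalent to a tuple of operators on `H`. -/
lemma exists_conjTuple_eq_smul_universalModel (hm : ∀ i, 1 ≤ m i) (U : H ≃ₗᵢ[ℂ] Fock n) {r : ℝ}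
    (h0 : 0 ≤ r) (h1 : r < 1) :
    ∃ X : radialPart n m H, conjTuple U X.1 = (r : ℂ) • universalModel n m := by
  have hW' : conjTuple U.symm (universalModel n m) ∈ polyHyperball n m H :=
    conjTuple_mem_polyHyperball U.symm (universalModel_mem_polyHyperball hm)
  refine ⟨⟨_, real_smul_mem_radialPart hW' h0 h1⟩, ?_⟩
  rw [conjTuple_smul]
  exact congrArg _ (conjTuple_symm_conjTuple U.symm _)

/-- The representing coefficients in `HasRadialLimit` may vary with `r`. The value at `r𝐖` is
nevertheless determined by `F`, because `r𝐖` is unitarily equivalent to a tuple on `H`. -/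
lemma HasRadialLimit.unique (hm : ∀ i, 1 ≤ m i) (U : H ≃ₗᵢ[ℂ] Fock n)
    {F : radialPart n m H → minTensor K H} {T T' : HTensor K (Fock n) →L[ℂ] HTensor K (Fock n)}
    (h : HasRadialLimit F T) (h' : HasRadialLimit F T') : T = T' := by
  obtain ⟨G, hG, hlim⟩ := h
  obtain ⟨G', hG', hlim'⟩ := h'
  refine tendsto_nhds_unique hlim (hlim'.congr' (eventually_mem_unit_Ico.mono fun r hr => ?_))
  obtain ⟨X, hX⟩ := exists_conjTuple_eq_smul_universalModel hm U hr.1 hr.2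
  have h1 := hG r hr.1 hr.2
  have h2 := hG' r hr.1 hr.2
  rw [← hX] at h1 h2
  exact (h2.eq_conjTensor U).trans (h1.eq_conjTensor U).symm

end MainEquivalence

lemma norm_op_le_of_tendsto {P Q : Type*} [NormedAddCommGroup P] [InnerProductSpace ℂ P]
    [NormedAddCommGroup Q] [InnerProductSpace ℂ Q] {ι : Type*} {l : Filter ι} [l.NeBot]
    {M : ι → (P →L[ℂ] Q)} {T : P →L[ℂ] Q} {c : ℝ} (h : Tendsto M l (𝓝 T))
    (hM : ∀ᶠ r in l, ‖M r‖ ≤ c) : ‖T‖ ≤ c :=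
  le_of_tendsto h.norm hM

lemma norm_matrixOp_le_of_tendsto {P : Type*} [NormedAddCommGroup P] [InnerProductSpace ℂ P]
    {ι : Type*} {l : Filter ι} [l.NeBot] {p : ℕ} {M : ι → Fin p → Fin p → (P →L[ℂ] P)}
    {T : Fin p → Fin p → (P →L[ℂ] P)} {c : ℝ}
    (h : ∀ i j, Tendsto (fun r => M r i j) l (𝓝 (T i j))) (hM : ∀ᶠ r in l, ‖matrixOp (M r)‖ ≤ c) :
    ‖matrixOp T‖ ≤ c := by
  have h1 : Tendsto M l (𝓝 T) :=
    tendsto_pi_nhds.mpr fun i => tendsto_pi_nhds.mpr fun j => h i j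
  exact norm_op_le_of_tendsto ((continuous_matrixOp.tendsto T).comp h1) hM

/-! ### The completely isometric isomorphism -/

section CompleteIsometry

universe u v

variable {k : ℕ} {n m : Fin k → ℕ}
  {H : Type u} [NormedAddCommGroup H] [InnerProductSpace ℂ H] [CompleteSpace H]
  {K : Type v} [NormedAddCommGroup K] [InnerProductSpace ℂ K] [CompleteSpace K]

lemma exists_isBerezinTransformOf_of_mem (hm : ∀ i, 1 ≤ m i) (U : H ≃ₗᵢ[ℂ] Fock n)
    {F : radialPart n m H → minTensor K H} (hF : F ∈ continuousPluriharmonic n m K H) :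
    ∃ T ∈ modelSpace n m K, IsBerezinTransformOf F T := by
  obtain ⟨A, hA, hE⟩ := hF
  obtain ⟨G, hG, hGc⟩ := hE H
  -- The extension property is used on `E = H`, where the representation with the same coefficients
  -- can only be `F`.
  have hGF : G = F := funext fun X => Subtype.ext ((hG X).unique (hA X))
  obtain ⟨T, hT⟩ := (hGF ▸ hGc).exists_hasRadialLimit hm U ⟨A, hA⟩
  exact ⟨T, hT.mem_modelSpace, hT.isBerezinTransformOf hm⟩

variable (H K) in
/-- The Berezin transform of an element of `𝓖`, as a function on the radial poly-hyperball. -/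
noncomputable def berezinFunction (hm : ∀ i, 1 ≤ m i) (T : modelSpace n m K) :
    radialPart n m H → minTensor K H :=
  fun X => ⟨berezinL m K X.1 T.1, berezinL_mem_minTensor hm X.2 T.2⟩

lemma isBerezinTransformOf_berezinFunction (hm : ∀ i, 1 ≤ m i) (T : modelSpace n m K) :
    IsBerezinTransformOf (berezinFunction H K hm T) T.1 := fun _ => rfl

variable (H K) in
/-- The Berezin transform as a linear map of `𝓖` into `PH_K^c`. -/
noncomputable def berezinₗ (hm : ∀ i, 1 ≤ m i) :
    modelSpace n m K →ₗ[ℂ] continuousPluriharmonic n m K H where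
  toFun T := ⟨berezinFunction H K hm T, modelCoeffs m T.1,
    (isBerezinTransformOf_berezinFunction hm T).represents hm T.2, fun E _ _ _ =>
    ⟨berezinFunction E K hm T, (isBerezinTransformOf_berezinFunction hm T).represents hm T.2,
      (isBerezinTransformOf_berezinFunction hm T).hasContinuousExtension hm T.2⟩⟩
  map_add' T T' := Subtype.ext (funext fun X => Subtype.ext (map_add (berezinL m K X.1) T.1 T'.1))
  map_smul' c T := Subtype.ext (funext fun X => Subtype.ext (map_smul (berezinL m K X.1) c T.1))

lemma bijective_berezinₗ (hm : ∀ i, 1 ≤ m i) (U : H ≃ₗᵢ[ℂ] Fock n) :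
    Function.Bijective (berezinₗ (n := n) H K hm) := by
  constructor
  · intro T T' h
    have h1 : berezinFunction H K hm T = berezinFunction H K hm T' := congrArg Subtype.val h
    exact Subtype.ext (((isBerezinTransformOf_berezinFunction hm T).hasRadialLimit hm T.2).unique
      hm U (h1 ▸ (isBerezinTransformOf_berezinFunction hm T').hasRadialLimit hm T'.2))
  · rintro ⟨F, hF⟩
    obtain ⟨T, hT, h⟩ := exists_isBerezinTransformOf_of_mem hm U hF
    exact ⟨⟨T, hT⟩, Subtype.ext (funext fun X => Subtype.ext (h X).symm)⟩

variable (H K) in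
/-- The identification of `𝓖` with `PH_K^c` given by the Berezin transform. -/
noncomputable def berezinEquiv (hm : ∀ i, 1 ≤ m i) (U : H ≃ₗᵢ[ℂ] Fock n) :
    modelSpace n m K ≃ₗ[ℂ] continuousPluriharmonic n m K H :=
  LinearEquiv.ofBijective (berezinₗ H K hm) (bijective_berezinₗ hm U)

lemma isBerezinTransformOf_berezinEquiv_symm (hm : ∀ i, 1 ≤ m i) (U : H ≃ₗᵢ[ℂ] Fock n)
    (F : continuousPluriharmonic n m K H) :
    IsBerezinTransformOf F.1 ((berezinEquiv H K hm U).symm F).1 := by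
  have h : (berezinFunction H K hm ((berezinEquiv H K hm U).symm F)) = F.1 :=
    congrArg Subtype.val ((berezinEquiv H K hm U).apply_symm_apply F)
  exact h ▸ isBerezinTransformOf_berezinFunction hm _

/-- Every coefficient family of a Berezin transform has the expected values at `r𝐖`. -/
lemma Represents.hasValue_universalModel (hm : ∀ i, 1 ≤ m i) (U : H ≃ₗᵢ[ℂ] Fock n)
    {F : radialPart n m H → minTensor K H} {A : Coeffs n K} (hA : Represents A F)
    {T : HTensor K (Fock n) →L[ℂ] HTensor K (Fock n)} (hT : T ∈ modelSpace n m K)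
    (h : IsBerezinTransformOf F T) {r : ℝ} (h0 : 0 ≤ r) (h1 : r < 1) :
    HasValue A ((r : ℂ) • universalModel n m)
      (berezinL m K ((r : ℂ) • universalModel n m) T) := by
  obtain ⟨X, hX⟩ := exists_conjTuple_eq_smul_universalModel hm U h0 h1
  have h2 := h.isValueAt hm hT h0 h1
  rw [← hX] at h2 ⊢
  rw [h2.eq_conjTensor U]
  exact (hA X).conj U

/-- Writing `X = tZ` gives `F(X)` as the transform at `Z` of the transform of `T` at `t𝐖`, a
composition of two complete contractions. Passing through `t𝐖` makes the argument valid for any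
coefficients representing `F`. -/
lemma norm_matrixOp_value_le (hm : ∀ i, 1 ≤ m i) (U : H ≃ₗᵢ[ℂ] Fock n) {p : ℕ}
    {F : Fin p → Fin p → (radialPart n m H → minTensor K H)}
    {T : Fin p → Fin p → (HTensor K (Fock n) →L[ℂ] HTensor K (Fock n))}
    (hT : ∀ i j, T i j ∈ modelSpace n m K) (h : ∀ i j, IsBerezinTransformOf (F i j) (T i j))
    {E : Type*} [NormedAddCommGroup E] [InnerProductSpace ℂ E] [CompleteSpace E]
    {X : OpTuple n E} (hX : X ∈ radialPart n m E)
    {Y : Fin p → Fin p → (HTensor K E →L[ℂ] HTensor K E)}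
    (hY : ∀ i j, IsValueAt (F i j) X (Y i j)) : ‖matrixOp Y‖ ≤ ‖matrixOp T‖ := by
  obtain ⟨t, h0, h1, Z, hZ, rfl⟩ := exists_radial_factor hX
  have hYZ : Y = fun i j => berezinL m K Z (berezinL m K ((t : ℂ) • universalModel n m) (T i j)) :=
    funext fun i => funext fun j => by
      obtain ⟨A, hA, hAY⟩ := hY i j
      exact hAY.unique
        ((hA.hasValue_universalModel hm U (hT i j) (h i j) h0 h1).berezinL_smul hm hZ)
  rw [hYZ]
  exact (norm_matrixOp_berezinL_le hm hZ _).trans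
    (norm_matrixOp_berezinL_le hm (real_smul_universalModel_mem_radialPart hm h0 h1) _)

/-- The upper bound is complete contractivity. It is least because the copies of `r𝐖` on `H` are
admissible test tuples, and the transforms at `r𝐖` converge to `T` as `r → 1`. -/
lemma isLUB_matrixValueNorms (hm : ∀ i, 1 ≤ m i) (U : H ≃ₗᵢ[ℂ] Fock n) {p : ℕ}
    {F : Fin p → Fin p → (radialPart n m H → minTensor K H)}
    {T : Fin p → Fin p → (HTensor K (Fock n) →L[ℂ] HTensor K (Fock n))}
    (hT : ∀ i j, T i j ∈ modelSpace n m K) (h : ∀ i j, IsBerezinTransformOf (F i j) (T i j)) :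
    IsLUB (matrixValueNorms F) ‖matrixOp T‖ := by
  constructor
  · rintro c ⟨E, _, _, _, X, Y, hX, hY, rfl⟩
    exact norm_matrixOp_value_le hm U hT h hX hY
  · intro c hc
    have hle : ∀ r : ℝ, 0 ≤ r ∧ r < 1 →
        ‖matrixOp fun i j => berezinL m K ((r : ℂ) • universalModel n m) (T i j)‖ ≤ c :=
        fun r hr => by
      obtain ⟨X, hX⟩ := exists_conjTuple_eq_smul_universalModel hm U hr.1 hr.2
      have h1 : (fun i j => berezinL m K ((r : ℂ) • universalModel n m) (T i j)) =
          fun i j => conjTensor K U (F i j X) := funext fun i => funext fun j => by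
        have h2 := (h i j).isValueAt hm (hT i j) hr.1 hr.2
        rw [← hX] at h2 ⊢
        exact h2.eq_conjTensor U
      rw [h1]
      refine (norm_matrixOp_conjTensor_le U _).trans (hc ⟨H, _, _, _, X.1, _, X.2,
        fun i j => ⟨_, (h i j).represents hm (hT i j), (h i j).represents hm (hT i j) X⟩, rfl⟩)
    exact norm_matrixOp_le_of_tendsto
      (fun i j => tendsto_berezinL_universalModel hm (hT i j)) (eventually_mem_unit_Ico.mono hle)

end CompleteIsometry

end PolyHyperball

theorem mainTheorem4 {k : ℕ} (hk : 1 ≤ k) (n m : Fin k → ℕ)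
    (hn : ∀ i, 1 ≤ n i) (hm : ∀ i, 1 ≤ m i)
    (K : Type*) [NormedAddCommGroup K] [InnerProductSpace ℂ K] [CompleteSpace K]
    (H : Type*) [NormedAddCommGroup H] [InnerProductSpace ℂ H] [CompleteSpace H]
    [TopologicalSpace.SeparableSpace H] (hH : ¬ FiniteDimensional ℂ H) :
    (∀ F : radialPart n m H → minTensor K H,
      List.TFAE [
        IsFreePluriharmonic F ∧ ∃ T, HasRadialLimit F T,
        ∃ T ∈ modelSpace n m K, ∀ X : radialPart n m H,
          (F X : HTensor K H →L[ℂ] HTensor K H) = berezinTransform m X.1 T,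
        IsFreePluriharmonic F ∧ HasContinuousExtension F] ∧
      ∀ T ∈ modelSpace n m K,
        (∀ X : radialPart n m H,
          (F X : HTensor K H →L[ℂ] HTensor K H) = berezinTransform m X.1 T) →
        HasRadialLimit F T) ∧
    ∃ Φ : continuousPluriharmonic n m K H ≃ₗ[ℂ] modelSpace n m K,
      (∀ F : continuousPluriharmonic n m K H, HasRadialLimit F.1 (Φ F).1) ∧
      ∀ (p : ℕ) (F : Fin p → Fin p → continuousPluriharmonic n m K H),
        IsLUB (matrixValueNorms fun i j => (F i j).1) ‖matrixOp fun i j => (Φ (F i j)).1‖ := by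
  have U : H ≃ₗᵢ[ℂ] Fock n := Classical.choice (nonempty_linearIsometryEquiv_fock hk hn H hH)
  refine ⟨fun F => ⟨?_, fun T hT h => IsBerezinTransformOf.hasRadialLimit hm hT h⟩, ?_⟩
  · tfae_have 1 → 2 := fun ⟨_, T, hT⟩ => ⟨T, hT.mem_modelSpace, hT.isBerezinTransformOf hm⟩
    tfae_have 2 → 3 := fun ⟨T, hT, h⟩ =>
      ⟨⟨_, IsBerezinTransformOf.represents hm hT h⟩,
        IsBerezinTransformOf.hasContinuousExtension hm hT h⟩
    tfae_have 3 → 1 := fun ⟨hF, hc⟩ => ⟨hF, hc.exists_hasRadialLimit hm U hF⟩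
    tfae_finish
  -- `Φ` is taken to be the inverse of the Berezin transform on `𝓖`; that it is the radial limit
  -- then follows from radial convergence of Berezin transforms.
  · have he := isBerezinTransformOf_berezinEquiv_symm (K := K) hm U
    exact ⟨(berezinEquiv H K hm U).symm, fun F => (he F).hasRadialLimit hm (Subtype.prop _),
      fun p F => isLUB_matrixValueNorms hm U (fun i j => Subtype.prop _) fun i j => he (F i j)⟩
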